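/- **Setting.** Let $\omega_A,\omega_B\in\mathbb C$ be linearly independent over $\mathbb R$, $L=\mathbb Z\omega_A+\mathbb Z\omega_B$, and let $\wp,\zeta$ be the Weierstrass functions of $L$, with invariants $g_2=-2t$, $g_3=-u$. The marked Weierstrass spectral curve is $\Sigma=\mathbb C/L$ with $x(z)=\wp(z)$, $y(z)=\wp'(z)$, so that $y^2=4x^3-g_2x-g_3$, and with discriminant $\Delta=g_2^3-27g_3^2=-8t^3-27u^2$. Put $\sigma(z)=-z$, $\eta_A=-\oint_A x\,dx/y$, $S=\eta_A/\omega_A$, $\nu=\frac1{2\pi i}\oint_A y\,dx$, and $R=\{\omega_A/2,\ \omega_B/2,\ (\omega_A+\omega_B)/2\}$. The topological recursion correlators $W_{g,n}$ ($g\ge0$, $n\ge1$) are defined by $$W_{0,1}(z_1)=y(z_1)\,dx(z_1),\qquad W_{0,2}(z_1,z_2)=(\wp(z_1-z_2)+S)\,dz_1dz_2,$$ and, by induction on $\chi_{g,n}=2g-2+n\ge1$, $$W_{g,n}(z_1,\dots,z_n)=\sum_{r\in R}\operatorname*{res}_{z=r}K(z_1,z)\Big[W_{g-1,n+1}(z,\sigma(z),z_2,\dots,z_n)+\sum_{g_1+g_2=g,\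 I\sqcup J=\{2,\dots,n\}}^{\prime}W_{g_1,|I|+1}(z,z_I)\,W_{g_2,|J|+1}(\sigma(z),z_J)\Big].$$ Here the prime excludes the terms with $(g_1,I)=(0,\emptyset)$ or $(g_2,J)=(0,\emptyset)$, the first term is absent for $g=0$, and $$K(z_1,z)=\frac{\int_{w=\tilde z}^{w=z}W_{0,2}(z_1,w)}{(y(z)-y(\sigma(z)))\,dx(z)}=\frac{P(z_1-\tilde z)-P(z_1-z)}{2\wp'(z)^2}\,\frac{dz_1}{dz},\qquad P(z)=-\zeta(z)+Sz,$$ with an arbitrary base point $\tilde z$. For $r>0$ let $\varrho_r$ be the scaling $(z,t,\nu)\mapsto(r^{-1/5}z,\,r^{4/5}t,\,r\nu)$ (all $z_i$ are scaled alike); on marked curves it is $(\omega_A,\omega_B)\mapsto(r^{-1/5}\omega_A,r^{-1/5}\omega_B)$. Let $(\varrho_r)_*f=f\circ\varrho_r$ on functions $f$. **Proposition.** Let $g\ge0$ and $n\ge1$ with $\chi_{g,n}=2g-2+n\ge1$. There are polynomials $w_{g,n,k}$ ($0\le k\le 3g-3+2n$) in $n+2$ variables with constant complex coefficients (the same for all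 curves and all base points) such that, as an identity of meromorphic multi-differentials (that is, at all $z_1,\dots,z_n$ with $2z_i\notin L$), $$W_{g,n}(z_1,\dots,z_n)=\frac{\sum_{k=0}^{3g-3+2n}w_{g,n,k}(t,u,x(z_1),\dots,x(z_n))\,S^k}{\Delta^{2g-2+n}\prod_{i=1}^n y(z_i)^{6g-4+2n}}\,dz_1\cdots dz_n .$$ Moreover each $w_{g,n,k}$ is weighted homogeneous of weight $14g-14-2k+2n(9g+3n-2)$, where $t,u,x_1,\dots,x_n$ have weights $4,6,2,\dots,2$; that is, for all $r>0$, $$(\varrho_r)_*\,w_{g,n,k}=r^{\frac15\left(14g-14-2k+2n(9g+3n-2)\right)}\,w_{g,n,k}.$$ -/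

import Mathlib

open Filter Topology

noncomputable section

namespace WeierstrassTR

/-! ### The Weierstrass spectral curve

A Torelli-marked Weierstrass curve is given by a pair of periods `(ω₁, ω₂) = (ω_A, ω_B)`: the Riemann
surface is `Σ = ℂ / (ℤ ω_A + ℤ ω_B)`, with `x = ℘` and `y = ℘'`, so that `y² = 4x³ - g₂ x - g₃`. -/

/-- The parameter `t` of the curve `y² = 4x³ + 2t x + u`, that is `g₂ = -2t`. -/
def tPar (L : PeriodPair) : ℂ := -L.g₂ / 2

/-- The parameter `u` of the curve `y² = 4x³ + 2t x + u`, that is `g₃ = -u`. -/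
def uPar (L : PeriodPair) : ℂ := -L.g₃

/-- The discriminant `Δ = g₂³ - 27 g₃² = -8t³ - 27u²`. -/
def disc (L : PeriodPair) : ℂ := L.g₂ ^ 3 - 27 * L.g₃ ^ 2

/-- The integral of `f(z) dz` over the `A`-cycle, represented by the straight path from
`ω_B / 2` to `ω_B / 2 + ω_A`. (It avoids the lattice; its image under `x` is a loop through
`e₂ = x(ω_B / 2)` and `e₃ = x((ω_A + ω_B) / 2)`.) -/
def periodA (L : PeriodPair) (f : ℂ → ℂ) : ℂ :=
  ∫ s in (0 : ℝ)..1, f (L.ω₂ / 2 + s * L.ω₁) * L.ω₁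

/-- `η_A = -∮_A x dx / y`; note that `dx / y = dz`. -/
def etaA (L : PeriodPair) : ℂ := -periodA L L.weierstrassP

/-- `S = η_A / ω_A`. -/
def S (L : PeriodPair) : ℂ := etaA L / L.ω₁

/-- The normalized period `ν = (2πi)⁻¹ ∮_A y dx`; note that `y dx = ℘'(z)² dz`. -/
def nu (L : PeriodPair) : ℂ :=
  (2 * Real.pi * Complex.I)⁻¹ * periodA L (fun z => L.derivWeierstrassP z ^ 2)

/-- The Weierstrass zeta function
`ζ(z) = 1/z + ∑_{ω ≠ 0} (1/(z - ω) + 1/ω + z/ω²)`. Since `1/0 = 0`, the summand at `ω = 0` of the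
series below is `1/z`. -/
def zeta (L : PeriodPair) (z : ℂ) : ℂ :=
  ∑' l : L.lattice, (1 / (z - l) + 1 / (l : ℂ) + z / (l : ℂ) ^ 2)

theorem hasDerivAt_zeta (L : PeriodPair) {z : ℂ} (hz : z ∉ L.lattice) :
    HasDerivAt (zeta L) (-L.weierstrassP z) z := by
  have hopen : IsOpen (L.latticeᶜ : Set ℂ) := L.isClosed_lattice.isOpen_compl
  have hS : HasSumLocallyUniformly
      (fun (l : L.lattice) (z : ℂ) => 1 / (z - l) + 1 / (l : ℂ) + z / (l : ℂ) ^ 2) (zeta L) := by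
    refine L.hasSumLocallyUniformly_aux (u := (2 * · ^ 2 * ‖·‖ ^ (-3 : ℝ))) _
      (fun _ _ ↦ (ZLattice.summable_norm_rpow _ _ (by simp; norm_num)).mul_left _) fun r hr ↦
      Filter.eventually_atTop.mpr ⟨2 * r, ?_⟩
    rintro _ h s hs l rfl
    have h1 : (l : ℂ) ≠ 0 := by
      intro h0
      rw [h0, norm_zero] at h; linarith
    have h2 : ‖(l : ℂ)‖ / 2 ≤ ‖s - l‖ := by
      rw [norm_sub_rev]
      exact .trans (by linarith) (norm_sub_norm_le (l : ℂ) s)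
    have h0 : 0 < ‖(l : ℂ)‖ := norm_pos_iff.mpr h1
    have h3 : s - l ≠ 0 := by
      rw [← norm_pos_iff]; linarith
    have : 1 / (s - l) + 1 / (l : ℂ) + s / (l : ℂ) ^ 2 = s ^ 2 / ((s - l) * l ^ 2) := by
      field_simp; ring
    rw [this, norm_div, norm_mul, norm_pow, norm_pow]
    calc ‖s‖ ^ 2 / (‖s - l‖ * ‖(l : ℂ)‖ ^ 2) ≤ r ^ 2 / (‖(l : ℂ)‖ / 2 * ‖(l : ℂ)‖ ^ 2) := by gcongr
      _ = 2 * r ^ 2 * ‖(l : ℂ)‖ ^ (-3 : ℝ) := by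
        rw [Real.rpow_neg h0.le]; norm_cast; field_simp
  have hd : ∀ (l : L.lattice), ∀ w ∈ (L.latticeᶜ : Set ℂ),
      HasDerivAt (fun z : ℂ => 1 / (z - l) + 1 / (l : ℂ) + z / (l : ℂ) ^ 2)
        (-(1 / (w - l) ^ 2 - 1 / (l : ℂ) ^ 2)) w := by
    intro l w hw
    have hne : w - l ≠ 0 := fun e => hw (by rw [sub_eq_zero.mp e]; exact l.2)
    have h1 := ((hasDerivAt_id w).sub_const (l : ℂ)).inv hne
    have h2 := (h1.add_const (1 / (l : ℂ))).add ((hasDerivAt_id w).div_const ((l : ℂ) ^ 2))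
    have e1 : (fun z : ℂ => 1 / (z - l) + 1 / (l : ℂ) + z / (l : ℂ) ^ 2) =
        ((fun x => (fun x => id x - (l : ℂ))⁻¹ x + 1 / (l : ℂ)) + fun x => id x / (l : ℂ) ^ 2) := by
      funext z; simp [one_div]
    have e2 : -(1 / (w - l) ^ 2 - 1 / (l : ℂ) ^ 2) =
        -1 / (id w - (l : ℂ)) ^ 2 + 1 / (l : ℂ) ^ 2 := by
      simp only [id]; ring
    rw [e1, e2]; exact h2
  have hsum : ∀ (s : Finset L.lattice), ∀ w ∈ (L.latticeᶜ : Set ℂ),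
      HasDerivAt (fun z : ℂ => ∑ l ∈ s, (1 / (z - l) + 1 / (l : ℂ) + z / (l : ℂ) ^ 2))
        (-∑ l ∈ s, (1 / (w - l) ^ 2 - 1 / (l : ℂ) ^ 2)) w := by
    intro s w hw
    rw [← Finset.sum_neg_distrib]
    exact HasDerivAt.fun_sum fun l _ => hd l w hw
  refine hasDerivAt_of_tendstoLocallyUniformlyOn hopen
    (f := fun (s : Finset L.lattice) (z : ℂ) =>
      ∑ l ∈ s, (1 / (z - l) + 1 / (l : ℂ) + z / (l : ℂ) ^ 2))
    (f' := fun (s : Finset L.lattice) (z : ℂ) => -∑ l ∈ s, (1 / (z - l) ^ 2 - 1 / (l : ℂ) ^ 2))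
    (g := zeta L) (g' := fun z => -L.weierstrassP z) (l := atTop) ?_ ?_ ?_ hz
  · have := L.hasSumLocallyUniformly_weierstrassP.tendstoLocallyUniformlyOn (s := (L.latticeᶜ : Set ℂ))
    exact this.neg
  · exact Filter.Eventually.of_forall hsum
  · intro w _
    exact hS.hasSum

/-- `P(z) = -ζ(z) + S z`, a primitive of `℘(z) + S`. -/
def P (L : PeriodPair) (z : ℂ) : ℂ := -zeta L z + S L * z

/-- The three ramification points: the half-periods `ω_A/2`, `ω_B/2`, `(ω_A + ω_B)/2`. -/
def ram (L : PeriodPair) : Fin 3 → ℂ := ![L.ω₁ / 2, L.ω₂ / 2, (L.ω₁ + L.ω₂) / 2]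

/-! ### Topological recursion -/

/-- The residue at `a` of the differential `f(z) dz`: the limit, as `ρ → 0+`, of
`(2πi)⁻¹ ∮_{|z - a| = ρ} f(z) dz`. -/
def residue (f : ℂ → ℂ) (a : ℂ) : ℂ :=
  limUnder (𝓝[>] (0 : ℝ)) fun ρ => (2 * Real.pi * Complex.I)⁻¹ * ∮ z in C(a, ρ), f z

/-- The coefficient of `dz₁ dz₂` in the Bergman bidifferential
`W_{0,2} = (℘(z₁ - z₂) + S) dz₁ dz₂`. -/
def bergman (L : PeriodPair) (z₁ z₂ : ℂ) : ℂ := L.weierstrassP (z₁ - z₂) + S L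

/-- The coefficient of `dz₁` in the integral `∫_{w = b}^{w = z} W_{0,2}(z₁, w)`; see
`bergmanIntegral_self` and `hasDerivAt_bergmanIntegral`. -/
def bergmanIntegral (L : PeriodPair) (b z₁ z : ℂ) : ℂ := P L (z₁ - b) - P L (z₁ - z)

theorem bergmanIntegral_self (L : PeriodPair) (b z₁ : ℂ) : bergmanIntegral L b z₁ b = 0 := by
  simp [bergmanIntegral]

theorem hasDerivAt_bergmanIntegral (L : PeriodPair) (b z₁ : ℂ) {z : ℂ} (hz : z₁ - z ∉ L.lattice) :
    HasDerivAt (bergmanIntegral L b z₁) (bergman L z₁ z) z := by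
  have h1 : HasDerivAt (fun w : ℂ => z₁ - w) (-1) z := by
    simpa using (hasDerivAt_id z).const_sub z₁
  have h2 := (hasDerivAt_zeta L hz).comp z h1
  have h3 := ((h2.neg.add (h1.const_mul (S L))).const_sub (P L (z₁ - b)))
  have e : bergman L z₁ z = -(-(-L.weierstrassP (z₁ - z) * -1) + S L * -1) := by
    simp only [bergman]; ring
  rw [e]; exact h3

/-- The recursion kernel with base point `b`: the coefficient of `dz₁ (dz)⁻¹` in
`K(z₁, z) = (∫_{w = b}^{w = z} W_{0,2}(z₁, w)) / ((y(z) - y(σ(z))) dx(z))`, where `σ(z) = -z` and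
`dx(z) = y(z) dz`. -/
def kernel (L : PeriodPair) (b z₁ z : ℂ) : ℂ :=
  bergmanIntegral L b z₁ z /
    ((L.derivWeierstrassP z - L.derivWeierstrassP (-z)) * L.derivWeierstrassP z)

/-- The tuple `z_I`, the entries of `z` with index in `I` in increasing order. -/
def restrict {m : ℕ} (z : Fin m → ℂ) (I : Finset (Fin m)) : Fin I.card → ℂ :=
  fun i => z (I.orderEmbOfFin rfl i)

theorem measure_left {g m a : ℕ} (ha : a < g + 1) (I : Finset (Fin m))
    (h : ¬ (g - a = 0 ∧ Iᶜ = ∅)) : 2 * a + (I.card + 1) < 2 * g + (m + 1) := by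
  have h2 : I.card + Iᶜ.card = m := by simp [Finset.card_add_card_compl]
  by_cases h3 : Iᶜ = ∅
  · have : g - a ≠ 0 := fun h' => h ⟨h', h3⟩
    omega
  · have : 0 < Iᶜ.card := Finset.card_pos.mpr (Finset.nonempty_iff_ne_empty.mpr h3)
    omega

theorem measure_right {g m a : ℕ} (ha : a < g + 1) (I : Finset (Fin m))
    (h : ¬ (a = 0 ∧ I = ∅)) : 2 * (g - a) + (Iᶜ.card + 1) < 2 * g + (m + 1) := by
  have h2 : I.card + Iᶜ.card = m := by simp [Finset.card_add_card_compl]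
  by_cases h3 : I = ∅
  · have : a ≠ 0 := fun h' => h ⟨h', h3⟩
    omega
  · have : 0 < I.card := Finset.card_pos.mpr (Finset.nonempty_iff_ne_empty.mpr h3)
    omega

/-- The topological recursion correlators: `correlator L b g n` is the coefficient of `dz₁ ⋯ dzₙ` in
`W_{g,n}` (`n ≥ 1`), computed with base point `b` in the recursion kernel.
In the recursion, `W(z, …) W(σ(z), …)` involves `dz · d(-z) = -(dz)²`, whence the minus sign. The value
at `n = 0` is not used. -/
def correlator (L : PeriodPair) (b : ℂ) : (g n : ℕ) → (Fin n → ℂ) → ℂ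
  | _, 0, _ => 0
  | 0, 1, z => L.derivWeierstrassP (z 0) * L.derivWeierstrassP (z 0)
  | 0, 2, z => bergman L (z 0) (z 1)
  | g, m + 1, z =>
    ∑ i : Fin 3, residue (fun v : ℂ => kernel L b (z 0) v *
      -((if _h : 1 ≤ g then
            correlator L b (g - 1) (m + 2) (Matrix.vecCons v (Matrix.vecCons (-v) (Matrix.vecTail z)))
          else 0) +
        ∑ g₁ : Fin (g + 1), ∑ I : Finset (Fin m),
          if _h : ¬ ((g₁ : ℕ) = 0 ∧ I = ∅) ∧ ¬ (g - g₁ = 0 ∧ Iᶜ = ∅) then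
            correlator L b g₁ (I.card + 1) (Matrix.vecCons v (restrict (Matrix.vecTail z) I)) *
            correlator L b (g - g₁) (Iᶜ.card + 1)
              (Matrix.vecCons (-v) (restrict (Matrix.vecTail z) Iᶜ))
          else 0)) (ram L i)
  termination_by g n => 2 * g + n
  decreasing_by
    · omega
    · exact measure_left g₁.isLt I _h.2
    · exact measure_right g₁.isLt I _h.1

theorem correlator_zero_one (L : PeriodPair) (b : ℂ) (z : Fin 1 → ℂ) :
    correlator L b 0 1 z = L.derivWeierstrassP (z 0) * L.derivWeierstrassP (z 0) := by
  rw [correlator.eq_def]; rfl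

theorem correlator_zero_two (L : PeriodPair) (b : ℂ) (z : Fin 2 → ℂ) :
    correlator L b 0 2 z = bergman L (z 0) (z 1) := by
  rw [correlator.eq_def]; rfl

/-- The recursion, valid for `2g - 2 + n ≥ 1` with `n = m + 1`. -/
theorem correlator_rec (L : PeriodPair) (b : ℂ) (g m : ℕ) (h : 2 ≤ 2 * g + m)
    (z : Fin (m + 1) → ℂ) :
    correlator L b g (m + 1) z =
      ∑ i : Fin 3, residue (fun v : ℂ => kernel L b (z 0) v *
        -((if 1 ≤ g then
            correlator L b (g - 1) (m + 2) (Matrix.vecCons v (Matrix.vecCons (-v) (Matrix.vecTail z)))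
          else 0) +
        ∑ g₁ : Fin (g + 1), ∑ I : Finset (Fin m),
          if ¬ ((g₁ : ℕ) = 0 ∧ I = ∅) ∧ ¬ (g - g₁ = 0 ∧ Iᶜ = ∅) then
            correlator L b g₁ (I.card + 1) (Matrix.vecCons v (restrict (Matrix.vecTail z) I)) *
            correlator L b (g - g₁) (Iᶜ.card + 1)
              (Matrix.vecCons (-v) (restrict (Matrix.vecTail z) Iᶜ))
          else 0)) (ram L i) := by
  rw [correlator.eq_def]
  rcases g with _ | g
  · rcases m with _ | _ | m
    · omega
    · omega
    · rfl
  · rcases m with _ | _ | m <;> rfl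

/-! ### Scaling -/

/-- The pair of periods `(c ω₁, c ω₂)`. -/
def scale (c : ℂ) (hc : c ≠ 0) (L : PeriodPair) : PeriodPair where
  ω₁ := c * L.ω₁
  ω₂ := c * L.ω₂
  indep := by
    have h := LinearIndependent.pair_iff.mp L.indep
    refine LinearIndependent.pair_iff.mpr fun s t hst => h s t ?_
    have : c * (s • L.ω₁ + t • L.ω₂) = 0 := by
      rw [← hst]; simp only [Complex.real_smul]; ring
    exact (mul_eq_zero.mp this).resolve_left hc

/-- Multiplication by `c`, as a bijection of lattices. -/
def latticeScale (c : ℂ) (hc : c ≠ 0) (L : PeriodPair) : L.lattice ≃ (scale c hc L).lattice where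
  toFun l := ⟨c * l, by
    obtain ⟨m, n, h⟩ := PeriodPair.mem_lattice.mp l.2
    exact PeriodPair.mem_lattice.mpr ⟨m, n, by rw [← h]; simp only [scale]; ring⟩⟩
  invFun l := ⟨c⁻¹ * l, by
    obtain ⟨m, n, h⟩ := PeriodPair.mem_lattice.mp l.2
    exact PeriodPair.mem_lattice.mpr ⟨m, n, by rw [← h]; simp only [scale]; field_simp⟩⟩
  left_inv l := by ext; simp [hc]
  right_inv l := by ext; simp [hc]

theorem G_scale (c : ℂ) (hc : c ≠ 0) (L : PeriodPair) (k : ℕ) :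
    (scale c hc L).G k = (c ^ k)⁻¹ * L.G k := by
  simp only [PeriodPair.G]
  rw [← (latticeScale c hc L).tsum_eq, ← tsum_mul_left]
  congr with l
  simp [latticeScale, mul_pow, mul_comm]

theorem weierstrassP_scale (c : ℂ) (hc : c ≠ 0) (L : PeriodPair) (z : ℂ) :
    (scale c hc L).weierstrassP (c * z) = (c ^ 2)⁻¹ * L.weierstrassP z := by
  simp only [PeriodPair.weierstrassP]
  rw [← (latticeScale c hc L).tsum_eq, ← tsum_mul_left]
  congr with l
  simp [latticeScale, ← mul_sub, mul_pow]; ring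

theorem derivWeierstrassP_scale (c : ℂ) (hc : c ≠ 0) (L : PeriodPair) (z : ℂ) :
    (scale c hc L).derivWeierstrassP (c * z) = (c ^ 3)⁻¹ * L.derivWeierstrassP z := by
  simp only [PeriodPair.derivWeierstrassP, ← tsum_neg]
  rw [← (latticeScale c hc L).tsum_eq, ← tsum_mul_left]
  congr with l
  simp [latticeScale, ← mul_sub, mul_pow, div_eq_mul_inv]; ring

theorem periodA_scale (c : ℂ) (hc : c ≠ 0) (L : PeriodPair) (f : ℂ → ℂ) :
    periodA (scale c hc L) f = c * periodA L (fun z => f (c * z)) := by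
  simp only [periodA]
  rw [← intervalIntegral.integral_const_mul]
  congr with s
  simp only [scale]
  rw [show c * L.ω₂ / 2 + s * (c * L.ω₁) = c * (L.ω₂ / 2 + s * L.ω₁) by ring]
  ring

/-- The factor `r^{-1/5}`. -/
def rfac (r : ℝ) : ℂ := ((r ^ (-(1 / 5) : ℝ) : ℝ) : ℂ)

theorem rfac_ne_zero {r : ℝ} (hr : 0 < r) : rfac r ≠ 0 := by
  simpa [rfac] using (Real.rpow_pos_of_pos hr _).ne'

theorem rfac_pow_inv {r : ℝ} (hr : 0 < r) (k : ℕ) :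
    (rfac r ^ k)⁻¹ = ((r ^ ((k : ℝ) / 5) : ℝ) : ℂ) := by
  unfold rfac
  rw [← Complex.ofReal_pow, ← Complex.ofReal_inv, ← Real.rpow_natCast, ← Real.rpow_mul hr.le,
    ← Real.rpow_neg hr.le]
  congr 2; ring

/-- The scaling operator `ϱ_r : (z, t, ν) ↦ (r^{-1/5} z, r^{4/5} t, r ν)`, acting on pairs
`(marked curve, (z₁, …, zₙ))`. The pair `(t, ν)` is a system of local coordinates on the space of marked
curves, and on marked curves `ϱ_r` multiplies the periods by `r^{-1/5}`; see `tPar_rho` and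
`nu_rho`. -/
def rho {n : ℕ} (r : ℝ) (hr : 0 < r) (p : PeriodPair × (Fin n → ℂ)) :
    PeriodPair × (Fin n → ℂ) :=
  (scale (rfac r) (rfac_ne_zero hr) p.1, fun i => rfac r * p.2 i)

theorem tPar_rho {n : ℕ} (r : ℝ) (hr : 0 < r) (p : PeriodPair × (Fin n → ℂ)) :
    tPar (rho r hr p).1 = ((r ^ (4 / 5 : ℝ) : ℝ) : ℂ) * tPar p.1 := by
  have := rfac_pow_inv hr 4
  norm_num at this
  simp only [tPar, rho, PeriodPair.g₂, G_scale, ← this]; ring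

theorem nu_rho {n : ℕ} (r : ℝ) (hr : 0 < r) (p : PeriodPair × (Fin n → ℂ)) :
    nu (rho r hr p).1 = (r : ℂ) * nu p.1 := by
  have := rfac_pow_inv hr 5
  norm_num at this
  simp only [nu, rho, periodA_scale, derivWeierstrassP_scale, mul_pow, ← this]
  simp only [periodA, mul_assoc, intervalIntegral.integral_const_mul]
  have h := rfac_ne_zero hr
  field_simp
  congr with x
  ring_nf
/-- The action `((ϱ_r)_* f)(z, t, ν) = f(r^{-1/5} z, r^{4/5} t, r ν)` on functions. -/
def rhoPush {n : ℕ} (r : ℝ) (hr : 0 < r) (f : PeriodPair × (Fin n → ℂ) → ℂ) :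
    PeriodPair × (Fin n → ℂ) → ℂ :=
  fun p => f (rho r hr p)

/-! ### Polynomials in `t, u, x₁, …, xₙ` -/

/-- The value `p(t, u, x(z₁), …, x(zₙ))` as a function of the marked curve and of `(z₁, …, zₙ)`. -/
def evalCurve {n : ℕ} (p : MvPolynomial (Fin 2 ⊕ Fin n) ℂ) (q : PeriodPair × (Fin n → ℂ)) : ℂ :=
  MvPolynomial.eval (Sum.elim ![tPar q.1, uPar q.1] fun i => q.1.weierstrassP (q.2 i)) p

/-- The weights of `t, u, x₁, …, xₙ` in units of `1/5`: `t ↦ r^{4/5} t`, `u ↦ r^{6/5} u`,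
`xᵢ ↦ r^{2/5} xᵢ`. -/
def weight (n : ℕ) : Fin 2 ⊕ Fin n → ℤ := Sum.elim ![4, 6] fun _ => 2

end WeierstrassTR

end

/-!
Write `r_i` for the three half-periods and `e_i = ℘(r_i)`. The proof determines the shape of the
correlators in a basis that is adapted to the residues, and only afterwards converts it into
polynomials in `x` and `y`.

*The universal form.* Let `ξ_{i,d}(z) = ℘^{(2d)}(z - r_i) + S δ_{d,0}`; for `d ≥ 1` the first
summand is a polynomial in `℘(z - r_i)`, by the differential equation of `℘`. Then `Δ^{2g-2+n}
W_{g,n}` is a combination, with constant coefficients, of products `e^α S^l ∏_j ξ_{i_j,d_j}(z_j)`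
with `|α| + l + ∑ d_j = 2(2g-2+n) + (3g-3+n)` and `|α| ≥ 2(2g-2+n)` (`rep_correlator`). This goes
by induction on `2g + n`. Put `z = r_i + s`. All correlators other than `W_{0,2}` are even in `s`,
and `W_{0,2}(r_i + s, z_j)` has the even Taylor coefficients `ξ_{i,k}(z_j) / (2k)!`; the bracket
of the recursion is even in `s` by the symmetry exchanging its two factors. Hence only the odd
Taylor coefficients `ξ_{i,d}(z_1) / (2d+1)!` of `∫ W_{0,2}(z_1, ·)` enter the residue, which makes
the base point drop out. The factor `1 / ℘'(z)²` of the kernel costs one `Δ`, because `Δ / ℘'(z)²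
= -4 ∏_i (℘(z - r_i) - e_i)` (`disc_div_derivWeierstrassP_sq`), a consequence of the translation
formula `(℘(z - r_i) - e_i)(℘(z) - e_i) = (e_i - e_j)(e_i - e_k)` (`mul_translate_eq`). Every
expansion involved is homogeneous in the `e_i`, `S` and the order of differentiation, so the
grading is preserved.

*The conversion.* By the translation formula `℘(z - r_i) ℘'(z)²` is a polynomial in `x(z)` and the
`e_i`, so multiplication with powers of `y(z_j)²` turns the universal form into a polynomial in
the `e_i`, `S` and `x(z_j)`, of known degree (`exists_mul_prod_pow`). The labelling of the
half-periods is arbitrary. Averaging over the six labellings replaces the monomials in the `e_i`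
by power sums, which are weighted homogeneous polynomials in `t` and `u` by Newton's recursion
(`exists_sum_perm_eq`). The scaling behaviour is that of weighted homogeneous polynomials.
-/

noncomputable section

namespace WeierstrassTR

/-! ### Taylor series on a punctured neighbourhood and residues -/

/-- `f` agrees with the sum of the power series `p` on a punctured neighbourhood of `0`. The value
`f 0` is ignored, so that removable singularities need no repair. -/
def HasTaylor (f : ℂ → ℂ) (p : PowerSeries ℂ) : Prop :=
  ∀ᶠ s in 𝓝[≠] (0 : ℂ), HasSum (fun n => PowerSeries.coeff n p * s ^ n) (f s)

namespace HasTaylor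

variable {f g : ℂ → ℂ} {p q : PowerSeries ℂ}

theorem congr (hf : HasTaylor f p) (h : ∀ᶠ s in 𝓝[≠] (0 : ℂ), g s = f s) : HasTaylor g p := by
  filter_upwards [hf, h] with s h1 h2
  rwa [h2]

theorem add (hf : HasTaylor f p) (hg : HasTaylor g q) :
    HasTaylor (fun s => f s + g s) (p + q) := by
  filter_upwards [hf, hg] with s h1 h2
  simpa [add_mul] using h1.add h2

theorem const_mul (c : ℂ) (hf : HasTaylor f p) :
    HasTaylor (fun s => c * f s) (PowerSeries.C c * p) := by
  filter_upwards [hf] with s h1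
  simpa [mul_assoc] using h1.mul_left c

theorem mul (hf : HasTaylor f p) (hg : HasTaylor g q) :
    HasTaylor (fun s => f s * g s) (p * q) := by
  filter_upwards [hf, hg] with s h1 h2
  have a1 := h1.summable.norm
  have a2 := h2.summable.norm
  have h3 := (summable_norm_sum_mul_antidiagonal_of_summable_norm a1 a2).of_norm.hasSum
  rw [← tsum_mul_tsum_eq_tsum_sum_antidiagonal_of_summable_norm a1 a2, h1.tsum_eq,
    h2.tsum_eq] at h3
  refine h3.congr_fun fun n => ?_
  rw [PowerSeries.coeff_mul, Finset.sum_mul]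
  refine Finset.sum_congr rfl fun ij hij => ?_
  rw [← Finset.HasAntidiagonal.mem_antidiagonal.mp hij, pow_add]
  ring

theorem monomial (n : ℕ) : HasTaylor (fun s => s ^ n) (PowerSeries.X ^ n) := by
  refine Eventually.of_forall fun s => ?_
  convert hasSum_ite_eq n (s ^ n) using 2 with k
  rw [PowerSeries.coeff_X_pow]
  split_ifs with h <;> simp [h]

theorem const (c : ℂ) : HasTaylor (fun _ => c) (PowerSeries.C c) := by
  simpa using (monomial 0).const_mul c

theorem comp_mul {c : ℂ} (hc : c ≠ 0) (hf : HasTaylor f p) :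
    HasTaylor (fun s => f (c * s)) (PowerSeries.rescale c p) := by
  have ht : Tendsto (fun s : ℂ => c * s) (𝓝[≠] 0) (𝓝[≠] 0) := by
    refine tendsto_nhdsWithin_iff.mpr ⟨?_, ?_⟩
    · have : Tendsto (fun s : ℂ => c * s) (𝓝 0) (𝓝 (c * 0)) :=
        (continuous_const_mul c).tendsto 0
      rw [mul_zero] at this
      exact this.mono_left nhdsWithin_le_nhds
    · filter_upwards [self_mem_nhdsWithin] with s hs
      exact mul_ne_zero hc hs
  filter_upwards [ht.eventually hf] with s h1
  refine h1.congr_fun fun n => ?_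
  rw [PowerSeries.coeff_rescale, mul_pow]; ring

theorem comp_neg (hf : HasTaylor f p) :
    HasTaylor (fun s => f (-s)) (PowerSeries.rescale (-1) p) := by
  simpa using hf.comp_mul (neg_ne_zero.mpr one_ne_zero)

/-- The sum of the series, with the value at `0` repaired, has `p` as its power series. -/
theorem hasFPowerSeriesAt (hf : HasTaylor f p) :
    HasFPowerSeriesAt (Function.update f 0 (PowerSeries.coeff 0 p))
      (FormalMultilinearSeries.ofScalars ℂ fun n => PowerSeries.coeff n p) 0 := by
  rw [hasFPowerSeriesAt_iff]
  have := eventually_nhdsWithin_iff.mp hf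
  filter_upwards [this] with s hs
  simp only [zero_add, FormalMultilinearSeries.coeff_ofScalars, smul_eq_mul]
  rcases eq_or_ne s 0 with rfl | h
  · rw [Function.update_self]
    refine (hasSum_ite_eq 0 (PowerSeries.coeff 0 p)).congr_fun fun k => ?_
    rcases k with _ | k <;> simp
  · rw [Function.update_of_ne h]
    simpa [mul_comm] using hs h

end HasTaylor

theorem hasTaylor_of_hasFPowerSeriesAt {f : ℂ → ℂ} {P : FormalMultilinearSeries ℂ ℂ ℂ}
    (h : HasFPowerSeriesAt f P 0) : HasTaylor f (PowerSeries.mk fun n => P.coeff n) := by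
  refine eventually_nhdsWithin_of_eventually_nhds ?_
  filter_upwards [hasFPowerSeriesAt_iff.mp h] with s hs
  simpa [mul_comm] using hs

theorem hasTaylor_of_analyticAt {f : ℂ → ℂ} (h : AnalyticAt ℂ f 0) :
    HasTaylor f (PowerSeries.mk fun n => iteratedDeriv n f 0 / n.factorial) := by
  simpa [FormalMultilinearSeries.coeff_ofScalars] using
    hasTaylor_of_hasFPowerSeriesAt h.hasFPowerSeriesAt

/-- The residue of a function with a pole of order at most `N + 1` is a Taylor coefficient. -/
theorem residue_eq_coeff {f h : ℂ → ℂ} {p : PowerSeries ℂ} {a : ℂ} {N : ℕ}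
    (hh : HasTaylor h p) (hf : ∀ᶠ s in 𝓝[≠] (0 : ℂ), f (a + s) * s ^ (N + 1) = h s) :
    residue f a = PowerSeries.coeff N p := by
  set H := Function.update h 0 (PowerSeries.coeff 0 p) with hH
  have hps := hh.hasFPowerSeriesAt
  rw [← hH] at hps
  have hd : ∀ᶠ s in 𝓝 (0 : ℂ), DifferentiableAt ℂ H s :=
    hps.analyticAt.eventually_analyticAt.mono fun s hs => hs.differentiableAt
  obtain ⟨ε, hε, hball⟩ := Metric.eventually_nhds_iff.mp
    (hd.and (eventually_nhdsWithin_iff.mp hf))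
  refine Tendsto.limUnder_eq (tendsto_const_nhds.congr' ?_)
  filter_upwards [Ioo_mem_nhdsGT hε] with ρ hρ
  have hdc : DiffContOnCl ℂ H (Metric.ball 0 ρ) := by
    refine DifferentiableOn.diffContOnCl fun s hs => ?_
    have hs' : dist s 0 ≤ ρ := by
      have := closure_mono Metric.ball_subset_closedBall hs
      rwa [Metric.isClosed_closedBall.closure_eq, Metric.mem_closedBall] at this
    exact (hball (hs'.trans_lt hρ.2)).1.differentiableWithinAt
  lift ρ to NNReal using hρ.1.le
  have hc := hdc.hasFPowerSeriesOnBall (by exact_mod_cast hρ.1)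
  have heq := hc.hasFPowerSeriesAt.eq_formalMultilinearSeries hps
  have h1 := congrArg (fun P => P.coeff N) heq
  simp only [FormalMultilinearSeries.coeff_ofScalars] at h1
  rw [← h1, FormalMultilinearSeries.coeff]
  have : (1 : Fin N → ℂ) = fun _ => 1 := rfl
  rw [this, cauchyPowerSeries_apply, smul_eq_mul]
  congr 1
  -- both circle integrals are compared on the parameter circle
  simp only [circleIntegral, deriv_circleMap, smul_eq_mul]
  refine intervalIntegral.integral_congr fun θ _ => ?_
  have hw : circleMap 0 ρ θ ≠ 0 := by simpa using hρ.1.ne'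
  have hdist : dist (circleMap 0 ρ θ) 0 < ε := by
    simpa [abs_of_pos (show (0 : ℝ) < ρ from hρ.1)] using hρ.2
  have h2 := (hball hdist).2 hw
  have h3 : circleMap a ρ θ = a + circleMap 0 ρ θ := by simp [circleMap]
  rw [h3, hH, Function.update_of_ne hw, ← h2]
  simp only [sub_zero]
  rw [div_pow, one_pow, pow_succ]
  field_simp

theorem HasTaylor.unique {f : ℂ → ℂ} {p q : PowerSeries ℂ} (hp : HasTaylor f p)
    (hq : HasTaylor f q) : p = q := by
  ext n
  have h : ∀ᶠ s in 𝓝[≠] (0 : ℂ), f (0 + s) / (0 + s) ^ (n + 1) * s ^ (n + 1) = f s := by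
    filter_upwards [self_mem_nhdsWithin] with s hs
    have : s ≠ 0 := hs
    rw [zero_add]; field_simp
  rw [← residue_eq_coeff (f := fun z => f z / z ^ (n + 1)) hp h,
    ← residue_eq_coeff (f := fun z => f z / z ^ (n + 1)) hq h]

theorem HasTaylor.coeff_odd_of_even {f : ℂ → ℂ} {p : PowerSeries ℂ} (hp : HasTaylor f p)
    (hf : ∀ᶠ s in 𝓝[≠] (0 : ℂ), f (-s) = f s) (k : ℕ) :
    PowerSeries.coeff (2 * k + 1) p = 0 := by
  have h := (hp.comp_neg.congr (hf.mono fun s hs => hs.symm)).unique hp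
  have h2 := congrArg (PowerSeries.coeff (2 * k + 1)) h
  rw [PowerSeries.coeff_rescale] at h2
  simp only [pow_succ, pow_mul] at h2
  norm_num at h2
  exact CharZero.eq_neg_self_iff.mp h2.symm

/-- An even coefficient of a product, one of whose factors is even. -/
theorem coeff_even_mul {p q : PowerSeries ℂ}
    (hp : ∀ k, PowerSeries.coeff (2 * k + 1) p = 0) (k : ℕ) :
    PowerSeries.coeff (2 * k) (p * q) = ∑ ij ∈ Finset.HasAntidiagonal.antidiagonal k,
      PowerSeries.coeff (2 * ij.1) p * PowerSeries.coeff (2 * ij.2) q := by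
  rw [PowerSeries.coeff_mul]
  symm
  refine Finset.sum_of_injOn (fun ij => (2 * ij.1, 2 * ij.2)) ?_ ?_ ?_ ?_
  · rintro ⟨a, a'⟩ _ ⟨b, b'⟩ _ h
    simp only [Prod.mk.injEq] at h ⊢
    omega
  · intro a ha
    simp only [Finset.mem_coe, Finset.HasAntidiagonal.mem_antidiagonal] at ha ⊢
    omega
  · intro a ha hn
    rw [Finset.HasAntidiagonal.mem_antidiagonal] at ha
    rcases Nat.even_or_odd' a.1 with ⟨i, hi | hi⟩
    · refine absurd ⟨(i, k - i), ?_, ?_⟩ hn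
      · simp only [Finset.mem_coe, Finset.HasAntidiagonal.mem_antidiagonal]; omega
      · ext <;> simp <;> omega
    · rw [hi, hp, zero_mul]
  · intro a _; rfl

/-- An odd coefficient of a product whose first factor is even. -/
theorem coeff_odd_mul {p q : PowerSeries ℂ}
    (hp : ∀ k, PowerSeries.coeff (2 * k + 1) p = 0) (k : ℕ) :
    PowerSeries.coeff (2 * k + 1) (p * q) = ∑ ij ∈ Finset.HasAntidiagonal.antidiagonal k,
      PowerSeries.coeff (2 * ij.1) p * PowerSeries.coeff (2 * ij.2 + 1) q := by
  rw [PowerSeries.coeff_mul]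
  symm
  refine Finset.sum_of_injOn (fun ij => (2 * ij.1, 2 * ij.2 + 1)) ?_ ?_ ?_ ?_
  · rintro ⟨a, a'⟩ _ ⟨b, b'⟩ _ h
    simp only [Prod.mk.injEq] at h ⊢
    omega
  · intro a ha
    simp only [Finset.mem_coe, Finset.HasAntidiagonal.mem_antidiagonal] at ha ⊢
    omega
  · intro a ha hn
    rw [Finset.HasAntidiagonal.mem_antidiagonal] at ha
    rcases Nat.even_or_odd' a.1 with ⟨i, hi | hi⟩
    · refine absurd ⟨(i, k - i), ?_, ?_⟩ hn
      · simp only [Finset.mem_coe, Finset.HasAntidiagonal.mem_antidiagonal]; omega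
      · ext <;> simp <;> omega
    · rw [hi, hp, zero_mul]
  · intro a _; rfl

/-! ### Half-periods and the values of `℘` there -/

theorem weierstrassP_add_mem {L : PeriodPair} {l : ℂ} (hl : l ∈ L.lattice) (z : ℂ) :
    L.weierstrassP (z + l) = L.weierstrassP z := L.weierstrassP_add_coe z ⟨l, hl⟩

theorem derivWeierstrassP_add_mem {L : PeriodPair} {l : ℂ} (hl : l ∈ L.lattice) (z : ℂ) :
    L.derivWeierstrassP (z + l) = L.derivWeierstrassP z := L.derivWeierstrassP_add_coe z ⟨l, hl⟩

theorem two_mul_ram_mem (L : PeriodPair) (i : Fin 3) : 2 * ram L i ∈ L.lattice := by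
  have h1 := L.ω₁_mem_lattice
  have h2 := L.ω₂_mem_lattice
  fin_cases i <;> simp only [ram, Fin.zero_eta, Fin.mk_one, Fin.reduceFinMk, Matrix.cons_val] <;>
    rw [mul_div_cancel₀ _ two_ne_zero]
  · exact h1
  · exact h2
  · exact add_mem h1 h2

theorem ram_notMem (L : PeriodPair) (i : Fin 3) : ram L i ∉ L.lattice := by
  have h := L.mul_ω₁_add_mul_ω₂_mem_lattice (α := 1 / 2) (β := 1 / 2)
  have h1 := L.ω₁_div_two_notMem_lattice
  have h2 := L.ω₂_div_two_notMem_lattice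
  fin_cases i <;> simp only [ram, Fin.zero_eta, Fin.mk_one, Fin.reduceFinMk, Matrix.cons_val]
  · exact h1
  · exact h2
  · push_cast at h
    rw [show (L.ω₁ + L.ω₂) / 2 = 1 / 2 * L.ω₁ + 1 / 2 * L.ω₂ by ring, h]
    norm_num

theorem sum_ram_mem (L : PeriodPair) : ∑ i, ram L i ∈ L.lattice := by
  have : ∑ i, ram L i = L.ω₁ + L.ω₂ := by
    simp only [Fin.sum_univ_three, ram, Matrix.cons_val]; ring
  rw [this]
  exact add_mem L.ω₁_mem_lattice L.ω₂_mem_lattice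

/-- A marked curve with a labelling of its three half-periods and a base point: the parameters over
which all the universal formulas below range. -/
structure Par where
  /-- the pair of periods -/
  L : PeriodPair
  /-- the labelling of the half-periods -/
  perm : Equiv.Perm (Fin 3)
  /-- the base point of the recursion kernel -/
  b : ℂ

/-- The half-period with label `i`. -/
def halfPer (q : Par) (i : Fin 3) : ℂ := ram q.L (q.perm i)

/-- The value `e_i` of `℘` at the half-period with label `i`. -/
def ee (q : Par) (i : Fin 3) : ℂ := q.L.weierstrassP (halfPer q i)

theorem two_mul_halfPer_mem (q : Par) (i : Fin 3) : 2 * halfPer q i ∈ q.L.lattice :=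
  two_mul_ram_mem _ _

theorem halfPer_notMem (q : Par) (i : Fin 3) : halfPer q i ∉ q.L.lattice := ram_notMem _ _

theorem sum_halfPer_mem (q : Par) : ∑ i, halfPer q i ∈ q.L.lattice := by
  have := Equiv.sum_comp q.perm (ram q.L)
  rw [show ∑ i, halfPer q i = ∑ i, ram q.L i from this]
  exact sum_ram_mem _

theorem sum_fin_three {i j k : Fin 3} (hij : i ≠ j) (hik : i ≠ k) (hjk : j ≠ k) {M : Type*}
    [AddCommMonoid M] (f : Fin 3 → M) : ∑ l, f l = f i + f j + f k := by
  rw [Fin.sum_univ_three]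
  fin_cases i <;> fin_cases j <;> fin_cases k <;> simp at hij hik hjk ⊢ <;> abel

/-- The difference of two half-periods is the third one, modulo the lattice. -/
theorem halfPer_sub_sub_mem (q : Par) {i j k : Fin 3} (hij : i ≠ j) (hik : i ≠ k) (hjk : j ≠ k) :
    halfPer q i - halfPer q j - halfPer q k ∈ q.L.lattice := by
  have h := sum_halfPer_mem q
  rw [sum_fin_three hij hik hjk] at h
  have h2 := sub_mem (sub_mem h (two_mul_halfPer_mem q j)) (two_mul_halfPer_mem q k)
  convert h2 using 1
  ring

theorem exists_third (i j : Fin 3) (hij : i ≠ j) : ∃ k, i ≠ k ∧ j ≠ k := by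
  revert i j; decide

theorem halfPer_sub_notMem (q : Par) {i j : Fin 3} (hij : i ≠ j) :
    halfPer q i - halfPer q j ∉ q.L.lattice := by
  obtain ⟨k, hik, hjk⟩ := exists_third i j hij
  intro h
  have := sub_mem h (halfPer_sub_sub_mem q hij hik hjk)
  rw [sub_sub_cancel] at this
  exact halfPer_notMem q k this

theorem weierstrassP_halfPer_sub_add (q : Par) {i j k : Fin 3} (hij : i ≠ j) (hik : i ≠ k)
    (hjk : j ≠ k) (s : ℂ) :
    q.L.weierstrassP (halfPer q i - halfPer q j + s) = q.L.weierstrassP (halfPer q k + s) := by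
  rw [← weierstrassP_add_mem (halfPer_sub_sub_mem q hij hik hjk) (halfPer q k + s)]
  congr 1; ring

theorem weierstrassP_halfPer_sub (q : Par) {i j k : Fin 3} (hij : i ≠ j) (hik : i ≠ k)
    (hjk : j ≠ k) : q.L.weierstrassP (halfPer q i - halfPer q j) = ee q k := by
  simpa [ee] using weierstrassP_halfPer_sub_add q hij hik hjk 0

theorem weierstrassP_sub_halfPer_neg (q : Par) (i : Fin 3) (z : ℂ) :
    q.L.weierstrassP (-z - halfPer q i) = q.L.weierstrassP (z - halfPer q i) := by
  rw [← weierstrassP_add_mem (two_mul_halfPer_mem q i) (z - halfPer q i),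
    ← q.L.weierstrassP_neg]
  congr 1; ring

theorem derivWeierstrassP_halfPer (q : Par) (i : Fin 3) :
    q.L.derivWeierstrassP (halfPer q i) = 0 := by
  have h1 := q.L.derivWeierstrassP_neg (halfPer q i)
  have h2 := derivWeierstrassP_add_mem (two_mul_halfPer_mem q i) (-halfPer q i)
  rw [show -halfPer q i + 2 * halfPer q i = halfPer q i by ring, h1] at h2
  exact CharZero.eq_neg_self_iff.mp h2

theorem isPreconnected_compl_lattice (L : PeriodPair) :
    IsPreconnected ((L.lattice : Set ℂ)ᶜ) := by
  have hc : (L.lattice : Set ℂ).Countable := by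
    have : Countable L.lattice := L.latticeEquivProd.toEquiv.countable_iff.mpr inferInstance
    exact Set.countable_coe_iff.mp this
  exact (hc.isConnected_compl_of_one_lt_rank (by simp)).isPreconnected

theorem exists_analyticAt_eq_sq_mul_weierstrassP (L : PeriodPair) :
    ∃ φ : ℂ → ℂ, AnalyticAt ℂ φ 0 ∧ φ 0 = 1 ∧ ∀ s ≠ 0, φ s = s ^ 2 * L.weierstrassP s := by
  refine ⟨fun s => s ^ 2 * L.weierstrassPExcept 0 s + 1, by fun_prop, by simp, fun s hs => ?_⟩
  have := L.ite_eq_one_sub_sq_mul_weierstrassP 0 (zero_mem _) s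
  simpa [hs] using this.symm

/-- `℘` is not locally constant. -/
theorem not_eventually_eq_const (L : PeriodPair) {a c : ℂ} (ha : a ∉ L.lattice) :
    ¬ ∀ᶠ z in 𝓝 a, L.weierstrassP z = c := by
  intro h
  have h1 := L.analyticOnNhd_weierstrassP.eqOn_of_preconnected_of_eventuallyEq
    (g := fun _ => c) analyticOnNhd_const (isPreconnected_compl_lattice L) ha h
  obtain ⟨φ, hφ, hφ0, hφs⟩ := exists_analyticAt_eq_sq_mul_weierstrassP L
  have h2 : Tendsto φ (𝓝[≠] 0) (𝓝 1) := by
    rw [← hφ0]; exact hφ.continuousAt.tendsto.mono_left nhdsWithin_le_nhds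
  have h3 : Tendsto (fun s : ℂ => s ^ 2 * c) (𝓝[≠] 0) (𝓝 (0 ^ 2 * c)) :=
    (Continuous.tendsto (by fun_prop) 0).mono_left nhdsWithin_le_nhds
  have h4 : (fun s : ℂ => s ^ 2 * c) =ᶠ[𝓝[≠] 0] φ := by
    filter_upwards [self_mem_nhdsWithin,
      mem_nhdsWithin_of_mem_nhds (L.compl_lattice_sdiff_singleton_mem_nhds 0)] with s hs hs'
    have hs0 : s ≠ 0 := hs
    have : s ∉ L.lattice := by simp_all
    rw [hφs s hs0]
    exact congrArg _ (h1 this).symm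
  have := tendsto_nhds_unique (h3.congr' h4) h2
  norm_num at this

/-- The half-period translation: `(℘(z - r) - e)(℘(z) - e)` is constant, by Liouville's theorem, the
double pole of each factor being cancelled by a double zero of the other. -/
theorem exists_mul_translate_eq (q : Par) (i : Fin 3) :
    ∃ C ≠ 0, ∀ z ∉ q.L.lattice, z - halfPer q i ∉ q.L.lattice →
      (q.L.weierstrassP (z - halfPer q i) - ee q i) * (q.L.weierstrassP z - ee q i) = C := by
  classical
  set L := q.L with hL
  set r := halfPer q i with hr
  set e := ee q i with he
  have h2r := two_mul_halfPer_mem q i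
  rw [← hL, ← hr] at h2r
  have hrn : r ∉ L.lattice := halfPer_notMem q i
  have hnr : (0 : ℂ) - r ∉ L.lattice := by simpa using hrn
  set f : ℂ → ℂ := fun z => L.weierstrassP (z - r) - e with hf
  have hPr : AnalyticAt ℂ L.weierstrassP (0 - r) := L.analyticOnNhd_weierstrassP _ hnr
  have hfa : AnalyticAt ℂ f 0 :=
    (AnalyticAt.comp (f := fun z : ℂ => z - r) hPr (by fun_prop)).sub analyticAt_const
  have hf0 : f 0 = 0 := by simp [hf, he, ee, hr, hL]
  have hf1 : deriv f 0 = 0 := by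
    have : deriv f 0 = L.derivWeierstrassP (0 - r) := by
      simp only [hf, deriv_sub_const_fun, deriv_comp_sub_const, L.deriv_weierstrassP]
    rw [this, zero_sub, L.derivWeierstrassP_neg, hr, hL, derivWeierstrassP_halfPer, neg_zero]
  obtain ⟨g, hg, hfg⟩ : ∃ g, AnalyticAt ℂ g 0 ∧ ∀ᶠ z in 𝓝 (0 : ℂ), f z = (z - 0) ^ 2 • g z := by
    rw [← natCast_le_analyticOrderAt hfa]
    refine (natCast_le_analyticOrderAt_iff_iteratedDeriv_eq_zero hfa).mpr fun k hk => ?_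
    interval_cases k
    · simpa using hf0
    · simpa [iteratedDeriv_one] using hf1
  obtain ⟨φ, hφ, hφ0, hφs⟩ := exists_analyticAt_eq_sq_mul_weierstrassP L
  set h : ℂ → ℂ := fun z => if z ∈ L.lattice ∨ z - r ∈ L.lattice then g 0 else
    (L.weierstrassP (z - r) - e) * (L.weierstrassP z - e) with hh
  have hper : ∀ z, ∀ l ∈ L.lattice, h (z + l) = h z := by
    intro z l hl
    have m1 : z + l ∈ L.lattice ↔ z ∈ L.lattice := L.lattice.add_mem_iff_left hl
    have m2 : z + l - r ∈ L.lattice ↔ z - r ∈ L.lattice := by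
      rw [add_sub_right_comm]; exact L.lattice.add_mem_iff_left hl
    have p1 : L.weierstrassP (z + l - r) = L.weierstrassP (z - r) := by
      rw [add_sub_right_comm, weierstrassP_add_mem hl]
    simp only [hh, m1, m2, p1, weierstrassP_add_mem hl]
  have hsym : ∀ z, h (r - z) = h z := by
    intro z
    have m1 : r - z ∈ L.lattice ↔ z - r ∈ L.lattice := by rw [← neg_mem_iff, neg_sub]
    have m2 : r - z - r ∈ L.lattice ↔ z ∈ L.lattice := by
      rw [← neg_mem_iff]; congr! 1; ring
    have p1 : L.weierstrassP (r - z) = L.weierstrassP (z - r) := by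
      rw [← L.weierstrassP_neg, neg_sub]
    have p2 : L.weierstrassP (r - z - r) = L.weierstrassP z := by
      rw [← L.weierstrassP_neg]; congr 1; ring
    simp only [hh, m1, m2, p1, p2, or_comm]
    split_ifs
    · rfl
    · ring
  have han0 : AnalyticAt ℂ h 0 := by
    have ha : AnalyticAt ℂ (fun z => g z * (φ z - e * z ^ 2)) 0 := by fun_prop
    refine ha.congr ?_
    have n1 : ∀ᶠ z in 𝓝 (0 : ℂ), z - r ∉ L.lattice := by
      have : Tendsto (fun z : ℂ => z - r) (𝓝 0) (𝓝 (0 - r)) := by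
        exact (continuous_sub_right r).tendsto 0
      exact this.eventually (L.isClosed_lattice.isOpen_compl.mem_nhds hnr)
    filter_upwards [hfg, n1, L.compl_lattice_sdiff_singleton_mem_nhds 0] with z hz hz1 hz2
    by_cases hz0 : z = 0
    · simp [hz0, hh, hφ0]
    · have hz3 : z ∉ L.lattice := by simp_all
      have : L.weierstrassP (z - r) - e = z ^ 2 * g z := by simpa [hf] using hz
      simp only [hh, hz1, hz3, or_self, if_false, this, hφs z hz0]
      ring
  have han : ∀ z, AnalyticAt ℂ h z := by
    intro z
    by_cases hz : z ∈ L.lattice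
    · have : h = h ∘ fun w => w - z := by
        ext w
        have := hper w (-z) (neg_mem hz)
        simpa [sub_eq_add_neg] using this.symm
      rw [this]
      refine AnalyticAt.comp ?_ (by fun_prop)
      simpa using han0
    by_cases hz' : z - r ∈ L.lattice
    · have : h = h ∘ fun w => z - w := by
        ext w
        have := hper (z - w) (-(z - r)) (neg_mem hz')
        rw [Function.comp_apply, ← this, ← hsym w]
        congr 1; ring
      rw [this]
      refine AnalyticAt.comp ?_ (by fun_prop)
      simpa using han0
    · have ha : AnalyticAt ℂ (fun z => (L.weierstrassP (z - r) - e) * (L.weierstrassP z - e)) z :=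
        ((AnalyticAt.comp (f := fun z : ℂ => z - r) (L.analyticOnNhd_weierstrassP _ hz')
          (by fun_prop)).sub analyticAt_const).mul
          ((L.analyticOnNhd_weierstrassP z hz).sub analyticAt_const)
      refine ha.congr ?_
      have n1 : ∀ᶠ z in 𝓝 z, z - r ∉ L.lattice := by
        have : Tendsto (fun z : ℂ => z - r) (𝓝 z) (𝓝 (z - r)) := by
          exact (continuous_sub_right r).tendsto z
        exact this.eventually (L.isClosed_lattice.isOpen_compl.mem_nhds hz')
      filter_upwards [n1, L.isClosed_lattice.isOpen_compl.mem_nhds hz] with w hw1 hw2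
      have hw2 : w ∉ L.lattice := hw2
      simp [hh, hw1, hw2]
  have hdiff : Differentiable ℂ h := fun z => (han z).differentiableAt
  have hconst : ∀ z, h z = g 0 := by
    intro z
    rw [hdiff.apply_eq_apply_of_bounded (IsZLattice.isCompact_range_of_periodic L.lattice _
      hdiff.continuous fun z w hw => hper z w hw).isBounded z 0]
    simp [hh]
  refine ⟨g 0, fun hg0 => ?_, fun z hz hz' => ?_⟩
  · -- otherwise one of the two factors would vanish identically near `0`
    refine not_eventually_eq_const L hnr (c := e) ?_
    have n2 : ∀ᶠ z in 𝓝 (0 : ℂ), φ z - e * z ^ 2 ≠ 0 := by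
      have : ContinuousAt (fun z => φ z - e * z ^ 2) 0 := by
        have := hφ.continuousAt; fun_prop
      exact this.eventually_ne (by simp [hφ0])
    have n1 : ∀ᶠ z in 𝓝 (0 : ℂ), z - r ∉ L.lattice := by
      have : Tendsto (fun z : ℂ => z - r) (𝓝 0) (𝓝 (0 - r)) := by
        exact (continuous_sub_right r).tendsto 0
      exact this.eventually (L.isClosed_lattice.isOpen_compl.mem_nhds hnr)
    have key : ∀ᶠ z in 𝓝 (0 : ℂ), L.weierstrassP (z - r) = e := by
      filter_upwards [n1, n2, L.compl_lattice_sdiff_singleton_mem_nhds 0] with z hz1 hz4 hz2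
      by_cases hz0 : z = 0
      · have := hf0; simp only [hf] at this; rw [hz0]; exact sub_eq_zero.mp this
      · have hz3 : z ∉ L.lattice := by simp_all
        have h5 := hconst z
        simp only [hh, hz1, hz3, or_self, if_false, hg0] at h5
        rcases mul_eq_zero.mp h5 with h6 | h6
        · exact sub_eq_zero.mp h6
        · refine absurd ?_ hz4
          rw [hφs z hz0, sub_eq_zero.mp h6]; ring
    have ht : Tendsto (fun z : ℂ => z + r) (𝓝 (0 - r)) (𝓝 (0 - r + r)) :=
      (continuous_add_const r).tendsto _
    rw [sub_add_cancel] at ht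
    filter_upwards [ht.eventually key] with z hz
    simpa using hz
  · have := hconst z
    simpa [hh, hz, hz'] using this

theorem weierstrassP_sub_ee_ne_zero (q : Par) (i : Fin 3) {z : ℂ} (hz : z ∉ q.L.lattice)
    (hz' : z - halfPer q i ∉ q.L.lattice) : q.L.weierstrassP z - ee q i ≠ 0 := by
  obtain ⟨C, hC, h⟩ := exists_mul_translate_eq q i
  intro h0
  have := h z hz hz'
  rw [h0, mul_zero] at this
  exact hC this.symm

theorem ee_sub_ne_zero (q : Par) {i j : Fin 3} (hij : i ≠ j) : ee q i - ee q j ≠ 0 :=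
  weierstrassP_sub_ee_ne_zero q j (halfPer_notMem q i) (halfPer_sub_notMem q hij)

theorem mul_translate_eq (q : Par) {i j k : Fin 3} (hij : i ≠ j) (hik : i ≠ k) (hjk : j ≠ k)
    {z : ℂ} (hz : z ∉ q.L.lattice) (hz' : z - halfPer q i ∉ q.L.lattice) :
    (q.L.weierstrassP (z - halfPer q i) - ee q i) * (q.L.weierstrassP z - ee q i) =
      (ee q i - ee q j) * (ee q i - ee q k) := by
  obtain ⟨C, -, h⟩ := exists_mul_translate_eq q i
  rw [h z hz hz', ← h (halfPer q j) (halfPer_notMem q j) (halfPer_sub_notMem q hij.symm),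
    weierstrassP_halfPer_sub q hij.symm hjk hik]
  simp only [ee]; ring

theorem cubic_ee (q : Par) (i : Fin 3) :
    4 * ee q i ^ 3 - q.L.g₂ * ee q i - q.L.g₃ = 0 := by
  have := q.L.derivWeierstrassP_sq (halfPer q i) (halfPer_notMem q i)
  rw [derivWeierstrassP_halfPer] at this
  simp only [ee]; rw [← this]; ring

theorem ee_relations (q : Par) : ee q 2 = -ee q 0 - ee q 1 ∧
    q.L.g₂ = -4 * (ee q 0 * ee q 1 + ee q 0 * ee q 2 + ee q 1 * ee q 2) ∧
    q.L.g₃ = 4 * (ee q 0 * ee q 1 * ee q 2) := by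
  have h0 := cubic_ee q 0
  have h1 := cubic_ee q 1
  have h2 := cubic_ee q 2
  have n01 : ee q 0 - ee q 1 ≠ 0 := ee_sub_ne_zero q (by decide)
  have n02 : ee q 0 - ee q 2 ≠ 0 := ee_sub_ne_zero q (by decide)
  have n12 : ee q 1 - ee q 2 ≠ 0 := ee_sub_ne_zero q (by decide)
  have a1 : 4 * (ee q 0 ^ 2 + ee q 0 * ee q 1 + ee q 1 ^ 2) - q.L.g₂ = 0 := by
    refine mul_left_cancel₀ n01 ?_; linear_combination h0 - h1
  have a2 : 4 * (ee q 0 ^ 2 + ee q 0 * ee q 2 + ee q 2 ^ 2) - q.L.g₂ = 0 := by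
    refine mul_left_cancel₀ n02 ?_; linear_combination h0 - h2
  have a3 : ee q 0 + ee q 1 + ee q 2 = 0 := by
    refine mul_left_cancel₀ n12 ?_; linear_combination (a1 - a2) / 4
  have a4 : ee q 2 = -ee q 0 - ee q 1 := by linear_combination a3
  refine ⟨a4, ?_, ?_⟩
  · rw [a4]; linear_combination -a1
  · rw [a4]; linear_combination -h0 + ee q 0 * a1

/-- `y² = 4 (x - e₁)(x - e₂)(x - e₃)`. -/
theorem derivWeierstrassP_sq_eq_prod (q : Par) {z : ℂ} (hz : z ∉ q.L.lattice) :
    q.L.derivWeierstrassP z ^ 2 = 4 * ∏ i, (q.L.weierstrassP z - ee q i) := by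
  obtain ⟨h1, h2, h3⟩ := ee_relations q
  rw [q.L.derivWeierstrassP_sq z hz, h2, h3, Fin.prod_univ_three, h1]; ring

theorem disc_eq (q : Par) : disc q.L =
    16 * ((ee q 0 - ee q 1) * (ee q 0 - ee q 2) * (ee q 1 - ee q 2)) ^ 2 := by
  obtain ⟨h1, h2, h3⟩ := ee_relations q
  rw [disc, h2, h3, h1]; ring

theorem disc_ne_zero (q : Par) : disc q.L ≠ 0 := by
  rw [disc_eq]
  have n01 : ee q 0 - ee q 1 ≠ 0 := ee_sub_ne_zero q (by decide)
  have n02 : ee q 0 - ee q 2 ≠ 0 := ee_sub_ne_zero q (by decide)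
  have n12 : ee q 1 - ee q 2 ≠ 0 := ee_sub_ne_zero q (by decide)
  exact mul_ne_zero (by norm_num) (pow_ne_zero 2 (mul_ne_zero (mul_ne_zero n01 n02) n12))

/-- `2z ∉ L` says that `z` is neither a lattice point nor a half-period modulo the lattice. -/
theorem notMem_of_two_mul {L : PeriodPair} {z : ℂ} (hz : 2 * z ∉ L.lattice) : z ∉ L.lattice := by
  intro h
  exact hz (by rw [two_mul]; exact add_mem h h)

theorem sub_halfPer_notMem (q : Par) (i : Fin 3) {z : ℂ} (hz : 2 * z ∉ q.L.lattice) :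
    z - halfPer q i ∉ q.L.lattice := by
  intro h
  refine hz ?_
  have := add_mem (add_mem h h) (two_mul_halfPer_mem q i)
  convert this using 1; ring

theorem derivWeierstrassP_ne_zero (q : Par) {z : ℂ} (hz : 2 * z ∉ q.L.lattice) :
    q.L.derivWeierstrassP z ≠ 0 := by
  have h := derivWeierstrassP_sq_eq_prod q (notMem_of_two_mul hz)
  intro h0
  rw [h0] at h
  have : ∏ i, (q.L.weierstrassP z - ee q i) ≠ 0 := Finset.prod_ne_zero_iff.mpr fun i _ =>
    weierstrassP_sub_ee_ne_zero q i (notMem_of_two_mul hz) (sub_halfPer_notMem q i hz)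
  refine this ?_
  simpa using h.symm

/-- The reciprocal of `y²` is polynomial in the translates of `℘` by half-periods, at the cost of a
single factor `Δ`. -/
theorem disc_div_derivWeierstrassP_sq (q : Par) {z : ℂ} (hz : 2 * z ∉ q.L.lattice) :
    disc q.L / q.L.derivWeierstrassP z ^ 2 =
      -4 * ∏ i, (q.L.weierstrassP (z - halfPer q i) - ee q i) := by
  have h0 := derivWeierstrassP_ne_zero q hz
  have hz1 := notMem_of_two_mul hz
  rw [div_eq_iff (pow_ne_zero 2 h0), derivWeierstrassP_sq_eq_prod q hz1, disc_eq,
    Fin.prod_univ_three, Fin.prod_univ_three]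
  have t0 := mul_translate_eq q (i := 0) (j := 1) (k := 2) (by decide) (by decide) (by decide)
    hz1 (sub_halfPer_notMem q 0 hz)
  have t1 := mul_translate_eq q (i := 1) (j := 0) (k := 2) (by decide) (by decide) (by decide)
    hz1 (sub_halfPer_notMem q 1 hz)
  have t2 := mul_translate_eq q (i := 2) (j := 0) (k := 1) (by decide) (by decide) (by decide)
    hz1 (sub_halfPer_notMem q 2 hz)
  calc _ = -16 * (((ee q 0 - ee q 1) * (ee q 0 - ee q 2)) *
        ((ee q 1 - ee q 0) * (ee q 1 - ee q 2)) * ((ee q 2 - ee q 0) * (ee q 2 - ee q 1))) := by ring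
    _ = _ := by rw [← t0, ← t1, ← t2]; ring

section

/-! ### Even derivatives of `℘` as polynomials in `℘` -/

theorem deriv_derivWeierstrassP (L : PeriodPair) {z : ℂ} (hz : z ∉ L.lattice) :
    deriv L.derivWeierstrassP z = 6 * L.weierstrassP z ^ 2 - L.g₂ / 2 := by
  have hopen : IsOpen ((L.lattice : Set ℂ)ᶜ) := L.isClosed_lattice.isOpen_compl
  have hd : ∀ w ∉ L.lattice, DifferentiableAt ℂ L.weierstrassP w := fun w hw =>
    (L.analyticOnNhd_weierstrassP w hw).differentiableAt
  have hd' : ∀ w ∉ L.lattice, DifferentiableAt ℂ L.derivWeierstrassP w := fun w hw =>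
    (L.analyticOnNhd_derivWeierstrassP w hw).differentiableAt
  -- differentiating `y² = 4x³ - g₂ x - g₃` gives the claim times `℘'`
  have key : ∀ w ∉ L.lattice, L.derivWeierstrassP w *
      (deriv L.derivWeierstrassP w - (6 * L.weierstrassP w ^ 2 - L.g₂ / 2)) = 0 := by
    intro w hw
    have h1 : HasDerivAt (fun z => L.derivWeierstrassP z ^ 2)
        (2 * L.derivWeierstrassP w * deriv L.derivWeierstrassP w) w := by
      simpa using (hd' w hw).hasDerivAt.fun_pow 2
    have hP : HasDerivAt L.weierstrassP (L.derivWeierstrassP w) w := by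
      simpa using (hd w hw).hasDerivAt
    have h2 : HasDerivAt (fun z => 4 * L.weierstrassP z ^ 3 - L.g₂ * L.weierstrassP z - L.g₃)
        (4 * (3 * L.weierstrassP w ^ 2 * L.derivWeierstrassP w) -
          L.g₂ * L.derivWeierstrassP w) w := by
      simpa using (((hP.fun_pow 3).const_mul 4).sub (hP.const_mul L.g₂)).sub_const L.g₃
    have h3 := h1.congr_of_eventuallyEq
      (f₁ := fun z => 4 * L.weierstrassP z ^ 3 - L.g₂ * L.weierstrassP z - L.g₃) (by
        filter_upwards [hopen.mem_nhds hw] with u hu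
        exact (L.derivWeierstrassP_sq u hu).symm)
    linear_combination (h3.unique h2) / 2
  have hG : AnalyticAt ℂ (fun w => deriv L.derivWeierstrassP w -
      (6 * L.weierstrassP w ^ 2 - L.g₂ / 2)) z := by
    have h1 := (L.analyticOnNhd_derivWeierstrassP z hz).deriv
    have h2 := L.analyticOnNhd_weierstrassP z hz
    fun_prop
  have hy := L.analyticOnNhd_derivWeierstrassP z hz
  have hnz : ∃ᶠ w in 𝓝[≠] z, L.derivWeierstrassP w ≠ 0 := by
    rcases hy.eventually_eq_zero_or_eventually_ne_zero with h | h
    · exfalso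
      obtain ⟨ε, hε, hb⟩ := Metric.eventually_nhds_iff_ball.mp (h.and (hopen.mem_nhds hz))
      refine not_eventually_eq_const L hz (c := L.weierstrassP z) ?_
      filter_upwards [Metric.ball_mem_nhds z hε] with w hw
      refine (convex_ball z ε).is_const_of_fderivWithin_eq_zero (𝕜 := ℂ) (f := L.weierstrassP)
        (fun u hu => (hd u (hb u hu).2).differentiableWithinAt) (fun u hu => ?_) hw
        (Metric.mem_ball_self hε)
      rw [fderivWithin_of_isOpen Metric.isOpen_ball hu]
      ext
      simp [(hb u hu).1]
    · exact h.frequently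
  have hz0 : ∃ᶠ w in 𝓝[≠] z, deriv L.derivWeierstrassP w -
      (6 * L.weierstrassP w ^ 2 - L.g₂ / 2) = 0 := by
    refine (hnz.and_eventually (mem_nhdsWithin_of_mem_nhds (hopen.mem_nhds hz))).mono ?_
    rintro w ⟨h1, h2⟩
    exact (mul_eq_zero.mp (key w h2)).resolve_left h1
  exact sub_eq_zero.mp (hG.frequently_zero_iff_eventually_zero.mp hz0).self_of_nhds

open Polynomial in
/-- The polynomial `Q_d` with `℘^{(2d)} = Q_d(℘)`. -/
def derivPoly (L : PeriodPair) : ℕ → ℂ[X]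
  | 0 => X
  | d + 1 => derivative (derivative (derivPoly L d)) * (4 * X ^ 3 - C L.g₂ * X - C L.g₃) +
      derivative (derivPoly L d) * (6 * X ^ 2 - C (L.g₂ / 2))

theorem iteratedDeriv_weierstrassP (L : PeriodPair) (d : ℕ) {z : ℂ} (hz : z ∉ L.lattice) :
    iteratedDeriv (2 * d) L.weierstrassP z = (derivPoly L d).eval (L.weierstrassP z) := by
  have hopen : IsOpen ((L.lattice : Set ℂ)ᶜ) := L.isClosed_lattice.isOpen_compl
  have hP : ∀ w ∉ L.lattice, HasDerivAt L.weierstrassP (L.derivWeierstrassP w) w := fun w hw => by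
    simpa using (L.analyticOnNhd_weierstrassP w hw).differentiableAt.hasDerivAt
  have hy : ∀ w ∉ L.lattice, HasDerivAt L.derivWeierstrassP
      (6 * L.weierstrassP w ^ 2 - L.g₂ / 2) w := fun w hw => by
    rw [← deriv_derivWeierstrassP L hw]
    exact (L.analyticOnNhd_derivWeierstrassP w hw).differentiableAt.hasDerivAt
  induction d generalizing z with
  | zero => simp [derivPoly]
  | succ d ih =>
    have e1 : ∀ w ∉ L.lattice, iteratedDeriv (2 * d + 1) L.weierstrassP w =
        (derivPoly L d).derivative.eval (L.weierstrassP w) * L.derivWeierstrassP w := by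
      intro w hw
      rw [iteratedDeriv_succ]
      refine HasDerivAt.deriv ?_
      refine (((derivPoly L d).hasDerivAt _).comp w (hP w hw)).congr_of_eventuallyEq ?_
      filter_upwards [hopen.mem_nhds hw] with u hu
      exact ih hu
    rw [show 2 * (d + 1) = 2 * d + 1 + 1 by ring, iteratedDeriv_succ]
    have h1 := (((derivPoly L d).derivative.hasDerivAt _).comp z (hP z hz)).mul (hy z hz)
    have h2 := h1.congr_of_eventuallyEq (f₁ := iteratedDeriv (2 * d + 1) L.weierstrassP) (by
      filter_upwards [hopen.mem_nhds hz] with u hu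
      exact e1 u hu)
    rw [h2.deriv]
    have h3 := L.derivWeierstrassP_sq z hz
    simp only [derivPoly, Polynomial.eval_add, Polynomial.eval_mul, Polynomial.eval_sub,
      Polynomial.eval_ofNat, Polynomial.eval_pow, Polynomial.eval_X, Polynomial.eval_C,
      Function.comp_apply]
    rw [← h3]; ring

/-! ### Graded spaces of universal functions -/

/-- The family of even derivatives of `℘ + S` at `z - r`, where `r` is the half-period with label
`i`; the correlators are multilinear in these. For `z` off the lattice translate of `r` it is
`℘^{(2d)}(z - r) + S δ_{d,0}`. -/
def xi (q : Par) (i : Fin 3) (d : ℕ) (z : ℂ) : ℂ :=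
  (derivPoly q.L d).eval (q.L.weierstrassP (z - halfPer q i)) + if d = 0 then S q.L else 0

theorem xi_neg (q : Par) (i : Fin 3) (d : ℕ) (z : ℂ) : xi q i d (-z) = xi q i d z := by
  simp only [xi, weierstrassP_sub_halfPer_neg]

/-- The monomial `e₁^{α₁} e₂^{α₂} e₃^{α₃}`. -/
def eeMon (q : Par) (α : Fin 3 → ℕ) : ℂ := ∏ i, ee q i ^ α i

theorem eeMon_add (q : Par) (α β : Fin 3 → ℕ) :
    eeMon q (α + β) = eeMon q α * eeMon q β := by
  simp [eeMon, pow_add, Finset.prod_mul_distrib]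

theorem eeMon_single (q : Par) (i : Fin 3) : eeMon q (Pi.single i 1) = ee q i := by
  rw [eeMon, Finset.prod_eq_single i] <;> simp +contextual

theorem eeMon_zero (q : Par) : eeMon q 0 = 1 := by simp [eeMon]

variable {ι : Type*}

/-- The functions of the marked curve and of `(z_j)_{j ∈ I}` spanned by the products
`e^α S^l ∏_{j ∈ I} ξ_{i_j, d_j}(z_j)` of total degree `|α| + l + ∑ d_j = c + D` and with `c ≤ |α|`.
Since `c` bounds the number of factors `e_i` from below, `D` bounds `l + ∑ d_j` from above, and
thus both the degree in `S` and the pole orders. -/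
def U (I : Finset ι) (c D : ℕ) : Submodule ℂ (Par → (ι → ℂ) → ℂ) :=
  Submodule.span ℂ {F | ∃ (α : Fin 3 → ℕ) (l : ℕ) (i : ι → Fin 3) (d : ι → ℕ),
    ∑ t, α t + l + ∑ j ∈ I, d j = c + D ∧ c ≤ ∑ t, α t ∧
    F = fun q z => eeMon q α * S q.L ^ l * ∏ j ∈ I, xi q (i j) (d j) (z j)}

theorem U_le (I : Finset ι) {c D c' D' : ℕ} (h : c' ≤ c) (h' : c + D = c' + D') :
    U I c D ≤ U I c' D' := by
  refine Submodule.span_mono ?_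
  rintro F ⟨α, l, i, d, h1, h2, rfl⟩
  exact ⟨α, l, i, d, by omega, by omega, rfl⟩

theorem U_zero (I : Finset ι) (c D : ℕ) : (fun _ _ => 0) ∈ U I c D := zero_mem _

theorem U_add {I : Finset ι} {c D : ℕ} {F G : Par → (ι → ℂ) → ℂ} (hF : F ∈ U I c D)
    (hG : G ∈ U I c D) : (fun q z => F q z + G q z) ∈ U I c D := add_mem hF hG

theorem U_smul {I : Finset ι} {c D : ℕ} (a : ℂ) {F : Par → (ι → ℂ) → ℂ} (hF : F ∈ U I c D) :
    (fun q z => a * F q z) ∈ U I c D := Submodule.smul_mem _ a hF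

theorem U_mul [DecidableEq ι] {I J : Finset ι} (hIJ : Disjoint I J) {c D c' D' : ℕ}
    {F G : Par → (ι → ℂ) → ℂ} (hF : F ∈ U I c D) (hG : G ∈ U J c' D') :
    (fun q z => F q z * G q z) ∈ U (I ∪ J) (c + c') (D + D') := by
  have : F * G ∈ U (I ∪ J) (c + c') (D + D') := by
    induction hF using Submodule.span_induction with
    | zero => rw [zero_mul]; exact zero_mem _
    | add x y _ _ hx hy => rw [add_mul]; exact add_mem hx hy
    | smul a x _ hx => rw [smul_mul_assoc]; exact Submodule.smul_mem _ _ hx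
    | mem F hF =>
      induction hG using Submodule.span_induction with
      | zero => rw [mul_zero]; exact zero_mem _
      | add x y _ _ hx hy => rw [mul_add]; exact add_mem hx hy
      | smul a x _ hx => rw [mul_smul_comm]; exact Submodule.smul_mem _ _ hx
      | mem G hG =>
        obtain ⟨α, l, i, d, h1, h2, rfl⟩ := hF
        obtain ⟨β, m, i', d', h1', h2', rfl⟩ := hG
        refine Submodule.subset_span ⟨α + β, l + m, fun j => if j ∈ I then i j else i' j,
          fun j => if j ∈ I then d j else d' j, ?_, ?_, ?_⟩
        · have e1 : ∑ j ∈ I, (if j ∈ I then d j else d' j) = ∑ j ∈ I, d j :=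
            Finset.sum_congr rfl fun j hj => by simp [hj]
          have e2 : ∑ j ∈ J, (if j ∈ I then d j else d' j) = ∑ j ∈ J, d' j :=
            Finset.sum_congr rfl fun j hj => by simp [Finset.disjoint_right.mp hIJ hj]
          rw [Finset.sum_union hIJ, e1, e2]
          simp only [Pi.add_apply, Finset.sum_add_distrib]
          omega
        · simp only [Pi.add_apply, Finset.sum_add_distrib]
          omega
        · funext q z
          have e1 : ∏ j ∈ I, xi q (if j ∈ I then i j else i' j) (if j ∈ I then d j else d' j) (z j)
              = ∏ j ∈ I, xi q (i j) (d j) (z j) :=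
            Finset.prod_congr rfl fun j hj => by simp [hj]
          have e2 : ∏ j ∈ J, xi q (if j ∈ I then i j else i' j) (if j ∈ I then d j else d' j) (z j)
              = ∏ j ∈ J, xi q (i' j) (d' j) (z j) :=
            Finset.prod_congr rfl fun j hj => by simp [Finset.disjoint_right.mp hIJ hj]
          rw [Finset.prod_union hIJ, e1, e2]
          simp only [Pi.mul_apply, eeMon_add, pow_add]
          ring
  exact this

theorem U_empty_mul {J : Finset ι} {c D c' D' : ℕ}
    {F G : Par → (ι → ℂ) → ℂ} (hF : F ∈ U ∅ c D) (hG : G ∈ U J c' D') :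
    (fun q z => F q z * G q z) ∈ U J (c + c') (D + D') := by
  classical
  simpa using U_mul (Finset.disjoint_empty_left J) hF hG

theorem U_eeMon (α : Fin 3 → ℕ) : (fun q _ => eeMon q α) ∈ U (∅ : Finset ι) (∑ t, α t) 0 :=
  Submodule.subset_span ⟨α, 0, fun _ => 0, fun _ => 0, by simp, le_rfl, by simp⟩

theorem U_ee (i : Fin 3) : (fun q _ => ee q i) ∈ U (∅ : Finset ι) 1 0 := by
  have := U_eeMon (ι := ι) (Pi.single i 1)
  simpa [eeMon_single, Finset.sum_pi_single'] using this

theorem U_const (a : ℂ) : (fun _ _ => a) ∈ U (∅ : Finset ι) 0 0 := by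
  have := Submodule.smul_mem _ a (U_eeMon (ι := ι) 0)
  simp only [eeMon_zero, Pi.zero_apply, Finset.sum_const_zero] at this
  convert this using 1
  ext q z; simp

theorem U_S : (fun q _ => S q.L) ∈ U (∅ : Finset ι) 0 1 :=
  Submodule.subset_span ⟨0, 1, fun _ => 0, fun _ => 0, by simp, by simp, by simp [eeMon_zero]⟩

theorem U_xi (j : ι) (i : Fin 3) (d : ℕ) : (fun q z => xi q i d (z j)) ∈ U {j} 0 d :=
  Submodule.subset_span ⟨0, 0, fun _ => i, fun _ => d, by simp, by simp, by simp [eeMon_zero]⟩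

theorem U_sum {I : Finset ι} {c D : ℕ} {τ : Type*} (s : Finset τ) {F : τ → Par → (ι → ℂ) → ℂ}
    (hF : ∀ t ∈ s, F t ∈ U I c D) : (fun q z => ∑ t ∈ s, F t q z) ∈ U I c D := by
  have : (fun q z => ∑ t ∈ s, F t q z) = ∑ t ∈ s, F t := by
    funext q z; simp [Finset.sum_apply]
  rw [this]
  exact Submodule.sum_mem _ hF

theorem U_pow_empty {F : Par → (ι → ℂ) → ℂ} (hF : F ∈ U ∅ 1 0) (n : ℕ) :
    (fun q z => F q z ^ n) ∈ U (∅ : Finset ι) n 0 := by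
  induction n with
  | zero => simpa using U_const 1
  | succ n ih => simpa [pow_succ] using U_empty_mul ih hF

theorem U_g₂ : (fun q _ => q.L.g₂) ∈ U (∅ : Finset ι) 2 0 := by
  have h : ∀ i j : Fin 3, (fun q _ => ee q i * ee q j) ∈ U (∅ : Finset ι) 2 0 := fun i j => by
    have h1 := U_empty_mul (U_ee (ι := ι) i) (U_ee j)
    exact h1
  have e : (fun q _ => q.L.g₂ : Par → (ι → ℂ) → ℂ) = fun q _ =>
      -4 * (ee q 0 * ee q 1 + ee q 0 * ee q 2 + ee q 1 * ee q 2) := by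
    funext q _; exact (ee_relations q).2.1
  have h' := U_smul (-4) (U_add (U_add (h 0 1) (h 0 2)) (h 1 2))
  rw [e]
  exact h'

theorem U_g₃ : (fun q _ => q.L.g₃) ∈ U (∅ : Finset ι) 3 0 := by
  have e : (fun q _ => q.L.g₃ : Par → (ι → ℂ) → ℂ) = fun q _ =>
      4 * (ee q 0 * ee q 1 * ee q 2) := by
    funext q _; exact (ee_relations q).2.2
  have h' := U_smul 4 (U_empty_mul (U_empty_mul (U_ee (ι := ι) 0) (U_ee 1)) (U_ee 2))
  rw [e]
  exact h'

/-- Families of polynomials in one variable `X`, homogeneous of degree `n` in `e₁, e₂, e₃, X`. -/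
def HomPoly (n : ℕ) : Submodule ℂ (Par → Polynomial ℂ) :=
  Submodule.span ℂ {p | ∃ (α : Fin 3 → ℕ) (j : ℕ), ∑ t, α t + j = n ∧
    p = fun q => Polynomial.C (eeMon q α) * Polynomial.X ^ j}

theorem HomPoly_zero (n : ℕ) : (fun _ => 0) ∈ HomPoly n := zero_mem _

theorem HomPoly_add {n : ℕ} {p r : Par → Polynomial ℂ} (hp : p ∈ HomPoly n)
    (hr : r ∈ HomPoly n) : (fun q => p q + r q) ∈ HomPoly n := add_mem hp hr

theorem HomPoly_sub {n : ℕ} {p r : Par → Polynomial ℂ} (hp : p ∈ HomPoly n)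
    (hr : r ∈ HomPoly n) : (fun q => p q - r q) ∈ HomPoly n := sub_mem hp hr

theorem HomPoly_smul {n : ℕ} (a : ℂ) {p : Par → Polynomial ℂ} (hp : p ∈ HomPoly n) :
    (fun q => Polynomial.C a * p q) ∈ HomPoly n := by
  have e : (fun q => Polynomial.C a * p q) = a • p := by
    funext q; simp [Polynomial.smul_eq_C_mul]
  rw [e]
  exact Submodule.smul_mem _ a hp

theorem HomPoly_mul {n m : ℕ} {p r : Par → Polynomial ℂ} (hp : p ∈ HomPoly n)
    (hr : r ∈ HomPoly m) : (fun q => p q * r q) ∈ HomPoly (n + m) := by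
  have : p * r ∈ HomPoly (n + m) := by
    induction hp using Submodule.span_induction with
    | zero => rw [zero_mul]; exact zero_mem _
    | add x y _ _ hx hy => rw [add_mul]; exact add_mem hx hy
    | smul a x _ hx => rw [smul_mul_assoc]; exact Submodule.smul_mem _ _ hx
    | mem F hF =>
      induction hr using Submodule.span_induction with
      | zero => rw [mul_zero]; exact zero_mem _
      | add x y _ _ hx hy => rw [mul_add]; exact add_mem hx hy
      | smul a x _ hx => rw [mul_smul_comm]; exact Submodule.smul_mem _ _ hx
      | mem G hG =>
        obtain ⟨α, j, h1, rfl⟩ := hF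
        obtain ⟨β, k, h2, rfl⟩ := hG
        refine Submodule.subset_span ⟨α + β, j + k, ?_, ?_⟩
        · simp only [Pi.add_apply, Finset.sum_add_distrib]; omega
        · funext q
          simp only [Pi.mul_apply, eeMon_add, pow_add, Polynomial.C_mul]
          ring
  exact this

theorem HomPoly_X : (fun _ => Polynomial.X) ∈ HomPoly 1 :=
  Submodule.subset_span ⟨0, 1, by simp, by simp [eeMon_zero]⟩

theorem HomPoly_X_pow (n : ℕ) : (fun _ => Polynomial.X ^ n) ∈ HomPoly n :=
  Submodule.subset_span ⟨0, n, by simp, by simp [eeMon_zero]⟩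

theorem HomPoly_eeMon (α : Fin 3 → ℕ) :
    (fun q => Polynomial.C (eeMon q α)) ∈ HomPoly (∑ t, α t) :=
  Submodule.subset_span ⟨α, 0, by simp, by simp⟩

theorem HomPoly_C {c : ℕ} {F : Par → (Unit → ℂ) → ℂ} (hF : F ∈ U (∅ : Finset Unit) c 0) :
    (fun q => Polynomial.C (F q 0)) ∈ HomPoly c := by
  induction hF using Submodule.span_induction with
  | zero => simpa using HomPoly_zero c
  | add x y _ _ hx hy => simpa using HomPoly_add hx hy
  | smul a x _ hx => simpa using HomPoly_smul a hx
  | mem F hF =>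
    obtain ⟨α, l, i, d, h1, h2, rfl⟩ := hF
    have hl : l = 0 := by simp at h1; omega
    refine Submodule.subset_span ⟨α, 0, by simp at h1 ⊢; omega, ?_⟩
    simp [hl]

theorem HomPoly_g₂ : (fun q => Polynomial.C q.L.g₂) ∈ HomPoly 2 :=
  HomPoly_C (F := fun q _ => q.L.g₂) U_g₂

theorem HomPoly_g₃ : (fun q => Polynomial.C q.L.g₃) ∈ HomPoly 3 :=
  HomPoly_C (F := fun q _ => q.L.g₃) U_g₃

open Polynomial in
theorem HomPoly_cubic : (fun q => 4 * X ^ 3 - C q.L.g₂ * X - C q.L.g₃ : Par → ℂ[X]) ∈ HomPoly 3 := by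
  have h1 := HomPoly_smul 4 (HomPoly_X_pow 3)
  have h2 := HomPoly_mul HomPoly_g₂ HomPoly_X
  have h := HomPoly_sub (HomPoly_sub h1 h2) HomPoly_g₃
  exact h

open Polynomial in
theorem HomPoly_quadratic : (fun q => 6 * X ^ 2 - C (q.L.g₂ / 2) : Par → ℂ[X]) ∈ HomPoly 2 := by
  have e : (fun q => 6 * X ^ 2 - C (q.L.g₂ / 2) : Par → ℂ[X]) =
      fun q => C 6 * X ^ 2 - C (1 / 2) * C q.L.g₂ := by
    funext q
    rw [← C_mul, one_div_mul_eq_div]; rfl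
  rw [e]
  exact HomPoly_sub (HomPoly_smul 6 (HomPoly_X_pow 2)) (HomPoly_smul (1 / 2) HomPoly_g₂)

open Polynomial in
theorem HomPoly_secondDeriv {n : ℕ} {p : Par → ℂ[X]} (hp : p ∈ HomPoly n) :
    (fun q => derivative (derivative (p q)) * (4 * X ^ 3 - C q.L.g₂ * X - C q.L.g₃) +
      derivative (p q) * (6 * X ^ 2 - C (q.L.g₂ / 2))) ∈ HomPoly (n + 1) := by
  induction hp using Submodule.span_induction with
  | zero => simpa using HomPoly_zero (n + 1)
  | add x y _ _ hx hy =>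
    convert HomPoly_add hx hy using 2
    simp only [Pi.add_apply, derivative_add]; ring
  | smul a x _ hx =>
    convert HomPoly_smul a hx using 2
    simp only [Pi.smul_apply, smul_eq_C_mul, derivative_C_mul]; ring
  | mem F hF =>
    obtain ⟨α, j, h1, rfl⟩ := hF
    rcases j with _ | _ | j
    · simpa using HomPoly_zero (n + 1)
    · have := HomPoly_mul (HomPoly_eeMon α) HomPoly_quadratic
      rw [show ∑ t, α t + 2 = n + 1 by omega] at this
      simpa using this
    · have t1 := HomPoly_mul (HomPoly_eeMon α) (HomPoly_mul (HomPoly_X_pow j) HomPoly_cubic)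
      have t2 := HomPoly_mul (HomPoly_eeMon α)
        (HomPoly_mul (HomPoly_X_pow (j + 1)) HomPoly_quadratic)
      rw [show ∑ t, α t + (j + 3) = n + 1 by omega] at t1
      rw [show ∑ t, α t + (j + 1 + 2) = n + 1 by omega] at t2
      convert HomPoly_add (HomPoly_smul ((j + 2) * (j + 1)) t1) (HomPoly_smul (j + 2) t2) using 2
      have e2 : (((j + 1 + 1 : ℕ) : ℂ)) = j + 2 := by push_cast; ring
      have e1 : (((j + 1 : ℕ) : ℂ)) = j + 1 := by push_cast; ring
      simp only [derivative_C_mul, derivative_X_pow, Nat.add_sub_cancel, C_mul, e1, e2]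
      ring

theorem derivPoly_mem (d : ℕ) : (fun q => derivPoly q.L d) ∈ HomPoly (d + 1) := by
  induction d with
  | zero => exact HomPoly_X
  | succ d ih => exact HomPoly_secondDeriv ih

theorem U_eval {n : ℕ} {p : Par → Polynomial ℂ} (hp : p ∈ HomPoly n) {F : Par → (ι → ℂ) → ℂ}
    (hF : F ∈ U ∅ 1 0) : (fun q z => (p q).eval (F q z)) ∈ U (∅ : Finset ι) n 0 := by
  induction hp using Submodule.span_induction with
  | zero => simpa using U_zero (∅ : Finset ι) n 0
  | add x y _ _ hx hy => simpa using U_add hx hy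
  | smul a x _ hx => simpa using U_smul a hx
  | mem G hG =>
    obtain ⟨α, j, h1, rfl⟩ := hG
    have := U_empty_mul (U_eeMon α) (U_pow_empty hF j)
    rw [h1] at this
    simpa using this

end

section

variable {ι : Type*}

/-! ### Families of local expansions -/

/-- The points at which the correlators are evaluated: no `z_j` is a ramification point or a pole
of `x`. -/
def Dom (q : Par) (z : ι → ℂ) : Prop := ∀ j, 2 * z j ∉ q.L.lattice

/-- A family `f q z` of functions of a local coordinate `s`, each with a Taylor series at `s = 0`,
such that for `k ≤ N` the coefficient of `s^{2k}` is a universal function in `W k`. Nothing is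
required of the odd coefficients. -/
def Good (W : ℕ → Submodule ℂ (Par → (ι → ℂ) → ℂ)) (N : ℕ) (f : Par → (ι → ℂ) → ℂ → ℂ) : Prop :=
  ∃ p : Par → (ι → ℂ) → PowerSeries ℂ, (∀ q z, Dom q z → HasTaylor (f q z) (p q z)) ∧
    ∀ k ≤ N, ∃ Φ ∈ W k, ∀ q z, Dom q z → PowerSeries.coeff (2 * k) (p q z) = Φ q z

/-- A family of functions that are even near `s = 0`. -/
def EvenFam (f : Par → (ι → ℂ) → ℂ → ℂ) : Prop :=
  ∀ q z, Dom q z → ∀ᶠ s in 𝓝[≠] (0 : ℂ), f q z (-s) = f q z s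

section Good

variable {W W' W'' : ℕ → Submodule ℂ (Par → (ι → ℂ) → ℂ)} {N : ℕ} {f g : Par → (ι → ℂ) → ℂ → ℂ}

theorem Good.congr (hf : Good W N f)
    (h : ∀ q z, Dom q z → ∀ᶠ s in 𝓝[≠] (0 : ℂ), g q z s = f q z s) : Good W N g := by
  obtain ⟨p, hp, hc⟩ := hf
  exact ⟨p, fun q z hz => (hp q z hz).congr (h q z hz), hc⟩

theorem Good.mono (hf : Good W N f) (h : ∀ k, W k ≤ W' k) : Good W' N f := by
  obtain ⟨p, hp, hc⟩ := hf
  refine ⟨p, hp, fun k hk => ?_⟩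
  obtain ⟨Φ, hΦ, e⟩ := hc k hk
  exact ⟨Φ, h k hΦ, e⟩

theorem Good.add (hf : Good W N f) (hg : Good W N g) :
    Good W N (fun q z s => f q z s + g q z s) := by
  obtain ⟨p, hp, hc⟩ := hf
  obtain ⟨p', hp', hc'⟩ := hg
  refine ⟨fun q z => p q z + p' q z, fun q z hz => (hp q z hz).add (hp' q z hz), fun k hk => ?_⟩
  obtain ⟨Φ, hΦ, e⟩ := hc k hk
  obtain ⟨Φ', hΦ', e'⟩ := hc' k hk
  exact ⟨Φ + Φ', add_mem hΦ hΦ', fun q z hz => by simp [e q z hz, e' q z hz]⟩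

theorem Good.const_mul (a : ℂ) (hf : Good W N f) : Good W N (fun q z s => a * f q z s) := by
  obtain ⟨p, hp, hc⟩ := hf
  refine ⟨fun q z => PowerSeries.C a * p q z, fun q z hz => (hp q z hz).const_mul a,
    fun k hk => ?_⟩
  obtain ⟨Φ, hΦ, e⟩ := hc k hk
  exact ⟨a • Φ, Submodule.smul_mem _ a hΦ, fun q z hz => by simp [e q z hz]⟩

theorem Good.of_mem {Φ : Par → (ι → ℂ) → ℂ} (hΦ : Φ ∈ W 0) : Good W N (fun q z _ => Φ q z) := by
  refine ⟨fun q z => PowerSeries.C (Φ q z), fun q z _ => HasTaylor.const _, fun k _ => ?_⟩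
  rcases k with _ | k
  · exact ⟨Φ, hΦ, fun q z _ => by simp⟩
  · exact ⟨0, zero_mem _, fun q z _ => by
      rw [PowerSeries.coeff_C, if_neg (by omega)]; rfl⟩

theorem Good.zero : Good W N (fun _ _ _ => 0) := Good.of_mem (Φ := 0) (zero_mem _)

theorem Good.sum {τ : Type*} (t : Finset τ) {f : τ → Par → (ι → ℂ) → ℂ → ℂ}
    (h : ∀ i ∈ t, Good W N (f i)) : Good W N (fun q z s => ∑ i ∈ t, f i q z s) := by
  classical
  induction t using Finset.induction_on with
  | empty => simpa using Good.zero
  | insert a t ha ih =>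
    simp only [Finset.sum_insert ha]
    exact (h a (Finset.mem_insert_self a t)).add
      (ih fun i hi => h i (Finset.mem_insert_of_mem hi))

theorem Good.shift {N' : ℕ} (h : ℕ) (hf : Good W N f) (hN : N' ≤ N + h)
    (hW : ∀ k, W k ≤ W' (k + h)) : Good W' N' (fun q z s => s ^ (2 * h) * f q z s) := by
  obtain ⟨p, hp, hc⟩ := hf
  refine ⟨fun q z => PowerSeries.X ^ (2 * h) * p q z,
    fun q z hz => (HasTaylor.monomial _).mul (hp q z hz), fun k hk => ?_⟩
  by_cases hkh : h ≤ k
  · obtain ⟨Φ, hΦ, e⟩ := hc (k - h) (by omega)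
    refine ⟨Φ, ?_, fun q z hz => ?_⟩
    · have := hW (k - h) hΦ
      rwa [Nat.sub_add_cancel hkh] at this
    · rw [PowerSeries.coeff_X_pow_mul', if_pos (by omega), ← e q z hz]
      congr 2; omega
  · exact ⟨0, zero_mem _, fun q z _ => by
      rw [PowerSeries.coeff_X_pow_mul', if_neg (by omega)]; rfl⟩

theorem Good.mul (hf : Good W N f) (hfe : EvenFam f) (hg : Good W' N g)
    (hW : ∀ i j, ∀ a ∈ W i, ∀ b ∈ W' j, (fun q z => a q z * b q z) ∈ W'' (i + j)) :
    Good W'' N (fun q z s => f q z s * g q z s) := by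
  obtain ⟨p, hp, hc⟩ := hf
  obtain ⟨p', hp', hc'⟩ := hg
  refine ⟨fun q z => p q z * p' q z, fun q z hz => (hp q z hz).mul (hp' q z hz), fun k hk => ?_⟩
  choose! Φ hΦ e using hc
  choose! Φ' hΦ' e' using hc'
  refine ⟨∑ ij ∈ Finset.HasAntidiagonal.antidiagonal k, (fun q z => Φ ij.1 q z * Φ' ij.2 q z),
    Submodule.sum_mem _ fun ij hij => ?_, fun q z hz => ?_⟩
  · have := Finset.HasAntidiagonal.mem_antidiagonal.mp hij
    rw [← this]
    exact hW _ _ _ (hΦ _ (by omega)) _ (hΦ' _ (by omega))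
  · rw [coeff_even_mul fun k => (hp q z hz).coeff_odd_of_even (hfe q z hz) k]
    simp only [Finset.sum_apply]
    refine Finset.sum_congr rfl fun ij hij => ?_
    have := Finset.HasAntidiagonal.mem_antidiagonal.mp hij
    rw [e _ (by omega) q z hz, e' _ (by omega) q z hz]

/-- The constant term of a product needs no parity assumption. -/
theorem Good.mul_zero_order (hf : Good W 0 f) (hg : Good W' 0 g)
    (hW : ∀ a ∈ W 0, ∀ b ∈ W' 0, (fun q z => a q z * b q z) ∈ W'' 0) :
    Good W'' 0 (fun q z s => f q z s * g q z s) := by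
  obtain ⟨p, hp, hc⟩ := hf
  obtain ⟨p', hp', hc'⟩ := hg
  refine ⟨fun q z => p q z * p' q z, fun q z hz => (hp q z hz).mul (hp' q z hz), fun k hk => ?_⟩
  obtain rfl : k = 0 := by omega
  obtain ⟨Φ, hΦ, e⟩ := hc 0 le_rfl
  obtain ⟨Φ', hΦ', e'⟩ := hc' 0 le_rfl
  refine ⟨_, hW _ hΦ _ hΦ', fun q z hz => ?_⟩
  have h1 := e q z hz
  have h2 := e' q z hz
  simp only [mul_zero] at h1 h2 ⊢
  rw [PowerSeries.coeff_mul, Finset.HasAntidiagonal.antidiagonal_zero, Finset.sum_singleton, h1, h2]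

theorem Good.comp_neg (hf : Good W N f) : Good W N (fun q z s => f q z (-s)) := by
  obtain ⟨p, hp, hc⟩ := hf
  refine ⟨_, fun q z hz => (hp q z hz).comp_neg, fun k hk => ?_⟩
  obtain ⟨Φ, hΦ, e⟩ := hc k hk
  refine ⟨Φ, hΦ, fun q z hz => ?_⟩
  rw [PowerSeries.coeff_rescale, e q z hz, pow_mul]; simp

theorem Good.comp_two_mul (hf : Good W N f) : Good W N (fun q z s => f q z (2 * s)) := by
  obtain ⟨p, hp, hc⟩ := hf
  refine ⟨_, fun q z hz => (hp q z hz).comp_mul two_ne_zero, fun k hk => ?_⟩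
  obtain ⟨Φ, hΦ, e⟩ := hc k hk
  refine ⟨_, Submodule.smul_mem _ ((2 : ℂ) ^ (2 * k)) hΦ, fun q z hz => ?_⟩
  rw [PowerSeries.coeff_rescale, e q z hz]; rfl

end Good

section EvenFam

variable {f g : Par → (ι → ℂ) → ℂ → ℂ}

theorem EvenFam.mul (hf : EvenFam f) (hg : EvenFam g) :
    EvenFam (fun q z s => f q z s * g q z s) := fun q z hz => by
  filter_upwards [hf q z hz, hg q z hz] with s h1 h2
  rw [h1, h2]

theorem evenFam_pow (n : ℕ) : EvenFam (fun (_ : Par) (_ : ι → ℂ) s => s ^ (2 * n)) :=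
  fun _ _ _ => Eventually.of_forall fun s => by simp [pow_mul]

theorem evenFam_const (Φ : Par → (ι → ℂ) → ℂ) : EvenFam (fun q z _ => Φ q z) :=
  fun _ _ _ => Eventually.of_forall fun _ => rfl

end EvenFam

/-- A monomial in `s²` with a universal coefficient. -/
theorem Good.monomial {I : Finset ι} {c h : ℕ} (N : ℕ) {Φ : Par → (ι → ℂ) → ℂ} (hΦ : Φ ∈ U I c h) :
    Good (U I c) N (fun q z s => s ^ (2 * h) * Φ q z) :=
  Good.shift (W := fun k => U I c (k + h)) (N := N) (f := fun q z _ => Φ q z) h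
    (Good.of_mem (by simpa using hΦ)) (by omega) fun k => le_rfl

theorem Good.empty_mul {I : Finset ι} {c c' N : ℕ} {f g : Par → (ι → ℂ) → ℂ → ℂ}
    (hf : Good (U ∅ c) N f) (hfe : EvenFam f) (hg : Good (U I c') N g) :
    Good (U I (c + c')) N (fun q z s => f q z s * g q z s) :=
  hf.mul hfe hg fun _ _ _ ha _ hb => U_empty_mul ha hb

/-! ### Local expansions of `℘` at the half-periods -/

theorem eventually_notMem (L : PeriodPair) : ∀ᶠ s in 𝓝[≠] (0 : ℂ), s ∉ L.lattice := by
  filter_upwards [self_mem_nhdsWithin,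
    mem_nhdsWithin_of_mem_nhds (L.compl_lattice_sdiff_singleton_mem_nhds 0)] with s hs hs'
  have hs0 : s ≠ 0 := hs
  simp_all

theorem eventually_two_mul_add_notMem (q : Par) (i : Fin 3) :
    ∀ᶠ s in 𝓝[≠] (0 : ℂ), 2 * (halfPer q i + s) ∉ q.L.lattice := by
  have ht : Tendsto (fun s : ℂ => 2 * s) (𝓝[≠] 0) (𝓝[≠] 0) := by
    refine tendsto_nhdsWithin_iff.mpr ⟨?_, ?_⟩
    · have : Tendsto (fun s : ℂ => 2 * s) (𝓝 0) (𝓝 (2 * 0)) := (continuous_const_mul 2).tendsto 0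
      rw [mul_zero] at this
      exact this.mono_left nhdsWithin_le_nhds
    · filter_upwards [self_mem_nhdsWithin] with s hs
      exact mul_ne_zero two_ne_zero hs
  filter_upwards [ht.eventually (eventually_notMem q.L)] with s hs h
  refine hs ?_
  have := sub_mem h (two_mul_halfPer_mem q i)
  convert this using 1; ring

/-- The expansion of `℘` at a half-period has even coefficients that are polynomials in the `e_i`
alone. -/
theorem good_weierstrassP_halfPer (k : Fin 3) (N : ℕ) :
    Good (fun n => U (∅ : Finset ι) (n + 1) 0) N
      (fun q _ s => q.L.weierstrassP (halfPer q k + s)) := by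
  have han : ∀ q : Par, AnalyticAt ℂ (fun s => q.L.weierstrassP (halfPer q k + s)) 0 := fun q =>
    AnalyticAt.fun_comp (g := q.L.weierstrassP)
      (q.L.analyticOnNhd_weierstrassP _ (by simpa using halfPer_notMem q k)) (by fun_prop)
  refine ⟨_, fun q z _ => hasTaylor_of_analyticAt (han q), fun n _ => ?_⟩
  refine ⟨fun q z => (((2 * n).factorial : ℂ)⁻¹) * (derivPoly q.L n).eval (ee q k),
    U_smul _ (U_eval (F := fun q _ => ee q k) (derivPoly_mem n) (U_ee k)), fun q z _ => ?_⟩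
  rw [PowerSeries.coeff_mk, iteratedDeriv_comp_const_add]
  beta_reduce
  rw [add_zero, iteratedDeriv_weierstrassP _ _ (halfPer_notMem q k), div_eq_inv_mul]
  rfl

theorem deriv_deriv_weierstrassPExcept (L : PeriodPair) {s : ℂ} (hs : s ∉ L.lattice) :
    s ^ 2 * deriv (deriv (L.weierstrassPExcept 0)) s =
      6 * (s ^ 2 * L.weierstrassPExcept 0 s ^ 2) + 12 * L.weierstrassPExcept 0 s -
        L.g₂ / 2 * s ^ 2 := by
  have hopen : IsOpen ((L.lattice : Set ℂ)ᶜ) := L.isClosed_lattice.isOpen_compl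
  have h0 : ∀ w ∉ L.lattice, w ≠ 0 := fun w hw h => hw (h ▸ zero_mem _)
  have e0 : ∀ w, L.weierstrassPExcept 0 w = L.weierstrassP w - (w ^ 2)⁻¹ := by
    intro w
    have := L.weierstrassPExcept_add ⟨0, zero_mem _⟩ w
    simp only [sub_zero, one_div, ne_eq, OfNat.ofNat_ne_zero, not_false_eq_true, zero_pow,
      inv_zero] at this
    rw [← this]; ring
  have d1 : ∀ w ∉ L.lattice, HasDerivAt (L.weierstrassPExcept 0)
      (L.derivWeierstrassP w + 2 * (w ^ 3)⁻¹) w := by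
    intro w hw
    have hP : HasDerivAt L.weierstrassP (L.derivWeierstrassP w) w := by
      simpa using (L.analyticOnNhd_weierstrassP w hw).differentiableAt.hasDerivAt
    have hi := (hasDerivAt_pow 2 w).fun_inv (pow_ne_zero 2 (h0 w hw))
    have := hP.fun_sub hi
    rw [show L.weierstrassPExcept 0 = fun w => L.weierstrassP w - (w ^ 2)⁻¹ from funext e0]
    refine this.congr_deriv ?_
    have := h0 w hw
    field_simp
    norm_num
    ring
  have d2 : HasDerivAt (deriv (L.weierstrassPExcept 0))
      (6 * L.weierstrassP s ^ 2 - L.g₂ / 2 - 6 * (s ^ 4)⁻¹) s := by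
    have hy : HasDerivAt L.derivWeierstrassP (6 * L.weierstrassP s ^ 2 - L.g₂ / 2) s := by
      rw [← deriv_derivWeierstrassP L hs]
      exact (L.analyticOnNhd_derivWeierstrassP s hs).differentiableAt.hasDerivAt
    have hi := ((hasDerivAt_pow 3 s).fun_inv (pow_ne_zero 3 (h0 s hs))).const_mul 2
    have h1 := (hy.fun_add hi).congr_of_eventuallyEq (f₁ := deriv (L.weierstrassPExcept 0)) (by
      filter_upwards [hopen.mem_nhds hs] with w hw
      exact (d1 w hw).deriv)
    refine h1.congr_deriv ?_
    have := h0 s hs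
    field_simp
    norm_num
    ring
  rw [d2.deriv, e0]
  have := h0 s hs
  field_simp
  ring

/-- The even Laurent coefficients of `℘` at `0`, beyond the leading one, are polynomials in the
`e_i`, through the recursion given by `℘'' = 6℘² - g₂/2`. The recursion degenerates at the
coefficient of `s⁴`, which is `g₃/28`. -/
theorem weierstrassPExcept_coeff_mem (n : ℕ) :
    (fun q _ => iteratedDeriv (2 * n) (q.L.weierstrassPExcept 0) 0 / ((2 * n).factorial : ℂ) :
      Par → (ι → ℂ) → ℂ) ∈ U (∅ : Finset ι) (n + 1) 0 := by
  have c0 : ∀ L : PeriodPair, ∀ n ≠ 0, iteratedDeriv n (L.weierstrassPExcept 0) 0 =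
      (n + 1).factorial * L.G (n + 2) := by
    intro L n hn
    rw [L.iteratedDeriv_weierstrassPExcept_self 0, if_neg hn, L.sumInvPow_zero]
  induction n using Nat.strong_induction_on with
  | _ n ih =>
  match n with
  | 0 => simpa using U_zero (∅ : Finset ι) 1 0
  | 1 =>
    have h := U_smul (1 / 20) (U_g₂ (ι := ι))
    convert h using 3 with q z
    rw [c0 _ _ (by norm_num), PeriodPair.g₂]
    simp [Nat.factorial]; ring
  | 2 =>
    have h := U_smul (1 / 28) (U_g₃ (ι := ι))
    convert h using 3 with q z
    rw [c0 _ _ (by norm_num), PeriodPair.g₃]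
    simp [Nat.factorial]; ring
  | n + 3 =>
    set a : ℕ → Par → ℂ := fun n q =>
      iteratedDeriv n (q.L.weierstrassPExcept 0) 0 / n.factorial with ha
    have key : ∀ q : Par, a (2 * (n + 3)) q = 6 / ((2 * n + 6) * (2 * n + 5) - 12) *
        ∑ ij ∈ Finset.HasAntidiagonal.antidiagonal (n + 2), a (2 * ij.1) q * a (2 * ij.2) q := by
      intro q
      set φ := q.L.weierstrassPExcept 0 with hφ
      have hφa : AnalyticAt ℂ φ 0 := q.L.analyticAt_weierstrassPExcept 0
      have t0 := hasTaylor_of_analyticAt hφa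
      have t2 := hasTaylor_of_analyticAt hφa.deriv.deriv
      have lhs := (HasTaylor.monomial 2).mul t2
      have rhs := ((((HasTaylor.monomial 2).mul (t0.mul t0)).const_mul 6).add
        (t0.const_mul 12)).add ((HasTaylor.monomial 2).const_mul (-(q.L.g₂ / 2)))
      have heq := lhs.unique (rhs.congr (by
        filter_upwards [eventually_notMem q.L] with s hs
        have := deriv_deriv_weierstrassPExcept q.L hs
        rw [← hφ] at this
        rw [this]; ring))
      have hodd := t0.coeff_odd_of_even (Eventually.of_forall fun s => by
        simpa using q.L.weierstrassPExcept_neg 0 s)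
      have h1 := congrArg (PowerSeries.coeff (2 * (n + 2) + 2)) heq
      simp only [map_add, PowerSeries.coeff_C_mul, PowerSeries.coeff_X_pow_mul,
        PowerSeries.coeff_X_pow, coeff_even_mul hodd] at h1
      rw [if_neg (by omega)] at h1
      simp only [PowerSeries.coeff_mk] at h1
      have h2 : iteratedDeriv (2 * (n + 2)) (deriv (deriv φ)) 0 =
          iteratedDeriv (2 * (n + 2) + 2) φ 0 := by
        rw [iteratedDeriv_succ', iteratedDeriv_succ']
      have h3 : (((2 * (n + 2) + 2).factorial : ℕ) : ℂ) =
          (2 * n + 6) * (2 * n + 5) * ((2 * (n + 2)).factorial : ℕ) := by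
        rw [Nat.factorial_succ, Nat.factorial_succ]; push_cast; ring
      have hden : ((2 * n + 6) * (2 * n + 5) - 12 : ℂ) ≠ 0 := by
        have : ((2 * n + 6) * (2 * n + 5) - 12 : ℂ) = ((4 * n ^ 2 + 22 * n + 18 : ℕ) : ℂ) := by
          push_cast; ring
        rw [this]
        exact_mod_cast (by omega : 4 * n ^ 2 + 22 * n + 18 ≠ 0)
      have hf : (((2 * (n + 2)).factorial : ℕ) : ℂ) ≠ 0 := by
        exact_mod_cast Nat.factorial_ne_zero _
      have h5 : ((2 * n + 6) * (2 * n + 5) : ℂ) ≠ 0 := by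
        have : ((2 * n + 6) * (2 * n + 5) : ℂ) = ((4 * n ^ 2 + 22 * n + 30 : ℕ) : ℂ) := by
          push_cast; ring
        rw [this]
        exact_mod_cast (by omega : 4 * n ^ 2 + 22 * n + 30 ≠ 0)
      have h4 : iteratedDeriv (2 * (n + 2)) (deriv (deriv φ)) 0 / ((2 * (n + 2)).factorial : ℕ) =
          (2 * n + 6) * (2 * n + 5) * a (2 * (n + 3)) q := by
        simp only [ha]
        rw [h2, show 2 * (n + 3) = 2 * (n + 2) + 2 by ring, h3, ← hφ, mul_div_assoc',
          mul_div_mul_left _ _ h5]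
      rw [h4] at h1
      have h6 : iteratedDeriv (2 * (n + 2) + 2) φ 0 / ((2 * (n + 2) + 2).factorial : ℕ) =
          a (2 * (n + 3)) q := by
        simp only [ha]; rw [show 2 * (n + 3) = 2 * (n + 2) + 2 by ring]
      rw [h6] at h1
      rw [div_mul_eq_mul_div, eq_div_iff hden]
      linear_combination h1
    have hm : (fun q _ => 6 / ((2 * n + 6) * (2 * n + 5) - 12 : ℂ) *
        ∑ ij ∈ Finset.HasAntidiagonal.antidiagonal (n + 2), a (2 * ij.1) q * a (2 * ij.2) q) ∈
          U (∅ : Finset ι) (n + 3 + 1) 0 := by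
      have hs := U_sum (Finset.HasAntidiagonal.antidiagonal (n + 2))
        (F := fun ij q (_ : ι → ℂ) => a (2 * ij.1) q * a (2 * ij.2) q)
        (I := ∅) (c := n + 3 + 1) (D := 0) (fun ij hij => by
          have hs := Finset.HasAntidiagonal.mem_antidiagonal.mp hij
          have h1 := U_empty_mul (ih ij.1 (by omega)) (ih ij.2 (by omega))
          rw [show ij.1 + 1 + (ij.2 + 1) = n + 3 + 1 by omega] at h1
          exact h1)
      exact U_smul _ hs
    have e : (fun q _ => a (2 * (n + 3)) q : Par → (ι → ℂ) → ℂ) = _ :=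
      funext fun q => funext fun _ => key q
    exact e ▸ hm

theorem good_sq_mul_weierstrassP (N : ℕ) :
    Good (U (∅ : Finset ι) 0) N (fun q _ s => s ^ 2 * q.L.weierstrassP s) := by
  have h1 : Good (fun n => U (∅ : Finset ι) (n + 1) 0) N
      (fun q _ s => q.L.weierstrassPExcept 0 s) := by
    refine ⟨_, fun q z _ => hasTaylor_of_analyticAt (q.L.analyticAt_weierstrassPExcept 0),
      fun n _ => ⟨_, weierstrassPExcept_coeff_mem n, fun q z _ => ?_⟩⟩
    rw [PowerSeries.coeff_mk]
  have h2 : Good (U (∅ : Finset ι) 0) N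
      (fun q _ s => s ^ (2 * 1) * q.L.weierstrassPExcept 0 s) :=
    h1.shift 1 (by omega) fun k => U_le _ (by omega) (by omega)
  have h3 : Good (U (∅ : Finset ι) 0) N (fun _ _ _ => 1) :=
    Good.of_mem (Φ := fun _ _ => 1) (U_const 1)
  refine (h3.add h2).congr fun q z _ => ?_
  filter_upwards [self_mem_nhdsWithin] with s hs
  have hs0 : s ≠ 0 := hs
  have := q.L.ite_eq_one_sub_sq_mul_weierstrassP 0 (zero_mem _) s
  simp [hs0] at this
  rw [this]; ring

theorem good_sq_mul_weierstrassP_sub (i j : Fin 3) (N : ℕ) :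
    Good (U (∅ : Finset ι) 0) N
      (fun q _ s => s ^ (2 * 1) * q.L.weierstrassP (halfPer q i + s - halfPer q j)) := by
  by_cases hij : i = j
  · subst hij
    refine (good_sq_mul_weierstrassP N).congr fun q z _ => Eventually.of_forall fun s => ?_
    rw [add_sub_cancel_left]
  · obtain ⟨k, hik, hjk⟩ := exists_third i j hij
    have h := (good_weierstrassP_halfPer (ι := ι) k N).shift (W' := U ∅ 0) (N' := N) 1 (by omega)
      fun k => U_le _ (by omega) (by omega)
    refine h.congr fun q z _ => Eventually.of_forall fun s => ?_
    rw [← weierstrassP_halfPer_sub_add q hij hik hjk, add_sub_right_comm]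

theorem weierstrassP_halfPer_sub_halfPer_neg (q : Par) (i j : Fin 3) (s : ℂ) :
    q.L.weierstrassP (halfPer q i + -s - halfPer q j) =
      q.L.weierstrassP (halfPer q i + s - halfPer q j) := by
  rw [← weierstrassP_sub_halfPer_neg q j (halfPer q i + s),
    ← weierstrassP_add_mem (two_mul_halfPer_mem q i) (-(halfPer q i + s) - halfPer q j)]
  congr 1; ring

theorem xi_halfPer_add_neg (q : Par) (i j : Fin 3) (d : ℕ) (s : ℂ) :
    xi q j d (halfPer q i + -s) = xi q j d (halfPer q i + s) := by
  simp only [xi, weierstrassP_halfPer_sub_halfPer_neg]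

theorem evenFam_xi (i j : Fin 3) (d : ℕ) :
    EvenFam (fun q (_ : ι → ℂ) s => xi q j d (halfPer q i + s)) :=
  fun q _ _ => Eventually.of_forall fun s => xi_halfPer_add_neg q i j d s

theorem Good.pow_empty {N : ℕ} {f : Par → (ι → ℂ) → ℂ → ℂ} (hf : Good (U ∅ 0) N f)
    (hfe : EvenFam f) (n : ℕ) : Good (U (∅ : Finset ι) 0) N (fun q z s => f q z s ^ n) := by
  induction n with
  | zero =>
    have h : Good (U (∅ : Finset ι) 0) N (fun _ _ _ => 1) :=
      Good.of_mem (Φ := fun _ _ => 1) (U_const 1)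
    simpa using h
  | succ n ih =>
    have h := hf.empty_mul hfe ih
    simpa only [pow_succ'] using h

/-- Near the half-period with label `i`, the function `ξ_{j,d}` has a pole of order at most
`2d + 2`, and universal Laurent coefficients. -/
theorem good_xi (i j : Fin 3) (d N : ℕ) :
    Good (U (∅ : Finset ι) 0) N
      (fun q _ s => s ^ (2 * (d + 1)) * xi q j d (halfPer q i + s)) := by
  have hp : ∀ {n : ℕ} {p : Par → Polynomial ℂ}, p ∈ HomPoly n → Good (U (∅ : Finset ι) 0) N
      (fun q _ s => s ^ (2 * n) *
        (p q).eval (q.L.weierstrassP (halfPer q i + s - halfPer q j))) := by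
    intro n p hp
    induction hp using Submodule.span_induction with
    | zero => simpa using Good.zero
    | add x y _ _ hx hy =>
      refine (hx.add hy).congr fun q z _ => Eventually.of_forall fun s => ?_
      rw [Pi.add_apply, Polynomial.eval_add]; ring
    | smul a x _ hx =>
      refine (hx.const_mul a).congr fun q z _ => Eventually.of_forall fun s => ?_
      rw [Pi.smul_apply, Polynomial.eval_smul, smul_eq_mul]; ring
    | mem F hF =>
      obtain ⟨α, k, h1, rfl⟩ := hF
      have m1 := Good.monomial N (U_le ∅ (Nat.zero_le _) (by simp) (U_eeMon (ι := ι) α) :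
        (fun q _ => eeMon q α) ∈ U (∅ : Finset ι) 0 (∑ t, α t))
      have m2 := (good_sq_mul_weierstrassP_sub (ι := ι) i j N).pow_empty (fun q z _ =>
        Eventually.of_forall fun s => by
          beta_reduce
          rw [weierstrassP_halfPer_sub_halfPer_neg, pow_mul, neg_sq, ← pow_mul]) k
      refine (m1.empty_mul ((evenFam_pow _).mul (evenFam_const _)) m2).congr
        fun q z _ => Eventually.of_forall fun s => ?_
      rw [← h1]
      simp only [Polynomial.eval_mul, Polynomial.eval_C, Polynomial.eval_pow, Polynomial.eval_X]
      ring
  have h1 := hp (derivPoly_mem d)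
  have h2 : Good (U (∅ : Finset ι) 0) N
      (fun q _ s => s ^ (2 * (d + 1)) * (if d = 0 then S q.L else 0)) := by
    by_cases hd : d = 0
    · subst hd
      simpa using Good.monomial N (U_S (ι := ι))
    · simpa [hd] using Good.zero
  refine (h1.add h2).congr fun q z _ => Eventually.of_forall fun s => ?_
  rw [xi]; ring

/-- `Δ / y²` near a half-period: a double pole, with coefficients free of `S`. -/
theorem good_disc_div_sq (i : Fin 3) (N : ℕ) :
    Good (U (∅ : Finset ι) 2) N (fun q _ s =>
      s ^ 2 * (disc q.L / q.L.derivWeierstrassP (halfPer q i + s) ^ 2)) := by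
  have hfac : ∀ j, i ≠ j → Good (U (∅ : Finset ι) 1) N (fun q _ s =>
      q.L.weierstrassP (halfPer q i + s - halfPer q j) - ee q j) := by
    intro j hij
    obtain ⟨k, hik, hjk⟩ := exists_third i j hij
    have h1 := (good_weierstrassP_halfPer (ι := ι) k N).mono (W' := U ∅ 1) fun n =>
      U_le _ (by omega) (by omega)
    have h2 : Good (U (∅ : Finset ι) 1) N (fun q _ _ => ee q j) :=
      Good.of_mem (Φ := fun q _ => ee q j) (U_ee j)
    refine (h1.add (h2.const_mul (-1))).congr fun q z _ => Eventually.of_forall fun s => ?_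
    rw [← weierstrassP_halfPer_sub_add q hij hik hjk, add_sub_right_comm]; ring
  have hself : Good (U (∅ : Finset ι) 0) N (fun q _ s =>
      s ^ (2 * 1) * (q.L.weierstrassP (halfPer q i + s - halfPer q i) - ee q i)) := by
    have h1 := good_sq_mul_weierstrassP_sub (ι := ι) i i N
    have h2 := Good.monomial N (U_le ∅ (Nat.zero_le _) (by simp) (U_ee (ι := ι) i) :
      (fun q _ => ee q i) ∈ U (∅ : Finset ι) 0 1)
    refine (h1.add (h2.const_mul (-1))).congr fun q z _ => Eventually.of_forall fun s => ?_
    ring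
  have heven : ∀ j, EvenFam (fun q (_ : ι → ℂ) s =>
      q.L.weierstrassP (halfPer q i + s - halfPer q j) - ee q j) := fun j q z _ =>
    Eventually.of_forall fun s => by
      beta_reduce
      rw [weierstrassP_halfPer_sub_halfPer_neg]
  obtain ⟨j, hij⟩ : ∃ j, i ≠ j := (by decide : ∀ i : Fin 3, ∃ j, i ≠ j) i
  obtain ⟨k, hik, hjk⟩ := exists_third i j hij
  have h := ((hself.empty_mul ((evenFam_pow 1).mul (heven i)) ((hfac j hij).empty_mul (heven j)
    (hfac k hik))).const_mul (-4))
  refine h.congr fun q z _ => ?_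
  filter_upwards [eventually_two_mul_add_notMem q i] with s hs
  rw [disc_div_derivWeierstrassP_sq q hs]
  have e : ∏ l, (q.L.weierstrassP (halfPer q i + s - halfPer q l) - ee q l) =
      (q.L.weierstrassP (halfPer q i + s - halfPer q i) - ee q i) *
      (q.L.weierstrassP (halfPer q i + s - halfPer q j) - ee q j) *
      (q.L.weierstrassP (halfPer q i + s - halfPer q k) - ee q k) := by
    exact sum_fin_three hij hik hjk (M := Additive ℂ) fun l =>
      q.L.weierstrassP (halfPer q i + s - halfPer q l) - ee q l
  rw [e]; ring

end

/-! ### Local expansions of the correlators -/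

theorem prod_eq_prod_orderEmbOfFin {m : ℕ} {M : Type*} [CommMonoid M] (I : Finset (Fin m))
    (g : Fin m → M) : ∏ j ∈ I, g j = ∏ t : Fin I.card, g (I.orderEmbOfFin rfl t) := by
  conv_lhs => rw [← Finset.map_orderEmbOfFin_univ I rfl]
  rw [Finset.prod_map]
  rfl

theorem sum_eq_sum_orderEmbOfFin {m : ℕ} (I : Finset (Fin m))
    (g : Fin m → ℕ) : ∑ j ∈ I, g j = ∑ t : Fin I.card, g (I.orderEmbOfFin rfl t) :=
  prod_eq_prod_orderEmbOfFin (M := Multiplicative ℕ) I g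

theorem U_vecCons_neg {n c D : ℕ} {F : Par → (Fin (n + 1) → ℂ) → ℂ}
    (hF : F ∈ U Finset.univ c D) (q : Par) (v : ℂ) (w : Fin n → ℂ) :
    F q (Matrix.vecCons (-v) w) = F q (Matrix.vecCons v w) := by
  induction hF using Submodule.span_induction with
  | zero => rfl
  | add x y _ _ hx hy => simp [hx, hy]
  | smul a x _ hx => simp [hx]
  | mem F hF =>
    obtain ⟨α, l, i', d, h1, h2, rfl⟩ := hF
    simp only [Fin.prod_univ_succ, Matrix.cons_val_zero, Matrix.cons_val_succ, xi_neg]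

theorem U_halfPer_add_neg {n c D : ℕ} {F : Par → (Fin (n + 1) → ℂ) → ℂ}
    (hF : F ∈ U Finset.univ c D) (q : Par) (i : Fin 3) (s : ℂ) (w : Fin n → ℂ) :
    F q (Matrix.vecCons (halfPer q i + -s) w) = F q (Matrix.vecCons (halfPer q i + s) w) := by
  induction hF using Submodule.span_induction with
  | zero => rfl
  | add x y _ _ hx hy => simp only [Pi.add_apply, hx, hy]
  | smul a x _ hx => simp only [Pi.smul_apply, hx]
  | mem F hF =>
    obtain ⟨α, l, i', d, h1, h2, rfl⟩ := hF
    simp only [Fin.prod_univ_succ, Matrix.cons_val_zero, Matrix.cons_val_succ, xi_halfPer_add_neg]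

/-- The expansion of a universal function in one of its variables near a half-period. -/
theorem good_slot_of_mem {m c D : ℕ} (I : Finset (Fin m)) {F : Par → (Fin (I.card + 1) → ℂ) → ℂ}
    (hF : F ∈ U Finset.univ c D) (i : Fin 3) (N : ℕ) :
    Good (U I c) N (fun q z s =>
      s ^ (2 * (D + 1)) * F q (Matrix.vecCons (halfPer q i + s) (restrict z I))) := by
  induction hF using Submodule.span_induction with
  | zero => simpa using Good.zero
  | add x y _ _ hx hy =>
    refine (hx.add hy).congr fun q z _ => Eventually.of_forall fun s => ?_
    simp only [Pi.add_apply]; ring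
  | smul a x _ hx =>
    refine (hx.const_mul a).congr fun q z _ => Eventually.of_forall fun s => ?_
    simp only [Pi.smul_apply, smul_eq_mul]; ring
  | mem F hF =>
    obtain ⟨α, l, i', d, h1, h2, rfl⟩ := hF
    rw [Fin.sum_univ_succ d] at h1
    set emb := I.orderEmbOfFin rfl
    have hinj : Function.Injective emb := emb.injective
    have hmem : (fun q (z : Fin m → ℂ) => eeMon q α * S q.L ^ l *
        ∏ t : Fin I.card, xi q (i' t.succ) (d t.succ) (z (emb t))) ∈ U I c (D - d 0) := by
      refine Submodule.subset_span ⟨α, l, Function.extend emb (fun t => i' t.succ) 0,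
        Function.extend emb (fun t => d t.succ) 0, ?_, h2, ?_⟩
      · rw [sum_eq_sum_orderEmbOfFin I]
        simp only [emb] at hinj ⊢
        simp only [hinj.extend_apply]
        omega
      · funext q z
        rw [prod_eq_prod_orderEmbOfFin I]
        simp only [emb] at hinj ⊢
        simp only [hinj.extend_apply]
    have hd : d 0 ≤ D := by omega
    have h := (good_xi (ι := Fin m) i (i' 0) (d 0) N).empty_mul
      ((evenFam_pow _).mul (evenFam_xi i (i' 0) (d 0))) (Good.monomial N hmem)
    rw [zero_add] at h
    refine h.congr fun q z _ => Eventually.of_forall fun s => ?_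
    simp only [Fin.prod_univ_succ, Matrix.cons_val_zero, Matrix.cons_val_succ, restrict]
    rw [show 2 * (D + 1) = 2 * (d 0 + 1) + 2 * (D - d 0) by omega, pow_add]
    ring

/-- The expansion of a universal function on the antidiagonal of two of its variables. -/
theorem good_two_slots_of_mem {m c D : ℕ} {F : Par → (Fin (m + 2) → ℂ) → ℂ}
    (hF : F ∈ U Finset.univ c D) (i : Fin 3) (N : ℕ) :
    Good (U (Finset.univ : Finset (Fin m)) c) N (fun q z s => s ^ (2 * (D + 2)) *
      F q (Matrix.vecCons (halfPer q i + s) (Matrix.vecCons (-(halfPer q i + s)) z))) := by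
  induction hF using Submodule.span_induction with
  | zero => simpa using Good.zero
  | add x y _ _ hx hy =>
    refine (hx.add hy).congr fun q z _ => Eventually.of_forall fun s => ?_
    simp only [Pi.add_apply]; ring
  | smul a x _ hx =>
    refine (hx.const_mul a).congr fun q z _ => Eventually.of_forall fun s => ?_
    simp only [Pi.smul_apply, smul_eq_mul]; ring
  | mem F hF =>
    obtain ⟨α, l, i', d, h1, h2, rfl⟩ := hF
    rw [Fin.sum_univ_succ d, Fin.sum_univ_succ fun t => d t.succ, Fin.succ_zero_eq_one] at h1
    have hmem : (fun q (z : Fin m → ℂ) => eeMon q α * S q.L ^ l *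
        ∏ t : Fin m, xi q (i' t.succ.succ) (d t.succ.succ) (z t)) ∈
          U Finset.univ c (D - d 0 - d 1) := by
      refine Submodule.subset_span ⟨α, l, fun t => i' t.succ.succ, fun t => d t.succ.succ, ?_, h2,
        rfl⟩
      beta_reduce
      omega
    have hd : d 0 + d 1 ≤ D := by omega
    have h := (good_xi (ι := Fin m) i (i' 1) (d 1) N).empty_mul
      ((evenFam_pow _).mul (evenFam_xi i (i' 1) (d 1))) (Good.monomial N hmem)
    have h' := (good_xi (ι := Fin m) i (i' 0) (d 0) N).empty_mul
      ((evenFam_pow _).mul (evenFam_xi i (i' 0) (d 0))) h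
    rw [zero_add, zero_add] at h'
    refine h'.congr fun q z _ => Eventually.of_forall fun s => ?_
    simp only [Fin.prod_univ_succ, Matrix.cons_val_zero, Matrix.cons_val_succ, xi_neg,
      Fin.succ_zero_eq_one]
    rw [show 2 * (D + 2) = 2 * (d 0 + 1) + (2 * (d 1 + 1) + 2 * (D - d 0 - d 1)) by omega, pow_add,
      pow_add]
    ring

theorem halfPer_sub_notMem_of_two_mul (q : Par) (i : Fin 3) {w : ℂ} (hw : 2 * w ∉ q.L.lattice) :
    halfPer q i - w ∉ q.L.lattice := by
  rw [← neg_mem_iff, neg_sub]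
  exact sub_halfPer_notMem q i hw

theorem analyticAt_bergman (q : Par) (i : Fin 3) {w : ℂ} (hw : 2 * w ∉ q.L.lattice) :
    AnalyticAt ℂ (fun s => bergman q.L (halfPer q i + s) w) 0 := by
  have h : AnalyticAt ℂ q.L.weierstrassP (halfPer q i + 0 - w) :=
    q.L.analyticOnNhd_weierstrassP _ (by simpa using halfPer_sub_notMem_of_two_mul q i hw)
  exact (AnalyticAt.fun_comp (f := fun s => halfPer q i + s - w) (x := 0) h (by fun_prop)).add
    analyticAt_const

theorem iteratedDeriv_bergman (q : Par) (i : Fin 3) (d : ℕ) {w : ℂ} (hw : 2 * w ∉ q.L.lattice) :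
    iteratedDeriv (2 * d) (fun s => bergman q.L (halfPer q i + s) w) 0 = xi q i d w := by
  have hn := halfPer_sub_notMem_of_two_mul q i hw
  have e : (fun s => bergman q.L (halfPer q i + s) w) =
      fun s => S q.L + q.L.weierstrassP (halfPer q i - w + s) := by
    funext s
    rw [bergman, add_comm, add_sub_right_comm]
  have hP : q.L.weierstrassP (halfPer q i - w) = q.L.weierstrassP (w - halfPer q i) := by
    rw [← q.L.weierstrassP_neg, neg_sub]
  rw [e, xi]
  rcases d with _ | d
  · simp [derivPoly, hP, add_comm]
  · rw [if_neg (by omega), add_zero, iteratedDeriv_const_add (by omega),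
      iteratedDeriv_comp_const_add]
    beta_reduce
    rw [add_zero, iteratedDeriv_weierstrassP _ _ hn, hP]

theorem bergman_symm (L : PeriodPair) (v w : ℂ) : bergman L v w = bergman L w v := by
  rw [bergman, bergman, ← L.weierstrassP_neg, neg_sub]

/-- The even coefficients of `W_{0,2}(r + s, z_j)`, where `r` is a half-period. -/
theorem good_bergman {ι : Type*} (i : Fin 3) (j : ι) (N : ℕ) :
    Good (U {j} 0) N (fun q z s => bergman q.L (halfPer q i + s) (z j)) := by
  refine ⟨fun q z => PowerSeries.mk fun n =>
    iteratedDeriv n (fun s => bergman q.L (halfPer q i + s) (z j)) 0 / n.factorial,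
    fun q z hz => hasTaylor_of_analyticAt (analyticAt_bergman q i (hz j)), fun k _ =>
    ⟨_, U_smul (((2 * k).factorial : ℂ)⁻¹) (U_xi j i k), fun q z hz => ?_⟩⟩
  rw [PowerSeries.coeff_mk, iteratedDeriv_bergman q i k (hz j), div_eq_inv_mul]

/-- The odd Taylor coefficients of `∫ W_{0,2}(z₁, ·)` near a half-period; the even ones, and with
them the base point, do not enter the recursion. -/
theorem hasTaylor_bergmanIntegral (q : Par) (i : Fin 3) {w : ℂ} (hw : 2 * w ∉ q.L.lattice) :
    ∃ p, HasTaylor (fun s => bergmanIntegral q.L q.b w (halfPer q i + s)) p ∧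
      ∀ d, PowerSeries.coeff (2 * d + 1) p = ((2 * d + 1).factorial : ℂ)⁻¹ * xi q i d w := by
  have hopen : IsOpen ((q.L.lattice : Set ℂ)ᶜ) := q.L.isClosed_lattice.isOpen_compl
  have hev : ∀ᶠ s in 𝓝 (0 : ℂ), w - (halfPer q i + s) ∉ q.L.lattice := by
    have ht : Tendsto (fun s => w - (halfPer q i + s)) (𝓝 0) (𝓝 (w - (halfPer q i + 0))) :=
      Continuous.tendsto (by fun_prop) 0
    refine ht.eventually (hopen.mem_nhds ?_)
    rw [add_zero]
    exact sub_halfPer_notMem q i hw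
  have hder : ∀ᶠ s in 𝓝 (0 : ℂ), HasDerivAt
      (fun s => bergmanIntegral q.L q.b w (halfPer q i + s))
      (bergman q.L (halfPer q i + s) w) s := by
    filter_upwards [hev] with s hs
    rw [bergman_symm]
    exact (hasDerivAt_bergmanIntegral q.L q.b w hs).comp_const_add (halfPer q i) s
  have han : AnalyticAt ℂ (fun s => bergmanIntegral q.L q.b w (halfPer q i + s)) 0 := by
    obtain ⟨t, ht, hto, h0⟩ := eventually_nhds_iff.mp hder
    exact DifferentiableOn.analyticAt (s := t)
      (fun s hs => (ht s hs).differentiableAt.differentiableWithinAt) (hto.mem_nhds h0)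
  refine ⟨_, hasTaylor_of_analyticAt han, fun d => ?_⟩
  rw [PowerSeries.coeff_mk, iteratedDeriv_succ', div_eq_inv_mul]
  congr 1
  rw [← iteratedDeriv_bergman q i d hw]
  refine EventuallyEq.iteratedDeriv_eq _ ?_
  filter_upwards [hder] with s hs
  exact hs.deriv

/-- The universal form of the correlator `W_{g,n}` with `2g - 2 + n ≥ 1`. -/
def Rep (g n : ℕ) : Prop :=
  ∃ F ∈ U (Finset.univ : Finset (Fin n)) (2 * (2 * g + n - 2)) (3 * g + n - 3),
    ∀ q z, Dom q z → disc q.L ^ (2 * g + n - 2) * correlator q.L q.b g n z = F q z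

/-- The correlator `W_{a,|I|+1}(r + s, z_I)` near the half-period `r` with label `i`. -/
def slot {m : ℕ} (i : Fin 3) (a : ℕ) (I : Finset (Fin m)) (q : Par) (z : Fin m → ℂ) (s : ℂ) : ℂ :=
  correlator q.L q.b a (I.card + 1) (Matrix.vecCons (halfPer q i + s) (restrict z I))

theorem Dom.restrict {m : ℕ} {q : Par} {z : Fin m → ℂ} (hz : Dom q z) (I : Finset (Fin m)) :
    Dom q (restrict z I) := fun _ => hz _

theorem Dom.vecCons {m : ℕ} {q : Par} {z : Fin m → ℂ} (hz : Dom q z) {v : ℂ}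
    (hv : 2 * v ∉ q.L.lattice) : Dom q (Matrix.vecCons v z) := by
  intro j
  refine Fin.cases ?_ (fun j => ?_) j
  · simpa using hv
  · simpa using hz j

theorem two_mul_neg_notMem {L : PeriodPair} {v : ℂ} (hv : 2 * v ∉ L.lattice) :
    2 * -v ∉ L.lattice := by
  rwa [mul_neg, neg_mem_iff]

theorem correlator_zero_singleton {m : ℕ} (L : PeriodPair) (b v : ℂ) (z : Fin m → ℂ) (j : Fin m) :
    correlator L b 0 (({j} : Finset (Fin m)).card + 1) (Matrix.vecCons v (restrict z {j})) =
      bergman L v (z j) := by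
  have h := correlator_zero_two L b (Matrix.vecCons v (restrict z {j}))
  refine h.trans ?_
  have h0 : 0 < ({j} : Finset (Fin m)).card := by simp
  have hj : restrict z {j} ⟨0, h0⟩ = z j := by
    have := Finset.orderEmbOfFin_mem ({j} : Finset (Fin m)) rfl ⟨0, h0⟩
    rw [restrict, Finset.mem_singleton.mp this]
  rw [← hj]
  rfl

theorem slot_cases {m : ℕ} {a : ℕ} {I : Finset (Fin m)} (h : ¬ (a = 0 ∧ I = ∅)) :
    2 ≤ 2 * a + I.card ∨ a = 0 ∧ ∃ j, I = {j} := by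
  by_cases ha : a = 0
  · have hI : I.card ≠ 0 := fun h0 => h ⟨ha, Finset.card_eq_zero.mp h0⟩
    by_cases h1 : I.card = 1
    · exact Or.inr ⟨ha, Finset.card_eq_one.mp h1⟩
    · left; omega
  · left; omega

theorem good_slot {m : ℕ} (i : Fin 3) {a : ℕ} {I : Finset (Fin m)} (h : ¬ (a = 0 ∧ I = ∅))
    (hrep : 2 ≤ 2 * a + I.card → Rep a (I.card + 1)) (N : ℕ) :
    Good (U I (2 * (2 * a + I.card - 1))) N (fun q z s => s ^ (2 * (3 * a + I.card - 1)) *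
      (disc q.L ^ (2 * a + I.card - 1) * slot i a I q z s)) := by
  rcases slot_cases h with h2 | ⟨rfl, j, rfl⟩
  · obtain ⟨F, hF, hW⟩ := hrep h2
    have h := good_slot_of_mem I hF i N
    rw [show 2 * a + (I.card + 1) - 2 = 2 * a + I.card - 1 by omega] at h hW
    refine h.congr fun q z hz => ?_
    filter_upwards [eventually_two_mul_add_notMem q i] with s hs
    rw [← hW q _ ((hz.restrict I).vecCons hs),
      show 3 * a + (I.card + 1) - 3 + 1 = 3 * a + I.card - 1 by omega, slot]
  · refine (good_bergman i j N).congr fun q z _ => Eventually.of_forall fun s => ?_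
    simp [slot, correlator_zero_singleton]

theorem evenFam_slot {m : ℕ} (i : Fin 3) {a : ℕ} {I : Finset (Fin m)}
    (hrep : Rep a (I.card + 1)) : EvenFam (slot (m := m) i a I) := by
  obtain ⟨F, hF, hW⟩ := hrep
  intro q z hz
  have hev : ∀ᶠ s in 𝓝[≠] (0 : ℂ), 2 * (halfPer q i + -s) ∉ q.L.lattice := by
    filter_upwards [eventually_two_mul_add_notMem q i] with s hs
    have h1 := two_mul_neg_notMem hs
    intro h2
    refine h1 ?_
    have := sub_mem h2 (add_mem (two_mul_halfPer_mem q i) (two_mul_halfPer_mem q i))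
    convert this using 1; ring
  filter_upwards [eventually_two_mul_add_notMem q i, hev] with s hs hs'
  refine mul_left_cancel₀ (pow_ne_zero (2 * a + (I.card + 1) - 2) (disc_ne_zero q)) ?_
  rw [slot, slot, hW q _ ((hz.restrict I).vecCons hs), hW q _ ((hz.restrict I).vecCons hs'),
    U_halfPer_add_neg hF]

/-- Evaluating a correlator at `σ(r + s)` amounts to `s ↦ -s`. -/
theorem slot_neg {m : ℕ} (i : Fin 3) {a : ℕ} {I : Finset (Fin m)} (h : ¬ (a = 0 ∧ I = ∅))
    (hrep : 2 ≤ 2 * a + I.card → Rep a (I.card + 1)) (q : Par) (z : Fin m → ℂ) (hz : Dom q z) :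
    ∀ᶠ s in 𝓝[≠] (0 : ℂ), correlator q.L q.b a (I.card + 1)
      (Matrix.vecCons (-(halfPer q i + s)) (restrict z I)) = slot i a I q z (-s) := by
  rcases slot_cases h with h2 | ⟨rfl, j, rfl⟩
  · filter_upwards [eventually_two_mul_add_notMem q i, evenFam_slot i (hrep h2) q z hz] with s hs hs'
    obtain ⟨F, hF, hW⟩ := hrep h2
    rw [hs']
    refine mul_left_cancel₀ (pow_ne_zero (2 * a + (I.card + 1) - 2) (disc_ne_zero q)) ?_
    rw [slot, hW q _ ((hz.restrict I).vecCons hs),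
      hW q _ ((hz.restrict I).vecCons (two_mul_neg_notMem hs)), U_vecCons_neg hF]
  · refine Eventually.of_forall fun s => ?_
    rw [slot, correlator_zero_singleton, correlator_zero_singleton, bergman, bergman,
      ← weierstrassP_add_mem (two_mul_halfPer_mem q i) (-(halfPer q i + s) - z j)]
    congr 2; ring

/-! ### The recursion in terms of universal functions -/

/-- The bracket of the recursion, up to the sign coming from `d(σ(v)) = -dv`. -/
def bracket (L : PeriodPair) (b : ℂ) (g m : ℕ) (z : Fin m → ℂ) (v : ℂ) : ℂ :=
  (if 1 ≤ g then
    correlator L b (g - 1) (m + 2) (Matrix.vecCons v (Matrix.vecCons (-v) z)) else 0) +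
  ∑ g₁ : Fin (g + 1), ∑ I : Finset (Fin m),
    if ¬ ((g₁ : ℕ) = 0 ∧ I = ∅) ∧ ¬ (g - g₁ = 0 ∧ Iᶜ = ∅) then
      correlator L b g₁ (I.card + 1) (Matrix.vecCons v (restrict z I)) *
      correlator L b (g - g₁) (Iᶜ.card + 1) (Matrix.vecCons (-v) (restrict z Iᶜ))
    else 0

/-- The handle term `W_{g-1,m+2}(v, -v, z)`, where `v = r + s`. -/
theorem good_handle {g m : ℕ} (i : Fin 3) (hrep : 3 ≤ 2 * g + (m + 2) → Rep g (m + 2)) (N : ℕ) :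
    Good (U (Finset.univ : Finset (Fin m)) (2 * (2 * g + m))) N (fun q z s =>
      s ^ (2 * (3 * g + m + 1)) * (disc q.L ^ (2 * g + m) * correlator q.L q.b g (m + 2)
        (Matrix.vecCons (halfPer q i + s) (Matrix.vecCons (-(halfPer q i + s)) z)))) ∧
    EvenFam (fun q (z : Fin m → ℂ) s => correlator q.L q.b g (m + 2)
        (Matrix.vecCons (halfPer q i + s) (Matrix.vecCons (-(halfPer q i + s)) z))) := by
  by_cases h : 3 ≤ 2 * g + (m + 2)
  · obtain ⟨F, hF, hW⟩ := hrep h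
    rw [show 2 * g + (m + 2) - 2 = 2 * g + m by omega] at hF hW
    have hG := good_two_slots_of_mem hF i N
    have hdom : ∀ (q : Par) (z : Fin m → ℂ) (hz : Dom q z) (v : ℂ), 2 * v ∉ q.L.lattice →
        Dom q (Matrix.vecCons v (Matrix.vecCons (-v) z)) := fun q z hz v hv =>
      (hz.vecCons (two_mul_neg_notMem hv)).vecCons hv
    constructor
    · refine hG.congr fun q z hz => ?_
      filter_upwards [eventually_two_mul_add_notMem q i] with s hs
      rw [← hW q _ (hdom q z hz _ hs),
        show 3 * g + (m + 2) - 3 + 2 = 3 * g + m + 1 by omega]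
    · intro q z hz
      have hev : ∀ᶠ s in 𝓝[≠] (0 : ℂ), 2 * (halfPer q i + -s) ∉ q.L.lattice := by
        filter_upwards [eventually_two_mul_add_notMem q i] with s hs h2
        refine two_mul_neg_notMem hs ?_
        have := sub_mem h2 (add_mem (two_mul_halfPer_mem q i) (two_mul_halfPer_mem q i))
        convert this using 1; ring
      filter_upwards [eventually_two_mul_add_notMem q i, hev] with s hs hs'
      refine mul_left_cancel₀ (pow_ne_zero (2 * g + m) (disc_ne_zero q)) ?_
      rw [hW q _ (hdom q z hz _ hs), hW q _ (hdom q z hz _ hs'), U_halfPer_add_neg hF]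
      have hFm : ∀ v w, F q (Matrix.vecCons w (Matrix.vecCons (halfPer q i + -v) z)) =
          F q (Matrix.vecCons w (Matrix.vecCons (halfPer q i + v) z)) := by
        intro v w
        clear hW hG hrep
        induction hF using Submodule.span_induction with
        | zero => rfl
        | add x y _ _ hx hy => simp only [Pi.add_apply, hx, hy]
        | smul a x _ hx => simp only [Pi.smul_apply, hx]
        | mem F hF =>
          obtain ⟨α, l, i', d, h1, h2, rfl⟩ := hF
          simp only [Fin.prod_univ_succ, Matrix.cons_val_zero, Matrix.cons_val_succ,
            xi_halfPer_add_neg]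
      have hFn : ∀ w v, F q (Matrix.vecCons w (Matrix.vecCons (-v) z)) =
          F q (Matrix.vecCons w (Matrix.vecCons v z)) := by
        intro w v
        clear hW hG hrep hFm
        induction hF using Submodule.span_induction with
        | zero => rfl
        | add x y _ _ hx hy => simp only [Pi.add_apply, hx, hy]
        | smul a x _ hx => simp only [Pi.smul_apply, hx]
        | mem F hF =>
          obtain ⟨α, l, i', d, h1, h2, rfl⟩ := hF
          simp only [Fin.prod_univ_succ, Matrix.cons_val_zero, Matrix.cons_val_succ, xi_neg]
      rw [hFn, hFm, hFn]
  · obtain ⟨rfl, rfl⟩ : g = 0 ∧ m = 0 := by omega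
    have e : ∀ (q : Par) (z : Fin 0 → ℂ) (s : ℂ), correlator q.L q.b 0 (0 + 2)
        (Matrix.vecCons (halfPer q i + s) (Matrix.vecCons (-(halfPer q i + s)) z)) =
        q.L.weierstrassP (2 * s) + S q.L := by
      intro q z s
      rw [correlator_zero_two, bergman]
      congr 1
      rw [← weierstrassP_add_mem (add_mem (two_mul_halfPer_mem q i) (zero_mem _)) (2 * s)]
      congr 1
      simp only [Matrix.cons_val_zero, Matrix.cons_val_one]
      ring
    simp only [e]
    constructor
    · have h1 := ((good_sq_mul_weierstrassP (ι := Fin 0) N).comp_two_mul).const_mul (1 / 4)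
      have h2 := Good.monomial N (U_S (ι := Fin 0))
      rw [Finset.univ_eq_empty]
      refine (h1.add h2).congr fun q z _ => Eventually.of_forall fun s => ?_
      simp only [mul_zero, add_zero, zero_add, pow_zero, one_mul, mul_one]
      ring
    · refine fun q z _ => Eventually.of_forall fun s => ?_
      beta_reduce
      rw [mul_neg, q.L.weierstrassP_neg]

theorem good_bracket {g m : ℕ} (hgm : 2 ≤ 2 * g + m)
    (ih : ∀ g' n', 1 ≤ n' → 3 ≤ 2 * g' + n' → 2 * g' + n' < 2 * g + (m + 1) → Rep g' n')
    (i : Fin 3) :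
    Good (U (Finset.univ : Finset (Fin m)) (2 * (2 * g + m - 2))) (3 * g + m - 2) (fun q z s =>
      s ^ (2 * (3 * g + m - 2)) *
        (disc q.L ^ (2 * g + m - 2) * bracket q.L q.b g m z (halfPer q i + s))) ∧
    EvenFam (fun q (z : Fin m → ℂ) s => bracket q.L q.b g m z (halfPer q i + s)) := by
  classical
  set M := 3 * g + m - 2 with hM
  set χ := 2 * g + m - 2 with hχ
  -- the splitting terms, with the second slot evaluated at `r - s`
  set term : Fin (g + 1) → Finset (Fin m) → Par → (Fin m → ℂ) → ℂ → ℂ := fun a I q z s =>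
    if ¬ ((a : ℕ) = 0 ∧ I = ∅) ∧ ¬ (g - a = 0 ∧ Iᶜ = ∅) then
      slot i a I q z s * slot i (g - a) Iᶜ q z (-s) else 0 with hterm
  set handle : Par → (Fin m → ℂ) → ℂ → ℂ := fun q z s => if 1 ≤ g then
    correlator q.L q.b (g - 1) (m + 2) (Matrix.vecCons (halfPer q i + s)
      (Matrix.vecCons (-(halfPer q i + s)) z)) else 0 with hhandle
  have hrepL : ∀ (a : Fin (g + 1)) (I : Finset (Fin m)), ¬ (g - a = 0 ∧ Iᶜ = ∅) →
      2 ≤ 2 * a + I.card → Rep a (I.card + 1) := fun a I h h2 =>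
    ih _ _ (by omega) (by omega) (measure_left a.isLt I h)
  have hrepR : ∀ (a : Fin (g + 1)) (I : Finset (Fin m)), ¬ ((a : ℕ) = 0 ∧ I = ∅) →
      2 ≤ 2 * (g - a) + Iᶜ.card → Rep (g - a) (Iᶜ.card + 1) := fun a I h h2 =>
    ih _ _ (by omega) (by omega) (measure_right a.isLt I h)
  have hbr : ∀ q z, Dom q z → ∀ᶠ s in 𝓝[≠] (0 : ℂ), bracket q.L q.b g m z (halfPer q i + s) =
      handle q z s + ∑ a, ∑ I, term a I q z s := by
    intro q z hz
    have : ∀ᶠ s in 𝓝[≠] (0 : ℂ), ∀ (a : Fin (g + 1)) (I : Finset (Fin m)),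
        (if ¬ ((a : ℕ) = 0 ∧ I = ∅) ∧ ¬ (g - a = 0 ∧ Iᶜ = ∅) then
          correlator q.L q.b a (I.card + 1) (Matrix.vecCons (halfPer q i + s) (restrict z I)) *
          correlator q.L q.b (g - a) (Iᶜ.card + 1)
            (Matrix.vecCons (-(halfPer q i + s)) (restrict z Iᶜ))
          else 0) = term a I q z s := by
      rw [eventually_all]
      intro a
      rw [eventually_all]
      intro I
      by_cases h : ¬ ((a : ℕ) = 0 ∧ I = ∅) ∧ ¬ (g - a = 0 ∧ Iᶜ = ∅)
      · filter_upwards [slot_neg i h.2 (hrepR a I h.1) q z hz] with s hs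
        simp only [hterm, if_pos h, hs]
        rfl
      · simp only [hterm, if_neg h, eventually_true]
    filter_upwards [this] with s hs
    simp only [bracket, hs, hhandle]
  have hhandleE : Good (U (Finset.univ : Finset (Fin m)) (2 * χ)) M (fun q z s =>
      s ^ (2 * M) * (disc q.L ^ χ * handle q z s)) ∧ EvenFam handle := by
    by_cases hg : 1 ≤ g
    · obtain ⟨g, rfl⟩ : ∃ g', g = g' + 1 := ⟨g - 1, by omega⟩
      have h := good_handle i (g := g) (m := m)
        (fun h3 => ih g (m + 2) (by omega) h3 (by omega)) M
      rw [show χ = 2 * g + m by omega]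
      rw [show M = 3 * g + m + 1 by omega] at h ⊢
      simpa only [hhandle, if_pos hg, Nat.add_sub_cancel] using h
    · simp only [hhandle, if_neg hg, mul_zero]
      exact ⟨Good.zero, fun _ _ _ => Eventually.of_forall fun _ => rfl⟩
  have htermG : ∀ a I, Good (U (Finset.univ : Finset (Fin m)) (2 * χ)) M (fun q z s =>
      s ^ (2 * M) * (disc q.L ^ χ * term a I q z s)) := by
    intro a I
    by_cases h : ¬ ((a : ℕ) = 0 ∧ I = ∅) ∧ ¬ (g - a = 0 ∧ Iᶜ = ∅)
    swap
    · simp only [hterm, if_neg h, mul_zero]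
      exact Good.zero
    have g1 := good_slot i h.1 (hrepL a I h.2) M
    have g2 := (good_slot i h.2 (hrepR a I h.1) M).comp_neg
    have hcard : I.card + Iᶜ.card = m := by simp [Finset.card_add_card_compl]
    have ha := a.isLt
    have p1 : 1 ≤ 2 * (a : ℕ) + I.card := by
      rcases slot_cases h.1 with c | ⟨c, j, hj⟩
      · omega
      · rw [hj, Finset.card_singleton]; omega
    have p2 : 1 ≤ 2 * (g - a) + Iᶜ.card := by
      rcases slot_cases h.2 with c | ⟨c, j, hj⟩
      · omega
      · rw [hj, Finset.card_singleton]; omega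
    have p3 : 1 ≤ 3 * (a : ℕ) + I.card := by omega
    have p4 : 1 ≤ 3 * (g - a) + Iᶜ.card := by omega
    have e1 : M = (3 * a + I.card - 1) + (3 * (g - a) + Iᶜ.card - 1) := by omega
    have e2 : χ = (2 * a + I.card - 1) + (2 * (g - a) + Iᶜ.card - 1) := by omega
    have hmul : ∀ D D' : ℕ, ∀ F ∈ U I (2 * (2 * a + I.card - 1)) D,
        ∀ G ∈ U Iᶜ (2 * (2 * (g - a) + Iᶜ.card - 1)) D',
        (fun q z => F q z * G q z) ∈ U (Finset.univ : Finset (Fin m)) (2 * χ) (D + D') := by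
      intro D D' F hF G hG
      have := U_mul disjoint_compl_right hF hG
      rw [Finset.union_compl, ← mul_add, ← e2] at this
      exact this
    have heq : ∀ q z s, s ^ (2 * M) * (disc q.L ^ χ * term a I q z s) =
        (s ^ (2 * (3 * a + I.card - 1)) * (disc q.L ^ (2 * a + I.card - 1) * slot i a I q z s)) *
        ((-s) ^ (2 * (3 * (g - a) + Iᶜ.card - 1)) *
          (disc q.L ^ (2 * (g - a) + Iᶜ.card - 1) * slot i (g - a) Iᶜ q z (-s))) := by
      intro q z s
      rw [e1, e2]
      simp only [hterm, if_pos h]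
      rw [(even_two_mul _).neg_pow, mul_add, pow_add, pow_add]
      ring
    have hdiscE : ∀ n : ℕ, EvenFam (fun q (_ : Fin m → ℂ) _ => disc q.L ^ n) := fun n =>
      evenFam_const fun q _ => disc q.L ^ n
    suffices Good (U (Finset.univ : Finset (Fin m)) (2 * χ)) M (fun q z s =>
        (s ^ (2 * (3 * a + I.card - 1)) * (disc q.L ^ (2 * a + I.card - 1) * slot i a I q z s)) *
        ((-s) ^ (2 * (3 * (g - a) + Iᶜ.card - 1)) *
          (disc q.L ^ (2 * (g - a) + Iᶜ.card - 1) * slot i (g - a) Iᶜ q z (-s)))) from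
      this.congr fun q z _ => Eventually.of_forall fun s => heq q z s
    rcases slot_cases h.1 with c1 | ⟨c1, j, hj⟩
    · exact g1.mul ((evenFam_pow _).mul ((hdiscE _).mul (evenFam_slot i (hrepL a I h.2 c1)))) g2
        fun D D' F hF G hG => hmul D D' F hF G hG
    · rcases slot_cases h.2 with c2 | ⟨c2, j', hj'⟩
      · have he : EvenFam (fun q (z : Fin m → ℂ) s =>
            (-s) ^ (2 * (3 * (g - a) + Iᶜ.card - 1)) *
            (disc q.L ^ (2 * (g - a) + Iᶜ.card - 1) * slot i (g - a) Iᶜ q z (-s))) := by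
          intro q z hz
          filter_upwards [evenFam_slot i (hrepR a I h.1 c2) q z hz] with s hs
          rw [neg_neg, hs, (even_two_mul _).neg_pow]
        have hg := g2.mul he g1 (W'' := U Finset.univ (2 * χ)) fun D D' G hG F hF => by
          have := hmul D' D F hF G hG
          rw [add_comm D' D] at this
          simpa only [mul_comm] using this
        refine hg.congr fun q z _ => Eventually.of_forall fun s => ?_
        exact mul_comm _ _
      · -- the product of two copies of `W_{0,2}` occurs for `g = 0`, `m = 2` only
        have hM0 : M = 0 := by
          have k1 : I.card = 1 := by rw [hj, Finset.card_singleton]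
          have k2 : Iᶜ.card = 1 := by rw [hj', Finset.card_singleton]
          omega
        rw [hM0] at g1 g2 ⊢
        exact g1.mul_zero_order g2 fun F hF G hG => hmul 0 0 F hF G hG
  have htermE : ∀ q z s, ∑ a, ∑ I, term a I q z (-s) = ∑ a, ∑ I, term a I q z s := by
    intro q z s
    rw [← Equiv.sum_comp Fin.revPerm]
    refine Finset.sum_congr rfl fun a _ => ?_
    rw [← Equiv.sum_comp (Function.Involutive.toPerm _ (compl_involutive (α := Finset (Fin m))))]
    refine Finset.sum_congr rfl fun I _ => ?_
    have e1 : ((Fin.revPerm a : Fin (g + 1)) : ℕ) = g - a := by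
      simp only [Fin.revPerm_apply, Fin.val_rev]; omega
    have e2 : g - (g - (a : ℕ)) = a := by have := a.isLt; omega
    simp only [hterm, Function.Involutive.coe_toPerm, e1, e2, compl_compl, neg_neg]
    simp only [and_comm, mul_comm]
  constructor
  · have h := hhandleE.1.add (Good.sum Finset.univ fun a _ =>
      Good.sum Finset.univ fun I _ => htermG a I)
    refine h.congr fun q z hz => ?_
    filter_upwards [hbr q z hz] with s hs
    rw [hs, mul_add, mul_add]
    simp only [Finset.mul_sum]
  · intro q z hz
    have hneg : ∀ᶠ s in 𝓝[≠] (0 : ℂ), bracket q.L q.b g m z (halfPer q i + -s) =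
        handle q z (-s) + ∑ a, ∑ I, term a I q z (-s) := by
      have ht : Tendsto (fun s : ℂ => -s) (𝓝[≠] 0) (𝓝[≠] 0) := by
        refine tendsto_nhdsWithin_iff.mpr ⟨?_, ?_⟩
        · exact (by simpa using (continuous_neg.tendsto (0 : ℂ)) :
            Tendsto (fun s : ℂ => -s) (𝓝 0) (𝓝 0)).mono_left nhdsWithin_le_nhds
        · filter_upwards [self_mem_nhdsWithin] with s hs
          exact neg_ne_zero.mpr hs
      exact ht.eventually (hbr q z hz)
    filter_upwards [hbr q z hz, hneg, hhandleE.2 q z hz] with s h1 h2 h3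
    rw [h1, h2, h3, htermE]

theorem U_mul_xi {m c k : ℕ} {Φ : Par → (Fin m → ℂ) → ℂ} (hΦ : Φ ∈ U Finset.univ c k) (i : Fin 3)
    (d : ℕ) : (fun q z => Φ q (Matrix.vecTail z) * xi q i d (z 0)) ∈
      U (Finset.univ : Finset (Fin (m + 1))) c (k + d) := by
  induction hΦ using Submodule.span_induction with
  | zero => simpa using U_zero _ c (k + d)
  | add x y _ _ hx hy => simpa [add_mul] using U_add hx hy
  | smul a x _ hx => simpa [mul_assoc] using U_smul a hx
  | mem F hF =>
    obtain ⟨α, l, i', d', h1, h2, rfl⟩ := hF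
    refine Submodule.subset_span ⟨α, l, Matrix.vecCons i i', Matrix.vecCons d d', ?_, h2, ?_⟩
    · rw [Fin.sum_univ_succ (Matrix.vecCons d d')]
      simp only [Matrix.cons_val_zero, Matrix.cons_val_succ]
      omega
    · funext q z
      rw [Fin.prod_univ_succ]
      simp only [Matrix.cons_val_zero, Matrix.cons_val_succ, Matrix.vecTail, Function.comp_apply]
      ring

/-- The residue at one half-period, with at most one new factor `Δ⁻¹`. -/
theorem residue_mem {g m : ℕ} (hgm : 2 ≤ 2 * g + m)
    (ih : ∀ g' n', 1 ≤ n' → 3 ≤ 2 * g' + n' → 2 * g' + n' < 2 * g + (m + 1) → Rep g' n')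
    (i : Fin 3) :
    ∃ F ∈ U (Finset.univ : Finset (Fin (m + 1))) (2 * (2 * g + m - 1)) (3 * g + m - 2),
      ∀ q z, Dom q z → disc q.L ^ (2 * g + m - 1) *
        residue (fun v => kernel q.L q.b (z 0) v * -bracket q.L q.b g m (Matrix.vecTail z) v)
          (halfPer q i) = F q z := by
  obtain ⟨hB, hBe⟩ := good_bracket hgm ih i
  set M := 3 * g + m - 2 with hM
  have hD := good_disc_div_sq (ι := Fin m) i M
  have hDe : EvenFam (fun q (_ : Fin m → ℂ) s =>
      s ^ 2 * (disc q.L / q.L.derivWeierstrassP (halfPer q i + s) ^ 2)) := by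
    intro q z _
    refine Eventually.of_forall fun s => ?_
    have : q.L.derivWeierstrassP (halfPer q i + -s) =
        -q.L.derivWeierstrassP (halfPer q i + s) := by
      rw [← q.L.derivWeierstrassP_neg,
        ← derivWeierstrassP_add_mem (two_mul_halfPer_mem q i) (-(halfPer q i + s))]
      congr 1; ring
    beta_reduce
    rw [this, neg_sq, neg_sq]
  have hH := hD.empty_mul hDe hB
  have hHe := hDe.mul ((evenFam_pow M).mul ((evenFam_const (ι := Fin m)
    fun q _ => disc q.L ^ (2 * g + m - 2)).mul hBe))
  rw [show 2 + 2 * (2 * g + m - 2) = 2 * (2 * g + m - 1) by omega] at hH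
  obtain ⟨p, hp, hc⟩ := hH
  choose! Φ hΦ hΦe using hc
  refine ⟨fun q z => ∑ ij ∈ Finset.HasAntidiagonal.antidiagonal M,
    -1 / 2 * ((2 * ij.2 + 1).factorial : ℂ)⁻¹ * (Φ ij.1 q (Matrix.vecTail z) * xi q i ij.2 (z 0)),
    ?_, fun q z hz => ?_⟩
  · refine U_sum (Finset.HasAntidiagonal.antidiagonal M) (F := fun ij q z =>
      -1 / 2 * ((2 * ij.2 + 1).factorial : ℂ)⁻¹ *
        (Φ ij.1 q (Matrix.vecTail z) * xi q i ij.2 (z 0))) fun ij hij => ?_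
    have hs := Finset.HasAntidiagonal.mem_antidiagonal.mp hij
    have h1 := U_smul (-1 / 2 * ((2 * ij.2 + 1).factorial : ℂ)⁻¹)
      (U_mul_xi (hΦ ij.1 (by omega)) i ij.2)
    rw [hs] at h1
    exact h1
  · have hz' : Dom q (Matrix.vecTail z) := fun j => hz _
    obtain ⟨κ, hκ, hκc⟩ := hasTaylor_bergmanIntegral q i (hz 0)
    have hodd := (hp q _ hz').coeff_odd_of_even (hHe q _ hz')
    have hd0 : disc q.L ^ (2 * g + m - 1) ≠ 0 := pow_ne_zero _ (disc_ne_zero q)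
    have hT := (((hp q _ hz').mul hκ).const_mul (-1 / 2)).const_mul
      (disc q.L ^ (2 * g + m - 1))⁻¹
    rw [residue_eq_coeff (N := 2 * M + 1) hT, PowerSeries.coeff_C_mul, mul_inv_cancel_left₀ hd0,
      PowerSeries.coeff_C_mul, coeff_odd_mul hodd, Finset.mul_sum]
    · refine Finset.sum_congr rfl fun ij hij => ?_
      have hs := Finset.HasAntidiagonal.mem_antidiagonal.mp hij
      rw [hΦe _ (by omega) q _ hz', hκc]
      ring
    · filter_upwards [eventually_two_mul_add_notMem q i] with s hs
      have hy := derivWeierstrassP_ne_zero q hs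
      have hd := disc_ne_zero q
      rw [kernel, q.L.derivWeierstrassP_neg,
        show 2 * g + m - 1 = (2 * g + m - 2) + 1 by omega, pow_succ]
      have hd' : disc q.L ^ (2 * g + m - 2) ≠ 0 := pow_ne_zero _ hd
      field_simp
      ring

/-- The correlators of negative Euler characteristic are universal. -/
theorem rep_correlator (g n : ℕ) (hn : 1 ≤ n) (h : 3 ≤ 2 * g + n) : Rep g n := by
  induction hN : 2 * g + n using Nat.strong_induction_on generalizing g n with
  | _ N IH =>
  obtain ⟨m, rfl⟩ : ∃ m, n = m + 1 := ⟨n - 1, by omega⟩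
  have ih : ∀ g' n', 1 ≤ n' → 3 ≤ 2 * g' + n' → 2 * g' + n' < 2 * g + (m + 1) → Rep g' n' :=
    fun g' n' h1 h2 h3 => IH _ (by omega) g' n' h1 h2 rfl
  have hgm : 2 ≤ 2 * g + m := by omega
  choose F hF hFe using residue_mem hgm ih
  refine ⟨fun q z => ∑ i, F i q z, ?_, fun q z hz => ?_⟩
  · rw [show 2 * g + (m + 1) - 2 = 2 * g + m - 1 by omega,
      show 3 * g + (m + 1) - 3 = 3 * g + m - 2 by omega]
    exact U_sum _ fun i _ => hF i
  · rw [show 2 * g + (m + 1) - 2 = 2 * g + m - 1 by omega, correlator_rec q.L q.b g m hgm z,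
      ← Equiv.sum_comp q.perm, Finset.mul_sum]
    exact Finset.sum_congr rfl fun i _ => hFe i q z hz

section

/-! ### Clearing denominators -/

/-- The functions of the marked curve and of `z` spanned by the monomials
`e^α S^l ∏ x(z_j)^{β_j}` of total degree `|α| + l + |β| = d` with `l ≤ K`. -/
def PolyFam (n d K : ℕ) : Submodule ℂ (Par → (Fin n → ℂ) → ℂ) :=
  Submodule.span ℂ {F | ∃ (α : Fin 3 → ℕ) (l : ℕ) (β : Fin n → ℕ),
    ∑ t, α t + l + ∑ j, β j = d ∧ l ≤ K ∧
    F = fun q z => eeMon q α * S q.L ^ l * ∏ j, q.L.weierstrassP (z j) ^ β j}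

variable {n : ℕ}

theorem PolyFam_mono {d K K' : ℕ} (h : K ≤ K') : PolyFam n d K ≤ PolyFam n d K' := by
  refine Submodule.span_mono ?_
  rintro F ⟨α, l, β, h1, h2, rfl⟩
  exact ⟨α, l, β, h1, h2.trans h, rfl⟩

theorem PolyFam_mul {d K d' K' : ℕ} {F G : Par → (Fin n → ℂ) → ℂ} (hF : F ∈ PolyFam n d K)
    (hG : G ∈ PolyFam n d' K') : (fun q z => F q z * G q z) ∈ PolyFam n (d + d') (K + K') := by
  have : F * G ∈ PolyFam n (d + d') (K + K') := by
    induction hF using Submodule.span_induction with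
    | zero => rw [zero_mul]; exact zero_mem _
    | add x y _ _ hx hy => rw [add_mul]; exact add_mem hx hy
    | smul a x _ hx => rw [smul_mul_assoc]; exact Submodule.smul_mem _ _ hx
    | mem F hF =>
      induction hG using Submodule.span_induction with
      | zero => rw [mul_zero]; exact zero_mem _
      | add x y _ _ hx hy => rw [mul_add]; exact add_mem hx hy
      | smul a x _ hx => rw [mul_smul_comm]; exact Submodule.smul_mem _ _ hx
      | mem G hG =>
        obtain ⟨α, l, β, h1, h2, rfl⟩ := hF
        obtain ⟨α', l', β', h1', h2', rfl⟩ := hG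
        refine Submodule.subset_span ⟨α + α', l + l', β + β', ?_, by omega, ?_⟩
        · simp only [Pi.add_apply, Finset.sum_add_distrib]; omega
        · funext q z
          simp only [Pi.mul_apply, Pi.add_apply, eeMon_add, pow_add, Finset.prod_mul_distrib]
          ring
  exact this

theorem PolyFam_one : (fun _ _ => 1) ∈ PolyFam n 0 0 :=
  Submodule.subset_span ⟨0, 0, 0, by simp, le_rfl, by simp [eeMon_zero]⟩

theorem PolyFam_pow {d : ℕ} {F : Par → (Fin n → ℂ) → ℂ} (hF : F ∈ PolyFam n d 0) (m : ℕ) :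
    (fun q z => F q z ^ m) ∈ PolyFam n (d * m) 0 := by
  induction m with
  | zero => simpa using PolyFam_one
  | succ m ih =>
    have h := PolyFam_mul ih hF
    simpa only [pow_succ, Nat.mul_succ, add_zero] using h

theorem PolyFam_prod {τ : Type*} (s : Finset τ) {d K : τ → ℕ} {F : τ → Par → (Fin n → ℂ) → ℂ}
    (hF : ∀ t ∈ s, F t ∈ PolyFam n (d t) (K t)) :
    (fun q z => ∏ t ∈ s, F t q z) ∈ PolyFam n (∑ t ∈ s, d t) (∑ t ∈ s, K t) := by
  classical
  induction s using Finset.induction_on with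
  | empty => simpa using PolyFam_one
  | insert a s ha ih =>
    have h := PolyFam_mul (hF a (Finset.mem_insert_self a s))
      (ih fun t ht => hF t (Finset.mem_insert_of_mem ht))
    simpa only [Finset.prod_insert ha, Finset.sum_insert ha] using h

theorem PolyFam_add {d K : ℕ} {F G : Par → (Fin n → ℂ) → ℂ} (hF : F ∈ PolyFam n d K)
    (hG : G ∈ PolyFam n d K) : (fun q z => F q z + G q z) ∈ PolyFam n d K := add_mem hF hG

theorem PolyFam_sub {d K : ℕ} {F G : Par → (Fin n → ℂ) → ℂ} (hF : F ∈ PolyFam n d K)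
    (hG : G ∈ PolyFam n d K) : (fun q z => F q z - G q z) ∈ PolyFam n d K := sub_mem hF hG

theorem PolyFam_smul {d K : ℕ} (a : ℂ) {F : Par → (Fin n → ℂ) → ℂ} (hF : F ∈ PolyFam n d K) :
    (fun q z => a * F q z) ∈ PolyFam n d K := Submodule.smul_mem _ a hF

theorem PolyFam_eeMon (α : Fin 3 → ℕ) : (fun q _ => eeMon q α) ∈ PolyFam n (∑ t, α t) 0 :=
  Submodule.subset_span ⟨α, 0, 0, by simp, le_rfl, by simp⟩

theorem PolyFam_ee (i : Fin 3) : (fun q _ => ee q i) ∈ PolyFam n 1 0 := by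
  have := PolyFam_eeMon (n := n) (Pi.single i 1)
  simpa [eeMon_single, Finset.sum_pi_single'] using this

theorem PolyFam_S_pow (l : ℕ) : (fun q _ => S q.L ^ l) ∈ PolyFam n l l :=
  Submodule.subset_span ⟨0, l, 0, by simp, le_rfl, by simp [eeMon_zero]⟩

theorem PolyFam_weierstrassP (j : Fin n) :
    (fun q z => q.L.weierstrassP (z j)) ∈ PolyFam n 1 0 := by
  refine Submodule.subset_span ⟨0, 0, Pi.single j 1, by simp, le_rfl, ?_⟩
  funext q z
  rw [Finset.prod_eq_single j] <;> simp +contextual [eeMon_zero]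

theorem PolyFam_weierstrassP_sub_ee (j : Fin n) (i : Fin 3) :
    (fun q z => q.L.weierstrassP (z j) - ee q i) ∈ PolyFam n 1 0 :=
  PolyFam_sub (PolyFam_weierstrassP j) (PolyFam_ee i)

/-- `y(z_j)²` as a polynomial in `x(z_j)` and the `e_i`. -/
theorem PolyFam_ySq (j : Fin n) :
    (fun q z => 4 * ∏ i, (q.L.weierstrassP (z j) - ee q i)) ∈ PolyFam n 3 0 := by
  have h := PolyFam_smul 4 (PolyFam_prod Finset.univ (d := fun _ => 1) (K := fun _ => 0)
    fun i _ => PolyFam_weierstrassP_sub_ee j i)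
  simpa using h

/-- The translate `℘(z_j - r)` has a simple pole only, as a function of `x(z_j)`, which `y²`
cancels. -/
theorem exists_translate_mul_ySq (i : Fin 3) (j : Fin n) : ∃ G ∈ PolyFam n 4 0, ∀ q z, Dom q z →
    q.L.weierstrassP (z j - halfPer q i) * q.L.derivWeierstrassP (z j) ^ 2 = G q z := by
  obtain ⟨k, l, hik, hil, hkl⟩ : ∃ k l : Fin 3, i ≠ k ∧ i ≠ l ∧ k ≠ l := by revert i; decide
  have h1 := PolyFam_mul (PolyFam_ee i) (PolyFam_ySq j)
  have h2 := PolyFam_smul 4 (PolyFam_mul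
    (PolyFam_mul (PolyFam_sub (PolyFam_ee (n := n) i) (PolyFam_ee k))
      (PolyFam_sub (PolyFam_ee i) (PolyFam_ee l)))
    (PolyFam_mul (PolyFam_weierstrassP_sub_ee j k) (PolyFam_weierstrassP_sub_ee j l)))
  refine ⟨_, PolyFam_add h1 h2, fun q z hz => ?_⟩
  have hz1 := notMem_of_two_mul (hz j)
  have ht := mul_translate_eq q hik hil hkl hz1 (sub_halfPer_notMem q i (hz j))
  have hp : ∏ t, (q.L.weierstrassP (z j) - ee q t) = (q.L.weierstrassP (z j) - ee q i) *
      (q.L.weierstrassP (z j) - ee q k) * (q.L.weierstrassP (z j) - ee q l) := by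
    rw [Fin.prod_univ_three]
    have := sum_fin_three hik hil hkl (M := Additive ℂ)
      fun t => Additive.ofMul (q.L.weierstrassP (z j) - ee q t)
    rw [Fin.sum_univ_three] at this
    exact this
  rw [derivWeierstrassP_sq_eq_prod q hz1, ← ht, hp]
  ring

theorem exists_eval_translate_mul_pow (i : Fin 3) (j : Fin n) {k m : ℕ} (hkm : k ≤ m)
    {p : Par → Polynomial ℂ} (hp : p ∈ HomPoly k) :
    ∃ G ∈ PolyFam n (k + 3 * m) 0, ∀ q z, Dom q z →
      (p q).eval (q.L.weierstrassP (z j - halfPer q i)) * q.L.derivWeierstrassP (z j) ^ (2 * m) =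
        G q z := by
  induction hp using Submodule.span_induction with
  | zero => exact ⟨0, zero_mem _, fun q z _ => by simp⟩
  | add x y _ _ hx hy =>
    obtain ⟨G, hG, h⟩ := hx
    obtain ⟨G', hG', h'⟩ := hy
    refine ⟨_, add_mem hG hG', fun q z hz => ?_⟩
    simp only [Pi.add_apply, Polynomial.eval_add, add_mul, h q z hz, h' q z hz]
  | smul a x _ hx =>
    obtain ⟨G, hG, h⟩ := hx
    refine ⟨_, Submodule.smul_mem _ a hG, fun q z hz => ?_⟩
    simp only [Pi.smul_apply, Polynomial.eval_smul, smul_mul_assoc, h q z hz]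
  | mem F hF =>
    obtain ⟨α, t, h1, rfl⟩ := hF
    obtain ⟨G, hG, h⟩ := exists_translate_mul_ySq i j
    have hP := PolyFam_mul (PolyFam_eeMon α)
      (PolyFam_mul (PolyFam_pow hG t) (PolyFam_pow (PolyFam_ySq j) (m - t)))
    rw [show ∑ t, α t + (4 * t + 3 * (m - t)) = k + 3 * m by omega] at hP
    refine ⟨_, hP, fun q z hz => ?_⟩
    rw [← h q z hz, ← derivWeierstrassP_sq_eq_prod q (notMem_of_two_mul (hz j)),
      show m = t + (m - t) by omega, Nat.add_sub_cancel_left]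
    simp only [Polynomial.eval_mul, Polynomial.eval_C, Polynomial.eval_pow, Polynomial.eval_X]
    rw [mul_add, pow_add, pow_mul, pow_mul]
    ring

theorem exists_xi_mul_pow (i : Fin 3) (j : Fin n) {d m : ℕ} (hdm : d + 1 ≤ m) :
    ∃ G ∈ PolyFam n (d + 1 + 3 * m) 1, ∀ q z, Dom q z →
      xi q i d (z j) * q.L.derivWeierstrassP (z j) ^ (2 * m) = G q z := by
  obtain ⟨G, hG, h⟩ := exists_eval_translate_mul_pow i j hdm (derivPoly_mem d)
  have hG1 := PolyFam_mono zero_le_one hG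
  by_cases hd : d = 0
  · subst hd
    have hS := PolyFam_mul (PolyFam_S_pow 1) (PolyFam_pow (PolyFam_ySq j) m)
    refine ⟨_, PolyFam_add hG1 hS, fun q z hz => ?_⟩
    rw [← h q z hz, ← derivWeierstrassP_sq_eq_prod q (notMem_of_two_mul (hz j)), xi, if_pos rfl]
    ring
  · refine ⟨G, hG1, fun q z hz => ?_⟩
    rw [← h q z hz, xi, if_neg hd, add_zero]

/-- Universal functions become polynomials in the `e_i`, `S` and `x(z_j)` after multiplication with
a power of each `y(z_j)`. Each `ξ_{i_j,0}` contributes one further `S`, whence the bound `D + n`. -/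
theorem exists_mul_prod_pow {c D m : ℕ} (hm : D + 1 ≤ m) {F : Par → (Fin n → ℂ) → ℂ}
    (hF : F ∈ U Finset.univ c D) :
    ∃ G ∈ PolyFam n (c + D + n * (1 + 3 * m)) (D + n), ∀ q z, Dom q z →
      F q z * ∏ j, q.L.derivWeierstrassP (z j) ^ (2 * m) = G q z := by
  induction hF using Submodule.span_induction with
  | zero => exact ⟨0, zero_mem _, fun q z _ => by simp⟩
  | add x y _ _ hx hy =>
    obtain ⟨G, hG, h⟩ := hx
    obtain ⟨G', hG', h'⟩ := hy
    refine ⟨_, add_mem hG hG', fun q z hz => ?_⟩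
    simp only [Pi.add_apply, add_mul, h q z hz, h' q z hz]
  | smul a x _ hx =>
    obtain ⟨G, hG, h⟩ := hx
    refine ⟨_, Submodule.smul_mem _ a hG, fun q z hz => ?_⟩
    simp only [Pi.smul_apply, smul_mul_assoc, h q z hz]
  | mem F hF =>
    obtain ⟨α, l, i, d, h1, h2, rfl⟩ := hF
    have hd : ∀ j, d j + 1 ≤ m := fun j => by
      have := Finset.single_le_sum (fun j _ => Nat.zero_le (d j)) (Finset.mem_univ j)
      omega
    choose G hG h using fun j => exists_xi_mul_pow (i j) j (hd j)
    have hP := PolyFam_mul (PolyFam_mul (PolyFam_eeMon α) (PolyFam_S_pow l))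
      (PolyFam_prod Finset.univ fun j _ => hG j)
    have e1 : ∑ j, (d j + 1 + 3 * m) = ∑ j, d j + n * (1 + 3 * m) := by
      simp only [add_assoc, Finset.sum_add_distrib, Finset.sum_const, Finset.card_univ,
        Fintype.card_fin, smul_eq_mul]
      ring
    have e2 : ∑ _j : Fin n, 1 = n := by simp
    rw [e1, e2, ← add_assoc, h1] at hP
    refine ⟨_, PolyFam_mono (by omega) hP, fun q z hz => ?_⟩
    beta_reduce
    rw [mul_assoc, ← Finset.prod_mul_distrib]
    congr 1
    exact Finset.prod_congr rfl fun j _ => h j q z hz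

/-! ### Averaging over the labellings of the half-periods -/

/-- The function `f` of the marked curve is a weighted homogeneous polynomial in `t, u` of
weight `2d`. -/
def SymRep (n d : ℕ) (f : PeriodPair → ℂ) : Prop :=
  ∃ s : MvPolynomial (Fin 2 ⊕ Fin n) ℂ,
    MvPolynomial.IsWeightedHomogeneous (weight n) s (2 * (d : ℤ)) ∧
    ∀ L z, f L = evalCurve s (L, z)

theorem SymRep.add {d : ℕ} {f f' : PeriodPair → ℂ} (h : SymRep n d f) (h' : SymRep n d f') :
    SymRep n d (fun L => f L + f' L) := by
  obtain ⟨s, hs, e⟩ := h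
  obtain ⟨s', hs', e'⟩ := h'
  exact ⟨s + s', hs.add hs', fun L z => by simp [evalCurve, e L z, e' L z]⟩

theorem SymRep.mul {d d' : ℕ} {f f' : PeriodPair → ℂ} (h : SymRep n d f) (h' : SymRep n d' f') :
    SymRep n (d + d') (fun L => f L * f' L) := by
  obtain ⟨s, hs, e⟩ := h
  obtain ⟨s', hs', e'⟩ := h'
  refine ⟨s * s', ?_, fun L z => by simp [evalCurve, e L z, e' L z]⟩
  have := hs.mul hs'
  rwa [← mul_add, ← Nat.cast_add] at this

theorem SymRep.const (a : ℂ) : SymRep n 0 (fun _ => a) :=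
  ⟨MvPolynomial.C a, by simpa using MvPolynomial.isWeightedHomogeneous_C (weight n) a,
    fun L z => by simp [evalCurve]⟩

theorem SymRep.const_mul {d : ℕ} {f : PeriodPair → ℂ} (a : ℂ) (h : SymRep n d f) :
    SymRep n d (fun L => a * f L) := by
  simpa using (SymRep.const a).mul h

theorem SymRep.tPar : SymRep n 2 tPar :=
  ⟨MvPolynomial.X (Sum.inl 0), by
    simpa [weight] using MvPolynomial.isWeightedHomogeneous_X ℂ (weight n) (Sum.inl 0),
    fun L z => by simp [evalCurve]⟩

theorem SymRep.uPar : SymRep n 3 uPar :=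
  ⟨MvPolynomial.X (Sum.inl 1), by
    simpa [weight] using MvPolynomial.isWeightedHomogeneous_X ℂ (weight n) (Sum.inl 1),
    fun L z => by simp [evalCurve]⟩

/-- The power sum `e₁^m + e₂^m + e₃^m`. -/
def powerSum (m : ℕ) (L : PeriodPair) : ℂ := ∑ i, L.weierstrassP (ram L i) ^ m

theorem powerSum_eq (q : Par) (hq : q.perm = 1) (m : ℕ) :
    powerSum m q.L = ee q 0 ^ m + ee q 1 ^ m + ee q 2 ^ m := by
  rw [powerSum, Fin.sum_univ_three]
  simp [ee, halfPer, hq]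

theorem symRep_powerSum (m : ℕ) : SymRep n m (powerSum m) := by
  induction m using Nat.strong_induction_on with
  | _ m ih =>
  rcases m with _ | _ | _ | m
  · have : powerSum 0 = fun _ => 3 := by
      funext L
      simp [powerSum]
    rw [this]
    exact SymRep.const 3
  · have : powerSum 1 = fun _ => 0 := by
      funext L
      rw [powerSum_eq ⟨L, 1, 0⟩ rfl, (ee_relations ⟨L, 1, 0⟩).1]; ring
    rw [zero_add, this]
    exact ⟨0, MvPolynomial.isWeightedHomogeneous_zero _ _ _, fun L z => by simp [evalCurve]⟩
  · have : powerSum 2 = fun L => -1 * tPar L := by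
      funext L
      obtain ⟨h1, h2, -⟩ := ee_relations ⟨L, 1, 0⟩
      rw [powerSum_eq ⟨L, 1, 0⟩ rfl, tPar, h2, h1]; ring
    rw [zero_add, this]
    exact SymRep.tPar.const_mul _
  · -- Newton's recursion, from the cubic equation for the `e_i`
    have : powerSum (m + 3) = fun L => -1 / 2 * (tPar L * powerSum (m + 1) L) +
        -1 / 4 * (uPar L * powerSum m L) := by
      funext L
      have h := cubic_ee ⟨L, 1, 0⟩
      simp only [powerSum_eq ⟨L, 1, 0⟩ rfl, tPar, uPar]
      linear_combination (ee ⟨L, 1, 0⟩ 0 ^ m * h 0 + ee ⟨L, 1, 0⟩ 1 ^ m * h 1 +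
        ee ⟨L, 1, 0⟩ 2 ^ m * h 2) / 4
    have h1 := (SymRep.tPar.mul (ih (m + 1) (by omega))).const_mul (-1 / 2)
    have h2 := (SymRep.uPar.mul (ih m (by omega))).const_mul (-1 / 4)
    rw [show 2 + (m + 1) = m + 3 by ring] at h1
    rw [show 3 + m = m + 3 by ring] at h2
    change SymRep n (m + 3) (powerSum (m + 3))
    rw [this]
    exact h1.add h2

theorem sum_perm_fin_three (f : Equiv.Perm (Fin 3) → ℂ) : ∑ π, f π =
    f 1 + f (Equiv.swap 0 1) + f (Equiv.swap 0 2) + f (Equiv.swap 1 2) +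
      f (Equiv.swap 0 1 * Equiv.swap 1 2) + f (Equiv.swap 1 2 * Equiv.swap 0 1) := by
  have h : (Finset.univ : Finset (Equiv.Perm (Fin 3))) = {1, Equiv.swap 0 1, Equiv.swap 0 2,
      Equiv.swap 1 2, Equiv.swap 0 1 * Equiv.swap 1 2, Equiv.swap 1 2 * Equiv.swap 0 1} := by
    decide
  rw [h]
  repeat rw [Finset.sum_insert (by decide)]
  rw [Finset.sum_singleton]
  ring

/-- The average of a monomial in the `e_i` is a combination of products of power sums. -/
theorem sum_perm_eeMon (L : PeriodPair) (b : ℂ) (α : Fin 3 → ℕ) :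
    ∑ π, eeMon ⟨L, π, b⟩ α =
      powerSum (α 0) L * powerSum (α 1) L * powerSum (α 2) L +
      -1 * (powerSum (α 0 + α 1) L * powerSum (α 2) L) +
      -1 * (powerSum (α 0 + α 2) L * powerSum (α 1) L) +
      -1 * (powerSum (α 1 + α 2) L * powerSum (α 0) L) +
      2 * powerSum (α 0 + α 1 + α 2) L := by
  have s1 : Equiv.swap (0 : Fin 3) 1 2 = 2 := by decide
  have s2 : Equiv.swap (0 : Fin 3) 2 1 = 1 := by decide
  have s3 : Equiv.swap (1 : Fin 3) 2 0 = 0 := by decide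
  rw [sum_perm_fin_three]
  simp only [eeMon, Fin.prod_univ_three, ee, halfPer, powerSum, Fin.sum_univ_three,
    Equiv.Perm.coe_one, id, Equiv.Perm.coe_mul, Function.comp_apply, Equiv.swap_apply_left,
    Equiv.swap_apply_right, s1, s2, s3]
  ring

theorem symRep_sum_perm (b : ℂ) (α : Fin 3 → ℕ) :
    SymRep n (∑ i, α i) (fun L => ∑ π, eeMon ⟨L, π, b⟩ α) := by
  have p := symRep_powerSum (n := n)
  have t0 := ((p (α 0)).mul (p (α 1))).mul (p (α 2))
  have t1 := ((p (α 0 + α 1)).mul (p (α 2))).const_mul (-1)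
  have t2 := ((p (α 0 + α 2)).mul (p (α 1))).const_mul (-1)
  have t3 := ((p (α 1 + α 2)).mul (p (α 0))).const_mul (-1)
  have t4 := (p (α 0 + α 1 + α 2)).const_mul 2
  rw [show α 0 + α 2 + α 1 = α 0 + α 1 + α 2 by ring] at t2
  rw [show α 1 + α 2 + α 0 = α 0 + α 1 + α 2 by ring] at t3
  simp only [sum_perm_eeMon, Fin.sum_univ_three]
  exact (((t0.add t1).add t2).add t3).add t4

/-- The sum over the labellings is a polynomial in `S` whose coefficients are weighted homogeneous
in `t`, `u` and the `x(z_j)`. -/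
theorem exists_sum_perm_eq {d K : ℕ} {G : Par → (Fin n → ℂ) → ℂ} (hG : G ∈ PolyFam n d K) :
    ∃ w : ℕ → MvPolynomial (Fin 2 ⊕ Fin n) ℂ,
      (∀ k, MvPolynomial.IsWeightedHomogeneous (weight n) (w k) (2 * (d : ℤ) - 2 * k)) ∧
      ∀ L b z, ∑ π, G ⟨L, π, b⟩ z =
        ∑ k ∈ Finset.range (K + 1), evalCurve (w k) (L, z) * S L ^ k := by
  induction hG using Submodule.span_induction with
  | zero => exact ⟨0, fun k => MvPolynomial.isWeightedHomogeneous_zero _ _ _, fun L b z => by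
      simp [evalCurve]⟩
  | add x y _ _ hx hy =>
    obtain ⟨w, hw, h⟩ := hx
    obtain ⟨w', hw', h'⟩ := hy
    refine ⟨w + w', fun k => (hw k).add (hw' k), fun L b z => ?_⟩
    simp only [Pi.add_apply, Finset.sum_add_distrib, h, h', evalCurve, map_add, add_mul]
  | smul a x _ hx =>
    obtain ⟨w, hw, h⟩ := hx
    refine ⟨a • w, fun k => ?_, fun L b z => ?_⟩
    · exact Submodule.smul_mem (MvPolynomial.weightedHomogeneousSubmodule ℂ (weight n) _) a (hw k)
    · simp only [Pi.smul_apply, ← Finset.smul_sum, h, evalCurve, MvPolynomial.smul_eval]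
      simp only [smul_eq_mul, Finset.mul_sum, mul_assoc]
  | mem F hF =>
    obtain ⟨α, l, β, h1, h2, rfl⟩ := hF
    obtain ⟨s, hs, h⟩ := symRep_sum_perm (n := n) 0 α
    refine ⟨Pi.single l (s * ∏ j, MvPolynomial.X (Sum.inr j) ^ β j), fun k => ?_, fun L b z => ?_⟩
    · by_cases hk : k = l
      · subst hk
        rw [Pi.single_eq_same]
        have hx : MvPolynomial.IsWeightedHomogeneous (weight n)
            (∏ j, MvPolynomial.X (R := ℂ) (Sum.inr j : Fin 2 ⊕ Fin n) ^ β j)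
            (∑ j, β j • (2 : ℤ)) :=
          MvPolynomial.IsWeightedHomogeneous.prod _ _ _ fun j _ =>
            (MvPolynomial.isWeightedHomogeneous_X ℂ (weight n) (Sum.inr j)).pow (β j)
        have := hs.mul hx
        convert this using 1
        simp only [nsmul_eq_mul, ← Finset.sum_mul, ← Nat.cast_sum]
        rw [← h1]; push_cast; ring
      · rw [Pi.single_eq_of_ne hk]
        exact MvPolynomial.isWeightedHomogeneous_zero _ _ _
    · rw [Finset.sum_eq_single l, Pi.single_eq_same]
      · have e : ∑ π, eeMon ⟨L, π, b⟩ α = evalCurve s (L, z) := h L z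
        simp only [← Finset.sum_mul, e]
        simp only [evalCurve, map_mul, map_prod, map_pow, MvPolynomial.eval_X, Sum.elim_inr]
        ring
      · intro k _ hk
        simp [Pi.single_eq_of_ne hk, evalCurve]
      · intro hl
        exact absurd (Finset.mem_range.mpr (by omega)) hl

/-! ### Scaling -/

theorem prod_zpow_nsmul {σ : Type*} [Fintype σ] {a : ℂ} (ha : a ≠ 0) (w : σ → ℤ) (m : σ →₀ ℕ) :
    ∏ i, (a ^ w i) ^ m i = a ^ Finsupp.weight w m := by
  rw [Finsupp.weight_apply, Finsupp.sum_fintype _ _ (by simp)]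
  induction (Finset.univ : Finset σ) using Finset.cons_induction with
  | empty => simp
  | cons i s hi ih =>
    rw [Finset.prod_cons, Finset.sum_cons, zpow_add₀ ha, ih, ← zpow_natCast, ← zpow_mul,
      nsmul_eq_mul, mul_comm (w i)]

theorem eval_zpow_mul {σ : Type*} [Fintype σ] {w : σ → ℤ} {p : MvPolynomial σ ℂ} {k : ℤ}
    (hp : MvPolynomial.IsWeightedHomogeneous w p k) {a : ℂ} (ha : a ≠ 0) (f : σ → ℂ) :
    MvPolynomial.eval (fun i => a ^ w i * f i) p = a ^ k * MvPolynomial.eval f p := by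
  rw [MvPolynomial.eval_eq', MvPolynomial.eval_eq', Finset.mul_sum]
  refine Finset.sum_congr rfl fun m hm => ?_
  simp only [mul_pow, Finset.prod_mul_distrib]
  rw [prod_zpow_nsmul ha, hp (MvPolynomial.mem_support_iff.mp hm)]
  ring

theorem evalCurve_rho {k : ℤ} {p : MvPolynomial (Fin 2 ⊕ Fin n) ℂ}
    (hp : MvPolynomial.IsWeightedHomogeneous (weight n) p k) {r : ℝ} (hr : 0 < r)
    (q : PeriodPair × (Fin n → ℂ)) :
    evalCurve p (rho r hr q) = ((r ^ (1 / 5 * (k : ℝ)) : ℝ) : ℂ) * evalCurve p q := by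
  have hc := rfac_ne_zero hr
  have ha : (rfac r)⁻¹ ≠ 0 := inv_ne_zero hc
  have e : ((r ^ (1 / 5 * (k : ℝ)) : ℝ) : ℂ) = (rfac r)⁻¹ ^ k := by
    have h1 : (rfac r)⁻¹ = ((r ^ (1 / 5 : ℝ) : ℝ) : ℂ) := by
      have := rfac_pow_inv hr 1
      simpa using this
    rw [h1, ← Complex.ofReal_zpow, ← Real.rpow_intCast, ← Real.rpow_mul hr.le]
  rw [e, evalCurve, evalCurve, ← eval_zpow_mul hp ha]
  congr 1
  congr 1
  funext i
  rcases i with i | j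
  · fin_cases i
    · simp [weight, rho, tPar, PeriodPair.g₂, G_scale]
      norm_cast
      ring
    · simp [weight, rho, uPar, PeriodPair.g₃, G_scale]
      norm_cast
      ring
  · simp [weight, rho, weierstrassP_scale]

end

end WeierstrassTR

end

open WeierstrassTR in
theorem proposition4p2 (g n : ℕ) (hn : 1 ≤ n) (hχ : 1 ≤ 2 * (g : ℤ) - 2 + n) :
    ∃ w : ℕ → MvPolynomial (Fin 2 ⊕ Fin n) ℂ,
      (∀ (L : PeriodPair) (b : ℂ) (z : Fin n → ℂ), (∀ i, 2 * z i ∉ L.lattice) →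
        correlator L b g n z =
          (∑ k ∈ Finset.range (3 * g + 2 * n - 2), evalCurve (w k) (L, z) * S L ^ k) /
            (disc L ^ (2 * (g : ℤ) - 2 + n) *
              ∏ i, L.derivWeierstrassP (z i) ^ (6 * (g : ℤ) - 4 + 2 * n))) ∧
      ∀ k : ℕ, (k : ℤ) ≤ 3 * g - 3 + 2 * n →
        MvPolynomial.IsWeightedHomogeneous (weight n) (w k)
          (14 * (g : ℤ) - 14 - 2 * k + 2 * n * (9 * g + 3 * n - 2)) ∧
        ∀ (r : ℝ) (hr : 0 < r),
          rhoPush r hr (evalCurve (w k)) = fun p =>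
            ((r ^ ((1 / 5 : ℝ) * (14 * (g : ℝ) - 14 - 2 * k + 2 * n * (9 * g + 3 * n - 2))) : ℝ) : ℂ) *
              evalCurve (w k) p := by
  obtain ⟨F, hF, hW⟩ := rep_correlator g n hn (by omega)
  obtain ⟨G, hG, hFG⟩ := exists_mul_prod_pow (m := 3 * g + n - 2) (by omega) hF
  -- the left-hand side does not depend on the labelling, so `G` may be replaced by its average over
  -- the six labellings
  obtain ⟨w, hw, h⟩ := exists_sum_perm_eq (Submodule.smul_mem _ (1 / 6 : ℂ) hG)
  rw [show 3 * g + n - 3 + n + 1 = 3 * g + 2 * n - 2 by omega] at h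
  have hdeg : ∀ k : ℕ, 2 * ((2 * (2 * g + n - 2) + (3 * g + n - 3) +
      n * (1 + 3 * (3 * g + n - 2)) : ℕ) : ℤ) - 2 * k =
      14 * (g : ℤ) - 14 - 2 * k + 2 * n * (9 * g + 3 * n - 2) := by
    intro k
    have a1 : ((2 * g + n - 2 : ℕ) : ℤ) = 2 * g + n - 2 := by omega
    have a2 : ((3 * g + n - 3 : ℕ) : ℤ) = 3 * g + n - 3 := by omega
    have a3 : ((3 * g + n - 2 : ℕ) : ℤ) = 3 * g + n - 2 := by omega
    push_cast [a1, a2, a3]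
    ring
  simp only [hdeg] at hw
  refine ⟨w, fun L b z hz => ?_, fun k _ => ⟨hw k, fun r hr => ?_⟩⟩
  · have hd := disc_ne_zero ⟨L, 1, b⟩
    have hy : ∏ i, L.derivWeierstrassP (z i) ^ (2 * (3 * g + n - 2)) ≠ 0 :=
      Finset.prod_ne_zero_iff.mpr fun i _ =>
        pow_ne_zero _ (derivWeierstrassP_ne_zero ⟨L, 1, b⟩ (hz i))
    have e1 : (2 * (g : ℤ) - 2 + n) = ((2 * g + n - 2 : ℕ) : ℤ) := by omega
    have e2 : (6 * (g : ℤ) - 4 + 2 * n) = ((2 * (3 * g + n - 2) : ℕ) : ℤ) := by omega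
    simp only [e1, e2, zpow_natCast]
    rw [← h L b z, eq_div_iff (mul_ne_zero (pow_ne_zero _ hd) hy)]
    have hπ : ∀ π, G ⟨L, π, b⟩ z = correlator L b g n z * (disc L ^ (2 * g + n - 2) *
        ∏ i, L.derivWeierstrassP (z i) ^ (2 * (3 * g + n - 2))) := by
      intro π
      rw [← hFG ⟨L, π, b⟩ z hz, ← hW ⟨L, π, b⟩ z hz]
      ring
    simp only [Pi.smul_apply, hπ, Finset.sum_const, Finset.card_univ, Fintype.card_perm,
      Fintype.card_fin]
    simp [Nat.factorial]
  · funext p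
    rw [rhoPush, evalCurve_rho (hw k) hr]
    push_cast
    rfl
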